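/- A lattice path from the origin with north and east unit steps is NW-convex if it begins and ends with a north step and no unit cell lies between the path and its upper convex hull. The size of such a path is its length, the compulsory initial north step not counted. Let $\mathcal S$ be the class of NW-convex paths and $S(x)=\sum_{\gamma\in\mathcal S}x^{|\gamma|}$ its generating function, $0<x<1$. **The samplers.** The free sampler with parameter $x$ works as follows. Let $A(x)=\sum_{n\ge1}\varphi(n)x^n$. 1. Draw an index $M\ge 0$ with $\mathbb P(M\le k)=\exp\bigl(-\sum_{j>k}A(x^j)/j\bigr)$. For $1\le j<M$ draw a Poisson number, and for $j=M\geq 1$ a Poisson number conditioned to be nonzero, both of parameter $A(x^j)/j$. Draw that many primitive Christoffel words with parameter $x^j$ and take $j$ copies of each. 2. A primitive Christoffel word with parameter $y$ is drawn as a pair of integers: draw its length $m$ with probability $\varphi(m)y^m/A(y)$, then draw $q$ uniformly in $\{1,\dots,m\}$ until $\gcd(q,m)=1$, and return the word with $m-q$ letters $0$ (east steps) and $q$ letters $1$ (north steps). 3. Sort the words by decreasing slope (merge sort), write them one after the other, and add a north step at the beginning. The exact-size sampler repeats the free sampler independently until a path of size $n$ is obtained; each repetition is a trial. **The cost.** The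 values of the generating functions, of $\varphi$, and of the probabilities that are used are precomputed, and real numbers are handled at unit cost. Drawing the value $k$ of an integer random variable costs $k+1$ (sequential search), the coprimality test costs the number of steps of Euclid's algorithm, copying, writing and measuring cost one step per item or letter, and sorting costs the steps of merge sort. The costs of all trials are added. **Theorem.** For every $0<x<1$, the free sampler with parameter $x$ is a Boltzmann sampler for $\mathcal S$: it outputs each $\gamma\in\mathcal S$ with probability $x^{|\gamma|}/S(x)$. For every $n\ge 0$, the exact-size sampler halts with probability $1$. For every $n\ge1$ the equation $xS'(x)/S(x)=n$ (expected output size equal to $n$) has exactly one solution in $(0,1)$. Let $x_n\in(0,1)$ be this solution or, more generally, let $(x_n)$ be any sequence in $(0,1)$ with $$\frac{x_nS'(x_n)}{S(x_n)}=n+o(n^{2/3}).$$ Then, as $n\to\infty$, the expected number of trials of the exact-size sampler for size $n$, run with parameter $x_n$, is equivalent to $\kappa\,n^{2/3}$, where $$\kappa=\frac{2^{1/6}\,3^{1/3}\,\pi^{5/6}}{\zeta(3)^{1/6}},\qquad |\kappa-4.0755|<10^{-4},$$ and its overall expected cost is $O(n^{5/3}\ln\ln n)$. -/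

import Mathlib

open Filter Topology
open scoped ENNReal

noncomputable section

namespace NWPath

/-! ### NW-convex paths -/

/-- Number of east steps among the first `k` letters of a word (`false` codes an east step,
`true` codes a north step). -/
def east (w : List Bool) (k : ℕ) : ℕ := (w.take k).count false

/-- Number of north steps among the first `k` letters of a word. -/
def north (w : List Bool) (k : ℕ) : ℕ := (w.take k).count true

/-- The lattice points visited by the path from the origin coded by `w`, in the plane. -/
def points (w : List Bool) : Set (ℝ × ℝ) :=
  {P | ∃ k ≤ w.length, P = ((east w k : ℝ), (north w k : ℝ))}

/-- The closed unit cell with lower left corner `(i, j)`. -/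
def unitCell (i j : ℤ) : Set (ℝ × ℝ) :=
  Set.Icc (i : ℝ) (i + 1) ×ˢ Set.Icc (j : ℝ) (j + 1)

/-- The unit cell with lower left corner `(i, j)` lies above the path coded by `w`: the east step
of the path from abscissa `i` to abscissa `i + 1` is at height at most `j`. -/
def CellAbove (w : List Bool) (i j : ℤ) : Prop :=
  ∃ k, w[k]? = some false ∧ (east w k : ℤ) = i ∧ (north w k : ℤ) ≤ j

/-- A path is NW-convex if it begins and ends with a north step and no unit cell lies between the
path and its upper convex hull, that is, inside the convex hull of the path and above the path. -/
def IsNWConvex (w : List Bool) : Prop :=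
  w.head? = some true ∧ w.getLast? = some true ∧
    ∀ i j : ℤ, unitCell i j ⊆ convexHull ℝ (points w) → ¬ CellAbove w i j

/-- The size of a NW-convex path: its length, the compulsory initial north step not counted. -/
def size (w : List Bool) : ℕ := w.length - 1

/-- The generating function of NW-convex paths counted by size. -/
def genFun (x : ℝ) : ℝ := ∑' w : {w : List Bool // IsNWConvex w}, x ^ size w.1

/-- The expected size `x S'(x) / S(x)` of a Boltzmann distributed NW-convex path. -/
def meanSize (x : ℝ) : ℝ := x * deriv genFun x / genFun x

/-! ### Random algorithms with a step count -/

/-- The behaviour of a random algorithm with outputs in `α`: `m (a, c)` is the probability that it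
halts with output `a` after exactly `c` elementary steps. The missing mass is the probability that
it never halts. -/
def Algo (α : Type) : Type := α × ℕ → ℝ≥0∞

namespace Algo

variable {α β : Type}

open Classical in
/-- Return `a` at no cost. -/
protected def pure (a : α) : Algo α := fun z => if z = (a, 0) then 1 else 0

/-- Run `m`, then run `f` on its output with fresh randomness; the step counts add up. -/
protected def bind (m : Algo α) (f : α → Algo β) : Algo β := fun z =>
  ∑' a : α, ∑ c ∈ Finset.HasAntidiagonal.antidiagonal z.2, m (a, c.1) * f a (z.1, c.2)

instance : Monad Algo where
  pure := Algo.pure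
  bind := Algo.bind

open Classical in
/-- Spend `c` elementary steps. -/
def tick (c : ℕ) : Algo Unit := fun z => if z = ((), c) then 1 else 0

/-- Draw an integer `k` with probability `f k` by sequential search in the table of the
probabilities `f 0, f 1, …`; this takes `k + 1` steps. -/
def draw (f : ℕ → ℝ) : Algo ℕ := fun z => if z.2 = z.1 + 1 then ENNReal.ofReal (f z.1) else 0

/-- The event that independent runs of `m` give `k` rejected outputs followed by an accepted one;
the output is the accepted one, the cost is that of all `k + 1` runs. -/
def rejections (m : Algo α) (ok : α → Bool) : ℕ → Algo α
  | 0 => fun z => if ok z.1 then m z else 0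
  | k + 1 => Algo.bind (fun z => if ok z.1 then 0 else m z) fun _ => rejections m ok k

/-- Run `m` repeatedly and independently until its output is accepted by `ok`; return the accepted
output and the number of runs (trials). -/
def repeatUntil (m : Algo α) (ok : α → Bool) : Algo (α × ℕ)
  | ((_, 0), _) => 0
  | ((a, k + 1), c) => rejections m ok k (a, c)

/-- The probability of the output `a`. -/
def law (m : Algo α) (a : α) : ℝ≥0∞ := ∑' c, m (a, c)

/-- The probability of halting. -/
def haltProb (m : Algo α) : ℝ≥0∞ := ∑' z, m z

/-- The expected value of a function of the output. -/
def expect (m : Algo α) (f : α → ℝ≥0∞) : ℝ≥0∞ := ∑' z, m z * f z.1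

/-- The expected number of steps. -/
def expectedCost (m : Algo α) : ℝ≥0∞ := ∑' z, m z * (z.2 : ℝ≥0∞)

end Algo

open Algo

/-! ### Drawing primitive Christoffel words

A primitive Christoffel word with `p` letters `0` and `q` letters `1` is represented by the pair
`(p, q)` of coprime integers, `p ≥ 0`, `q > 0`. -/

/-- The generating function `∑ φ(n) x ^ n` of primitive Christoffel words. -/
def christoffelGF (x : ℝ) : ℝ := ∑' n : ℕ, (Nat.totient n : ℝ) * x ^ n

/-- Probability that the Boltzmann sampler with parameter `x` for primitive Christoffel words
chooses the length `n`. -/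
def lengthProb (x : ℝ) (n : ℕ) : ℝ := (Nat.totient n : ℝ) * x ^ n / christoffelGF x

/-- The uniform distribution on `{1, …, n}`. -/
def uniformProb (n k : ℕ) : ℝ := if 1 ≤ k ∧ k ≤ n then 1 / (n : ℝ) else 0

/-- Number of calls made by Euclid's algorithm on `(a, b)`. -/
def euclidSteps (a b : ℕ) : ℕ :=
  if h : b = 0 then 1 else
    have : a % b < b := Nat.mod_lt a (Nat.pos_of_ne_zero h)
    1 + euclidSteps b (a % b)
termination_by b

/-- The Boltzmann sampler for primitive Christoffel words: draw the length `n`, then draw `q`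
uniformly in `{1, …, n}` until Euclid's algorithm finds `q` coprime to `n`. -/
def drawChristoffel (x : ℝ) : Algo (ℕ × ℕ) := do
  let n ← draw (lengthProb x)
  let r ← repeatUntil
    (do
      let q ← draw (uniformProb n)
      tick (euclidSteps n q)
      pure q)
    (fun q => Nat.gcd n q == 1)
  pure (n - r.1, r.1)

/-! ### Drawing multisets of primitive Christoffel words -/

/-- Mean of the Poisson number of words that are drawn with parameter `x ^ j` (and then copied
`j` times each). -/
def rate (x : ℝ) (j : ℕ) : ℝ := christoffelGF (x ^ j) / j

/-- Distribution function of the largest index `j ≥ 1` for which the Poisson number with mean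
`rate x j` is nonzero (`0` if there is none). -/
def maxIndexCDF (x : ℝ) (k : ℕ) : ℝ := Real.exp (-∑' i : ℕ, rate x (k + 1 + i))

/-- Distribution of the largest index. -/
def maxIndexProb (x : ℝ) : ℕ → ℝ
  | 0 => maxIndexCDF x 0
  | k + 1 => maxIndexCDF x (k + 1) - maxIndexCDF x k

/-- The Poisson distribution with mean `l`. -/
def poissonProb (l : ℝ) (k : ℕ) : ℝ := Real.exp (-l) * l ^ k / (Nat.factorial k : ℝ)

/-- The Poisson distribution with parameter `l`, conditioned to be nonzero. -/
def posPoissonProb (l : ℝ) (k : ℕ) : ℝ :=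
  if k = 0 then 0 else poissonProb l k / (1 - Real.exp (-l))

/-- Draw `r` words with parameter `x ^ j` and add `j` copies of each to `acc`. -/
def addWords (x : ℝ) (j : ℕ) : ℕ → List (ℕ × ℕ) → Algo (List (ℕ × ℕ))
  | 0, acc => pure acc
  | r + 1, acc => do
    let w ← drawChristoffel (x ^ j)
    tick j
    addWords x j r (List.replicate j w ++ acc)

/-- Treat the indices `j = i, i - 1, …, 1`, where `M` is the largest index. -/
def addBlocks (x : ℝ) (M : ℕ) : ℕ → List (ℕ × ℕ) → Algo (List (ℕ × ℕ))
  | 0, acc => pure acc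
  | i + 1, acc => do
    let r ← draw (if i + 1 = M then posPoissonProb (rate x (i + 1))
      else poissonProb (rate x (i + 1)))
    let acc' ← addWords x (i + 1) r acc
    addBlocks x M i acc'

/-- The Boltzmann sampler for multisets of primitive Christoffel words: draw the largest index
`M`, then the words of the indices `1, …, M`. -/
def drawMultiset (x : ℝ) : Algo (List (ℕ × ℕ)) := do
  let M ← draw (maxIndexProb x)
  addBlocks x M M []

/-! ### From a multiset to a NW-convex path -/

/-- Merge two lists that are sorted by decreasing slope `q / p`; the second component counts the
steps. -/
def merge : List (ℕ × ℕ) → List (ℕ × ℕ) → List (ℕ × ℕ) × ℕ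
  | [], v => (v, 1)
  | a :: u, [] => (a :: u, 1)
  | a :: u, b :: v =>
    if b.2 * a.1 ≤ a.2 * b.1 then
      (a :: (merge u (b :: v)).1, (merge u (b :: v)).2 + 1)
    else
      (b :: (merge (a :: u) v).1, (merge (a :: u) v).2 + 1)
termination_by u v => u.length + v.length

/-- Merge sort by decreasing slope with recursion depth `d`; the second component counts the
steps. -/
def mergeSort : ℕ → List (ℕ × ℕ) → List (ℕ × ℕ) × ℕ
  | 0, l => (l, 1)
  | d + 1, l =>
    let s := mergeSort d (l.take (l.length / 2))
    let t := mergeSort d (l.drop (l.length / 2))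
    let m := merge s.1 t.1
    (m.1, l.length + s.2 + t.2 + m.2)

/-- The word of the highest path from `(0, 0)` to `(p, q)` that stays under the segment between
these points: after `k` steps its height is `⌊q k / (p + q)⌋`. -/
def christoffelWord (p q : ℕ) : List Bool :=
  (List.range (p + q)).map fun k => decide (q * k / (p + q) < q * (k + 1) / (p + q))

/-- Sort the words by decreasing slope, write them out and add a north step at the beginning. -/
def toPath (l : List (ℕ × ℕ)) : Algo (List Bool) := do
  let s := mergeSort (Nat.clog 2 l.length) l
  tick s.2
  let w := true :: s.1.flatMap fun c => christoffelWord c.1 c.2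
  tick w.length
  pure w

/-- The free sampler for NW-convex paths. -/
def freeSampler (x : ℝ) : Algo (List Bool) := do
  let l ← drawMultiset x
  toPath l

/-- The exact-size sampler: run the free sampler and measure its output, until a path of size `n`
is obtained. It returns that path and the number of trials. -/
def exactSampler (x : ℝ) (n : ℕ) : Algo (List Bool × ℕ) :=
  repeatUntil
    (do
      let w ← freeSampler x
      tick w.length
      pure w)
    (fun w => size w == n)

/-- `m` is a free Boltzmann sampler with parameter `x` for NW-convex paths. -/
def IsBoltzmannSampler (m : Algo (List Bool)) (x : ℝ) : Prop :=
  (∀ w, IsNWConvex w → m.law w = ENNReal.ofReal (x ^ size w / genFun x)) ∧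
    ∀ w, ¬ IsNWConvex w → m.law w = 0

/-- The expected number of trials of the exact-size sampler. -/
def expectedTrials (x : ℝ) (n : ℕ) : ℝ≥0∞ :=
  (exactSampler x n).expect fun r => (r.2 : ℝ≥0∞)

/-- The constant `2^(1/6) 3^(1/3) π^(5/6) / ζ(3)^(1/6)`. -/
def kappa : ℝ :=
  2 ^ (1 / 6 : ℝ) * 3 ^ (1 / 3 : ℝ) * Real.pi ^ (5 / 6 : ℝ) / (riemannZeta 3).re ^ (1 / 6 : ℝ)

end NWPath

end

/-! Combinatorics. After its initial north step, a NW-convex path is a concatenation of primitive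
Christoffel words in order of decreasing slope, uniquely. The shortest prefix of maximal slope must
follow its chord as closely as the lattice allows, since otherwise a unit cell fits under the hull;
it is therefore a Christoffel word, and it can be removed (`exists_pathWord`). Conversely, in a
sorted concatenation every cell above an east step crosses the supporting line of the word that
contains this step (`isNWConvex_of_sorted`). Paths thus correspond to multisets of coprime pairs,
with additive size.

Law of the sampler. A block of index `j` acts on functions of multisets as the exponential of the
operator "add `j` copies of a word", divided by `j`. Multiplication by the multiplicity of a word
behaves as a derivation with respect to these operators, so an induction on the multiset shows that
the blocks together give each multiset the product of the weights of its elements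
(`blockOp_single`). Conditioning the last block to be nonzero is compensated by the law of `M`
(`expect_drawMultiset`). As the sampler halts with probability one, this also yields `S(x) = exp(∑
A(x^j)/j)`.

Rejection. If `p` is the probability of size `n`, then the mean number of trials is `1/p`, and the
mean total cost is `1/p` times the mean cost of one trial (`expectedCost_repeatUntil`).

Probability of size `n`. Put `x = e^{-t}`. Then `log S = ∑ φ(m)/j e^{-jmt}`, whose derivatives are,
up to sign, the cumulants of the size (`moment`). From `φ = μ * id` and Tannery's theorem, `t^3`
times the mean tends to `2 ζ(3)/ζ(2)` and `t^4` times the variance tends to `6 ζ(3)/ζ(2)`. Fourier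
inversion with `θ = u t^2` and dominated convergence give a Gaussian local limit theorem
(`tendsto_sizeProb`). Near `0` the Taylor expansion dominates the characteristic function; farther
away, `φ(m) ≥ 1` permits a comparison with a geometric series. A calibration error `o(n^{2/3})` is
negligible against the standard deviation, and `n t^3 → 2 ζ(3)/ζ(2)` converts the result into `p ~
n^{-2/3}/κ`.

Cost of a trial. The Mecke formula bounds the mean size and the first two moments of the number of
words, hence the cost of one trial by `O(t^{-3}) = O(n)` (`exists_expectedCost_trial_le`). The total
is `O(n^{5/3})`, which is stronger than the stated bound. -/

namespace NWPath

/-! ### Prefix counts -/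

theorem north_add_east {w : List Bool} {k : ℕ} (hk : k ≤ w.length) :
    north w k + east w k = k := by
  have h := List.length_eq_countP_add_countP (p := fun b => b == true) (l := w.take k)
  have e : east w k = List.countP (fun b => !(b == true)) (w.take k) := by
    unfold east List.count
    congr 1
    funext b
    cases b <;> rfl
  have n : north w k = List.countP (fun b => b == true) (w.take k) := rfl
  rw [List.length_take, min_eq_left hk] at h
  rw [e, n]
  simpa using h.symm

@[simp] theorem north_zero (w : List Bool) : north w 0 = 0 := by simp [north]

@[simp] theorem east_zero (w : List Bool) : east w 0 = 0 := by simp [east]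

theorem north_succ {w : List Bool} {k : ℕ} (hk : k < w.length) :
    north w (k + 1) = north w k + if w[k] = true then 1 else 0 := by
  unfold north
  rw [List.take_add_one, List.getElem?_eq_getElem hk, List.count_append]
  cases w[k] <;> simp

theorem east_succ {w : List Bool} {k : ℕ} (hk : k < w.length) :
    east w (k + 1) = east w k + if w[k] = false then 1 else 0 := by
  unfold east
  rw [List.take_add_one, List.getElem?_eq_getElem hk, List.count_append]
  cases w[k] <;> simp

theorem north_append (u v : List Bool) (k : ℕ) :
    north (u ++ v) (u.length + k) = north u u.length + north v k := by
  simp [north, List.take_append, List.take_of_length_le (Nat.le_add_right u.length k)]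

theorem east_append (u v : List Bool) (k : ℕ) :
    east (u ++ v) (u.length + k) = east u u.length + east v k := by
  simp [east, List.take_append, List.take_of_length_le (Nat.le_add_right u.length k)]

theorem north_append_left {u : List Bool} (v : List Bool) {k : ℕ} (hk : k ≤ u.length) :
    north (u ++ v) k = north u k := by
  simp [north, List.take_append, Nat.sub_eq_zero_of_le hk]

theorem east_append_left {u : List Bool} (v : List Bool) {k : ℕ} (hk : k ≤ u.length) :
    east (u ++ v) k = east u k := by
  simp [east, List.take_append, Nat.sub_eq_zero_of_le hk]

@[simp] theorem north_cons_true (u : List Bool) (k : ℕ) :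
    north (true :: u) (k + 1) = north u k + 1 := by
  simp [north]

@[simp] theorem east_cons_true (u : List Bool) (k : ℕ) :
    east (true :: u) (k + 1) = east u k := by
  simp [east]

theorem eq_of_north {u v : List Bool} (h : u.length = v.length)
    (hn : ∀ k ≤ u.length, north u k = north v k) : u = v := by
  refine List.ext_getElem h fun k h1 h2 => ?_
  have a := north_succ h1
  have b := north_succ h2
  rw [hn _ h1, hn _ h1.le, b] at a
  cases hu : u[k] <;> cases hv : v[k] <;> simp_all

/-! ### Christoffel words -/

@[simp] theorem length_christoffelWord (p q : ℕ) : (christoffelWord p q).length = p + q := by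
  simp [christoffelWord]

/-- Since `q ≤ p + q`, the floor of `q k / (p + q)` increases by `0` or `1` at each step, so that
letters which only record whether it increases determine it. -/
theorem north_christoffelWord {p q k : ℕ} (hk : k ≤ p + q) :
    north (christoffelWord p q) k = q * k / (p + q) := by
  induction k with
  | zero => simp
  | succ k ih =>
    have hk' : k < (christoffelWord p q).length := by simpa using hk
    rw [north_succ hk', ih (by omega)]
    have hpos : 0 < p + q := by omega
    have hmono : q * k / (p + q) ≤ q * (k + 1) / (p + q) :=
      Nat.div_le_div_right (by nlinarith)
    have hstep : q * (k + 1) / (p + q) ≤ q * k / (p + q) + 1 := by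
      rw [← Nat.add_div_right _ hpos]
      exact Nat.div_le_div_right (by nlinarith)
    simp only [christoffelWord, List.getElem_map, List.getElem_range, decide_eq_true_eq]
    split_ifs with h <;> omega

theorem north_christoffelWord_length {p q : ℕ} (h : 0 < q) :
    north (christoffelWord p q) (p + q) = q := by
  rw [north_christoffelWord le_rfl, Nat.mul_div_cancel _ (by omega)]

theorem east_christoffelWord_length {p q : ℕ} (h : 0 < q) :
    east (christoffelWord p q) (p + q) = p := by
  have := north_add_east (w := christoffelWord p q) (k := p + q) (by simp)
  rw [north_christoffelWord_length h] at this
  omega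

/-- The points of a Christoffel word lie on or under its chord. -/
theorem north_mul_le_christoffelWord {p q k : ℕ} (hk : k ≤ p + q) :
    north (christoffelWord p q) k * p ≤ q * east (christoffelWord p q) k := by
  have h1 := north_add_east (w := christoffelWord p q) (k := k) (by simpa using hk)
  have h2 : north (christoffelWord p q) k * (p + q) ≤ q * k := by
    rw [north_christoffelWord hk]; exact Nat.div_mul_le_self _ _
  nlinarith

/-- The upper left corner of the cell on top of an east step lies strictly above the chord. -/
theorem lt_north_mul_of_east_step {p q k : ℕ} (hk : k < p + q)
    (h : (christoffelWord p q)[k]'(by simpa using hk) = false) :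
    q * east (christoffelWord p q) k < (north (christoffelWord p q) k + 1) * p := by
  have hk' : k < (christoffelWord p q).length := by simpa using hk
  have h0 := north_add_east hk'.le
  have h1 : north (christoffelWord p q) (k + 1) = north (christoffelWord p q) k := by
    rw [north_succ hk', h]; simp
  rw [north_christoffelWord hk] at h1
  have h2 : q * (k + 1) < (north (christoffelWord p q) k + 1) * (p + q) := by
    rw [← h1, mul_comm _ (p + q)]
    exact Nat.lt_mul_div_succ _ (by omega)
  nlinarith

theorem christoffelWord_ne_nil {p q : ℕ} (h : 0 < q) : christoffelWord p q ≠ [] := by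
  rw [← List.length_pos_iff]; simp; omega

theorem getLast?_christoffelWord {p q : ℕ} (h : 0 < q) :
    (christoffelWord p q).getLast? = some true := by
  have hk : p + q - 1 < (christoffelWord p q).length := by simp; omega
  rw [List.getLast?_eq_getElem?, length_christoffelWord, List.getElem?_eq_getElem hk]
  congr 1
  simp only [christoffelWord, List.getElem_map, List.getElem_range, decide_eq_true_eq]
  rw [Nat.sub_add_cancel (by omega), Nat.mul_div_cancel _ (by omega),
    Nat.div_lt_iff_lt_mul (by omega)]
  exact Nat.mul_lt_mul_of_pos_left (by omega) h

/-! ### Concatenations of Christoffel words -/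

/-- The pair of coprime integers represents a primitive Christoffel word. -/
def IsPrim (c : ℕ × ℕ) : Prop := Nat.Coprime c.1 c.2 ∧ 0 < c.2

/-- The slope of `c` is at least that of `d`. -/
def Steeper (c d : ℕ × ℕ) : Prop := d.2 * c.1 ≤ c.2 * d.1

theorem Steeper.trans {c d e : ℕ × ℕ} (hd : 0 < d.2) (h1 : Steeper c d) (h2 : Steeper d e) :
    Steeper c e := by
  unfold Steeper at *
  have h1' := Nat.mul_le_mul_left e.2 h1
  have h2' := Nat.mul_le_mul_left c.2 h2
  refine Nat.le_of_mul_le_mul_left (?_ : d.2 * _ ≤ d.2 * _) hd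
  nlinarith

/-- Equal slopes force equal pairs because both fractions are in lowest terms. This makes a sorted
list of primitive pairs unique. -/
theorem Steeper.antisymm {c d : ℕ × ℕ} (hc : IsPrim c) (hd : IsPrim d) (h1 : Steeper c d)
    (h2 : Steeper d c) : c = d := by
  have h : d.2 * c.1 = c.2 * d.1 := le_antisymm h1 h2
  have e2 : c.2 = d.2 := by
    refine Nat.dvd_antisymm ?_ ?_
    · exact (hc.1.symm).dvd_of_dvd_mul_right (h ▸ Dvd.intro _ rfl)
    · exact (hd.1.symm).dvd_of_dvd_mul_right (h ▸ Dvd.intro _ rfl)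
  refine Prod.ext ?_ e2
  rw [e2] at h
  exact Nat.eq_of_mul_eq_mul_left hd.2 h

/-- The concatenation of the Christoffel words of a list of pairs. -/
def pathWord (l : List (ℕ × ℕ)) : List Bool := l.flatMap fun c => christoffelWord c.1 c.2

@[simp] theorem pathWord_nil : pathWord [] = [] := rfl

@[simp] theorem pathWord_cons (c : ℕ × ℕ) (l : List (ℕ × ℕ)) :
    pathWord (c :: l) = christoffelWord c.1 c.2 ++ pathWord l := rfl

@[simp] theorem pathWord_append (l l' : List (ℕ × ℕ)) :
    pathWord (l ++ l') = pathWord l ++ pathWord l' := by simp [pathWord]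

/-- Points of a concatenation of words of slope at most that of `d` lie under the line of
direction `d` through the origin. -/
theorem north_mul_le_pathWord {d : ℕ × ℕ} {l : List (ℕ × ℕ)} (hl : ∀ c ∈ l, 0 < c.2)
    (hd : ∀ c ∈ l, Steeper d c) {k : ℕ} (hk : k ≤ (pathWord l).length) :
    north (pathWord l) k * d.1 ≤ d.2 * east (pathWord l) k := by
  induction l generalizing k with
  | nil => simp at hk; simp [hk]
  | cons c l ih =>
    have hc := hl c (by simp)
    have hs : c.2 * d.1 ≤ d.2 * c.1 := hd c (by simp)
    rw [pathWord_cons] at hk ⊢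
    rcases le_total k (christoffelWord c.1 c.2).length with h | h
    · rw [north_append_left _ h, east_append_left _ h]
      rw [length_christoffelWord] at h
      have h1 := north_mul_le_christoffelWord h
      have h1' := Nat.mul_le_mul_left d.2 h1
      have h2 := Nat.mul_le_mul_left (north (christoffelWord c.1 c.2) k) hs
      refine Nat.le_of_mul_le_mul_left (?_ : c.2 * _ ≤ c.2 * _) hc
      nlinarith
    · obtain ⟨j, rfl⟩ := Nat.exists_eq_add_of_le h
      rw [north_append, east_append]
      have := ih (fun c' h' => hl c' (by simp [h'])) (fun c' h' => hd c' (by simp [h']))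
        (k := j) (by simp at hk ⊢; omega)
      rw [length_christoffelWord, north_christoffelWord_length hc, east_christoffelWord_length hc]
      nlinarith

/-- Points of a concatenation of words of slope at least that of `d` lie under the line of
direction `d` through its end. -/
theorem pathWord_le_end {d : ℕ × ℕ} {l : List (ℕ × ℕ)} (hl : ∀ c ∈ l, 0 < c.2)
    (hd : ∀ c ∈ l, Steeper c d) {k : ℕ} (hk : k ≤ (pathWord l).length) :
    north (pathWord l) k * d.1 + d.2 * east (pathWord l) (pathWord l).length ≤
      north (pathWord l) (pathWord l).length * d.1 + d.2 * east (pathWord l) k := by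
  induction l generalizing k with
  | nil => simp at hk; simp [hk]
  | cons c l ih =>
    have hc := hl c (by simp)
    have hs : d.2 * c.1 ≤ c.2 * d.1 := hd c (by simp)
    have ih' := fun {k} => ih (k := k) (fun c' h' => hl c' (by simp [h']))
      (fun c' h' => hd c' (by simp [h']))
    rw [pathWord_cons] at hk ⊢
    rw [List.length_append, north_append, east_append]
    rcases le_total k (christoffelWord c.1 c.2).length with h | h
    · rw [north_append_left _ h, east_append_left _ h]
      have h0 := ih' (Nat.zero_le _)
      rw [length_christoffelWord] at h
      rw [length_christoffelWord, north_christoffelWord_length hc, east_christoffelWord_length hc]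
      have hn : north (christoffelWord c.1 c.2) k ≤ c.2 := by
        rw [north_christoffelWord h]
        refine Nat.div_le_of_le_mul ?_
        nlinarith
      have h1 := north_mul_le_christoffelWord h
      simp only [north_zero, east_zero] at h0
      obtain ⟨r, hr⟩ := Nat.exists_eq_add_of_le hn
      -- The first `k` points lie under the chord of `c`, so the rest of this word, with `r` north
      -- steps, is at least as steep as the chord, hence as `d`.
      have h3 : d.2 * (c.1 - east (christoffelWord c.1 c.2) k : ℤ) ≤ r * d.1 := by
        have hr' : (c.2 : ℤ) = north (christoffelWord c.1 c.2) k + r := by exact_mod_cast hr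
        have h1' : (north (christoffelWord c.1 c.2) k : ℤ) * c.1 ≤
          c.2 * east (christoffelWord c.1 c.2) k := by exact_mod_cast h1
        have hs' : (d.2 : ℤ) * c.1 ≤ c.2 * d.1 := by exact_mod_cast hs
        have hc' : (0 : ℤ) < c.2 := by exact_mod_cast hc
        refine le_of_mul_le_mul_left (?_ : (c.2 : ℤ) * _ ≤ c.2 * _) hc'
        have e1 := mul_le_mul_of_nonneg_left hs' (Int.natCast_nonneg r)
        have e2 := mul_le_mul_of_nonneg_left h1' (Int.natCast_nonneg d.2)
        have e3 : (r : ℤ) = c.2 - north (christoffelWord c.1 c.2) k := by linarith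
        have e4 : (c.2 : ℤ) * (d.2 * (c.1 - east (christoffelWord c.1 c.2) k)) ≤
          d.2 * (c.1 * r) := by rw [e3]; nlinarith
        nlinarith
      zify at h0 hr ⊢
      nlinarith
    · obtain ⟨j, rfl⟩ := Nat.exists_eq_add_of_le h
      rw [north_append, east_append]
      have := ih' (k := j) (by simp at hk ⊢; omega)
      nlinarith

/-- An index in a concatenation belongs to one of the words. -/
theorem exists_split_pathWord {l : List (ℕ × ℕ)} {k : ℕ} (hk : k < (pathWord l).length) :
    ∃ l₁ c l₂ j, l = l₁ ++ c :: l₂ ∧ k = (pathWord l₁).length + j ∧ j < c.1 + c.2 := by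
  induction l generalizing k with
  | nil => simp at hk
  | cons c l ih =>
    rcases lt_or_ge k (c.1 + c.2) with h | h
    · exact ⟨[], c, l, k, rfl, by simp, h⟩
    · obtain ⟨i, rfl⟩ := Nat.exists_eq_add_of_le h
      obtain ⟨l₁, d, l₂, j, rfl, rfl, hj⟩ := ih (k := i) (by simp at hk; omega)
      exact ⟨c :: l₁, d, l₂, j, rfl, by simp; omega, hj⟩

/-- Slopes of the words of a sorted list. -/
def Sorted (l : List (ℕ × ℕ)) : Prop := l.Pairwise Steeper

/-- Sorting makes the line carrying the chord of any word a supporting line of the whole path. A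
cell on top of an east step of that word has its upper left corner strictly above this line, hence
outside the hull. -/
theorem isNWConvex_of_sorted {l : List (ℕ × ℕ)} (hl : ∀ c ∈ l, 0 < c.2) (hs : Sorted l) :
    IsNWConvex (true :: pathWord l) := by
  refine ⟨rfl, ?_, ?_⟩
  · rcases List.eq_nil_or_concat l with rfl | ⟨l', c, rfl⟩
    · rfl
    · have hc := hl c (by simp)
      rw [List.concat_eq_append, pathWord_append, ← List.cons_append, List.getLast?_append]
      simp [getLast?_christoffelWord hc]
  · rintro i j hcell ⟨k, hk, rfl, hj⟩
    rcases k with _ | k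
    · simp at hk
    rw [List.getElem?_cons_succ] at hk
    have hkf := hk
    replace hk := (List.getElem?_eq_some_iff.1 hk).1
    obtain ⟨l₁, c, l₂, r, rfl, rfl, hr⟩ := exists_split_pathWord hk
    have hc := hl c (by simp)
    have hl₁ : ∀ d ∈ l₁, 0 < d.2 := fun d h => hl d (by simp [h])
    have hl₂ : ∀ d ∈ c :: l₂, 0 < d.2 := fun d h => hl d (by
      simp only [List.mem_append]; exact Or.inr h)
    unfold Sorted at hs
    rw [List.pairwise_append] at hs
    have hs₁ : ∀ d ∈ l₁, Steeper d c := fun d h => hs.2.2 d h c (by simp)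
    have hs₂ : ∀ d ∈ c :: l₂, Steeper c d := by
      intro d h
      rcases List.mem_cons.1 h with rfl | h
      · exact (le_refl _ : d.2 * d.1 ≤ d.2 * d.1)
      · exact (List.pairwise_cons.1 hs.2.1).1 d h
    rw [pathWord_append] at hcell hk hkf hj
    set A := east (pathWord l₁) (pathWord l₁).length with hA
    set B := north (pathWord l₁) (pathWord l₁).length with hB
    have hpt : ∀ m ≤ (pathWord l₁ ++ pathWord (c :: l₂)).length,
        north (pathWord l₁ ++ pathWord (c :: l₂)) m * c.1 + c.2 * A ≤
          B * c.1 + c.2 * east (pathWord l₁ ++ pathWord (c :: l₂)) m := by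
      intro m hm
      rcases le_total m (pathWord l₁).length with h | h
      · rw [north_append_left _ h, east_append_left _ h]
        exact pathWord_le_end hl₁ hs₁ h
      · obtain ⟨m, rfl⟩ := Nat.exists_eq_add_of_le h
        rw [north_append, east_append, ← hA, ← hB]
        have := north_mul_le_pathWord hl₂ hs₂ (k := m)
          (by rw [List.length_append] at hm; omega)
        nlinarith
    -- The half-plane under the chord of `c`, which starts at `(A, B + 1)` once the initial north
    -- step is counted.
    have hsub : convexHull ℝ (points (true :: (pathWord l₁ ++ pathWord (c :: l₂)))) ⊆
        {X : ℝ × ℝ | (c.1 : ℝ) * X.2 - c.2 * X.1 ≤ c.1 * (1 + B) - c.2 * A} := by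
      refine convexHull_min ?_ ?_
      · have h0 := hpt 0 (Nat.zero_le _)
        simp only [north_zero, east_zero] at h0
        have h0' : (c.2 : ℝ) * A ≤ B * c.1 := by
          have : c.2 * A ≤ B * c.1 := by omega
          exact_mod_cast this
        rintro _ ⟨m, hm, rfl⟩
        rcases m with _ | m
        · simp only [Set.mem_ofPred_eq, north_zero, east_zero, Nat.cast_zero]
          have : (0 : ℝ) ≤ c.1 := Nat.cast_nonneg _
          nlinarith
        · simp only [Set.mem_ofPred_eq, north_cons_true, east_cons_true]
          have h1 := hpt m (by simpa using hm)
          have h1' : (north (pathWord l₁ ++ pathWord (c :: l₂)) m : ℝ) * c.1 + c.2 * A ≤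
            B * c.1 + c.2 * east (pathWord l₁ ++ pathWord (c :: l₂)) m := by exact_mod_cast h1
          push_cast
          nlinarith
      · have hlin : IsLinearMap ℝ fun X : ℝ × ℝ => (c.1 : ℝ) * X.2 - c.2 * X.1 :=
          ⟨fun X Y => by simp; ring, fun a X => by simp; ring⟩
        exact convex_halfSpace_le hlin _
    -- Test the half-plane on the upper left corner of the cell.
    have hmem := hsub (hcell (show
      (((east (true :: (pathWord l₁ ++ pathWord (c :: l₂))) ((pathWord l₁).length + r + 1) : ℤ) : ℝ),
        (j : ℝ) + 1) ∈ _ by simp [unitCell]))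
    simp only [Set.mem_ofPred_eq, east_cons_true, north_cons_true, east_append, ← hA] at hmem hj
    rw [north_append, ← hB] at hj
    have hrw : r < (christoffelWord c.1 c.2).length := by simpa using hr
    rw [List.getElem?_append_right (by omega)] at hkf
    simp only [Nat.add_sub_cancel_left, pathWord_cons] at hkf
    rw [List.getElem?_append_left hrw] at hkf
    have hlt := lt_north_mul_of_east_step hr (List.getElem?_eq_some_iff.1 hkf).2
    rw [pathWord_cons, north_append_left _ hrw.le] at hj
    rw [pathWord_cons, east_append_left _ hrw.le] at hmem
    have hlt' : (c.2 : ℝ) * east (christoffelWord c.1 c.2) r <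
      (north (christoffelWord c.1 c.2) r + 1) * c.1 := by exact_mod_cast hlt
    have hj' : (B : ℝ) + north (christoffelWord c.1 c.2) r + 1 ≤ j := by exact_mod_cast hj
    have hc1 : (0 : ℝ) ≤ c.1 := Nat.cast_nonneg _
    push_cast at hmem
    nlinarith

/-- The end of the first word of one factorization is a point of the common path, so it lies under
the line through the origin along the first word of the other, which is the steepest there. By
symmetry the first slopes agree, and the first words cancel. -/
theorem eq_of_pathWord_eq {l l' : List (ℕ × ℕ)} (hl : ∀ c ∈ l, IsPrim c) (hl' : ∀ c ∈ l', IsPrim c)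
    (hs : Sorted l) (hs' : Sorted l') (h : pathWord l = pathWord l') : l = l' := by
  have key : ∀ {c d : ℕ × ℕ} {l l' : List (ℕ × ℕ)}, (∀ e ∈ c :: l, IsPrim e) →
      (∀ e ∈ d :: l', IsPrim e) → Sorted (c :: l) →
      pathWord (c :: l) = pathWord (d :: l') → Steeper c d := by
    intro c d l l' hl hl' hs h
    have hd := (hl' d (by simp)).2
    have hlen : (christoffelWord d.1 d.2).length ≤ (pathWord (c :: l)).length := by
      rw [h, pathWord_cons, List.length_append]; omega
    have := north_mul_le_pathWord (d := c) (fun e he => (hl e he).2) (fun e he => by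
      rcases List.mem_cons.1 he with rfl | he
      · exact (le_refl _ : e.2 * e.1 ≤ e.2 * e.1)
      · exact (List.pairwise_cons.1 hs).1 e he) hlen
    rw [h, pathWord_cons, north_append_left _ le_rfl, east_append_left _ le_rfl,
      length_christoffelWord, north_christoffelWord_length hd, east_christoffelWord_length hd] at this
    exact this
  induction l generalizing l' with
  | nil =>
    rcases l' with _ | ⟨d, l'⟩
    · rfl
    · have := christoffelWord_ne_nil (p := d.1) (hl' d (by simp)).2
      simp at h
      exact absurd h.1 this
  | cons c l ih =>
    rcases l' with _ | ⟨d, l'⟩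
    · have := christoffelWord_ne_nil (p := c.1) (hl c (by simp)).2
      simp at h
      exact absurd h.1 this
    · have hcd : c = d := Steeper.antisymm (hl c (by simp)) (hl' d (by simp))
        (key hl hl' hs h) (key hl' hl hs' h.symm)
      subst hcd
      rw [pathWord_cons, pathWord_cons, List.append_cancel_left_eq] at h
      rw [ih (fun e he => hl e (by simp [he])) (fun e he => hl' e (by simp [he]))
        (List.pairwise_cons.1 hs).2 (List.pairwise_cons.1 hs').2 h]

/-! ### Factorization of NW-convex paths into Christoffel words -/

/-- A point at positive abscissa is preceded by an east step. -/
theorem exists_east_step {u : List Bool} {k : ℕ} (hk : k ≤ u.length) (h : 0 < east u k) :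
    ∃ j < k, u[j]? = some false ∧ east u j + 1 = east u k ∧ north u j ≤ north u k := by
  induction k with
  | zero => simp at h
  | succ k ih =>
    have hk' : k < u.length := hk
    rw [east_succ hk'] at h ⊢
    rw [north_succ hk']
    by_cases hu : u[k] = false
    · exact ⟨k, by omega, by simp [hu, hk'], by simp [hu], by simp [hu]⟩
    · rw [if_neg hu, add_zero] at h ⊢
      obtain ⟨j, hj, h1, h2, h3⟩ := ih hk'.le h
      exact ⟨j, by omega, h1, h2, h3.trans (by omega)⟩

theorem Convex.mem_of_vertical {H : Set (ℝ × ℝ)} (hH : Convex ℝ H) {x y a b : ℝ}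
    (ha : (x, a) ∈ H) (hb : (x, b) ∈ H) (hay : a ≤ y) (hyb : y ≤ b) : (x, y) ∈ H := by
  have h := hH.segment_subset ha hb
  rw [← Prod.image_mk_segment_right] at h
  exact h ⟨y, by rw [segment_eq_Icc (hay.trans hyb)]; exact ⟨hay, hyb⟩, rfl⟩

theorem Convex.mem_of_horizontal {H : Set (ℝ × ℝ)} (hH : Convex ℝ H) {x y a b : ℝ}
    (ha : (a, y) ∈ H) (hb : (b, y) ∈ H) (hax : a ≤ x) (hxb : x ≤ b) : (x, y) ∈ H := by
  have h := hH.segment_subset ha hb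
  rw [← Prod.image_mk_segment_left] at h
  exact h ⟨x, by rw [segment_eq_Icc (hax.trans hxb)]; exact ⟨hax, hxb⟩, rfl⟩

theorem mem_points_cons {u : List Bool} {k : ℕ} (hk : k ≤ u.length) :
    ((east u k : ℝ), (north u k : ℝ) + 1) ∈ points (true :: u) :=
  ⟨k + 1, by simpa using hk, by simp⟩

/-- Below a chord of its upper hull from `(0, 1)`, a NW-convex path is as high as possible. -/
theorem north_eq_of_isNWConvex {u : List Bool} (hu : IsNWConvex (true :: u)) {k : ℕ}
    (hk : k ≤ u.length) (hpos : 0 < north u k)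
    (hmax : ∀ j ≤ k, north u j * k ≤ north u k * j) {j : ℕ} (hj : j ≤ k) :
    north u j = north u k * j / k := by
  have hkpos : 0 < k := by
    rcases Nat.eq_zero_or_pos k with rfl | h
    · simp at hpos
    · exact h
  refine le_antisymm ((Nat.le_div_iff_mul_le hkpos).2 (hmax j hj)) (not_lt.1 fun hlt => ?_)
  have h1 : (north u j + 1) * k ≤ north u k * j := (Nat.le_div_iff_mul_le hkpos).1 hlt
  have hs := north_add_east hk
  have hsj := north_add_east (hj.trans hk)
  set a := east u k
  set b := north u k
  set a' := east u j with ha'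
  set h' := north u j with hh'
  -- Equivalently `h' + 2 ≤ 1 + b (a' - 1) / a`: already at abscissa `a' - 1` the chord reaches the
  -- top of the cell whose lower right corner is the point of index `j`.
  have h2 : (h' + 1) * a + b ≤ b * a' := by
    have : (h' + 1) * (b + a) ≤ b * (h' + a') := by rw [hs, hsj]; exact h1
    nlinarith
  have ha1 : 0 < a' := by
    rcases Nat.eq_zero_or_pos a' with h | h
    · rw [h] at h2; omega
    · exact h
  have hle : a' ≤ a := by
    have : (u.take j).count false ≤ (u.take k).count false :=
      List.Sublist.count_le _ ((List.take_prefix_take_left hj).sublist)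
    exact this
  have ha0 : 0 < a := by omega
  obtain ⟨i, hij, hi1, hi2, hi3⟩ := exists_east_step (hj.trans hk) ha1
  rw [← ha'] at hi2
  rw [← hh'] at hi3
  -- This cell contradicts convexity: each of its vertical sides lies between a point of the path
  -- and a point of the chord. The step `i` is the east step under it.
  refine hu.2.2 ((a' : ℤ) - 1) (h' + 1) ?_ ⟨i + 1, by simpa using hi1, ?_, ?_⟩
  · set H := convexHull ℝ (points (true :: u)) with hH
    have hconv : Convex ℝ H := convex_convexHull ℝ _
    have haR : (0 : ℝ) < a := by exact_mod_cast ha0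
    have h2R : ((h' : ℝ) + 1) * a + b ≤ b * a' := by exact_mod_cast h2
    have hleR : (a' : ℝ) ≤ a := by exact_mod_cast hle
    have ha1R : (1 : ℝ) ≤ a' := by exact_mod_cast ha1
    have hchord : ∀ x : ℝ, 0 ≤ x → x ≤ a → (x, 1 + b * x / a) ∈ H := by
      intro x hx0 hxa
      have m0 : ((0 : ℝ), (1 : ℝ)) ∈ H := by
        have := subset_convexHull ℝ _ (mem_points_cons (u := u) (Nat.zero_le _))
        simpa using this
      have m1 : ((a : ℝ), (b : ℝ) + 1) ∈ H := subset_convexHull ℝ _ (mem_points_cons hk)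
      have := hconv m0 m1 (a := 1 - x / a) (b := x / a)
        (by rw [sub_nonneg, div_le_one haR]; exact hxa) (by positivity) (by ring)
      convert this using 1
      ext
      · simp; field_simp
      · simp; field_simp; ring
    have p1 : ((a' : ℝ), (h' : ℝ) + 1) ∈ H :=
      subset_convexHull ℝ _ (mem_points_cons (hj.trans hk))
    have p0 : ((a' : ℝ) - 1, (north u i : ℝ) + 1) ∈ H := by
      have := subset_convexHull ℝ _ (mem_points_cons (hij.le.trans (hj.trans hk)))
      have e : (east u i : ℝ) = a' - 1 := by rw [← hi2]; push_cast; ring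
      rwa [e] at this
    have hi3R : (north u i : ℝ) ≤ h' := by exact_mod_cast hi3
    rintro ⟨x, y⟩ ⟨⟨hx1, hx2⟩, ⟨hy1, hy2⟩⟩
    push_cast at hx1 hx2 hy1 hy2
    refine Convex.mem_of_horizontal hconv (a := a' - 1) (b := a') ?_ ?_ hx1 (by linarith)
    · refine Convex.mem_of_vertical hconv p0 (hchord _ (by linarith) (by linarith)) (by linarith) ?_
      have : (h' : ℝ) + 1 ≤ b * (a' - 1) / a := by rw [le_div_iff₀ haR]; linarith
      linarith
    · refine Convex.mem_of_vertical hconv p1 (hchord _ (by linarith) (by linarith)) (by linarith) ?_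
      have : (h' : ℝ) + 1 ≤ b * a' / a := by
        rw [le_div_iff₀ haR]
        have : (0 : ℝ) ≤ b := Nat.cast_nonneg _
        linarith
      linarith
  · rw [east_cons_true]; omega
  · rw [north_cons_true]; push_cast; omega

/-- Removing the first Christoffel word from a NW-convex path. -/
theorem IsNWConvex.tail {p q : ℕ} {u : List Bool} (hq : 0 < q)
    (h : IsNWConvex (true :: (christoffelWord p q ++ u))) : IsNWConvex (true :: u) := by
  refine ⟨rfl, ?_, ?_⟩
  · rcases u with _ | ⟨b, u⟩
    · rfl
    · have := h.2.1
      rw [← List.cons_append, List.getLast?_append] at this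
      simpa using this
  · rintro i j hcell ⟨k, hk, hi, hj⟩
    rcases k with _ | k
    · simp at hk
    refine h.2.2 (i + p) (j + q) ?_ ⟨k + (p + q) + 1, ?_, ?_, ?_⟩
    · have hsub : convexHull ℝ (points (true :: u)) ⊆ (fun z => ((p : ℝ), (q : ℝ)) + z) ⁻¹'
          convexHull ℝ (points (true :: (christoffelWord p q ++ u))) := by
        refine convexHull_min ?_ ((convex_convexHull ℝ _).translate_preimage_right _)
        rintro _ ⟨m, hm, rfl⟩
        refine subset_convexHull ℝ _ ?_
        rcases m with _ | m
        -- The origin of the shortened path corresponds to `(p, q)`, which the long path visits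
        -- after `p + q` letters: the last letter of the Christoffel word is a north step and takes
        -- the place of the initial one.
        · refine ⟨p + q, by simp; omega, ?_⟩
          obtain ⟨r, hr⟩ : ∃ r, p + q = r + 1 := ⟨p + q - 1, by omega⟩
          have hlen : r < (christoffelWord p q).length := by simp; omega
          have hlast := getLast?_christoffelWord (p := p) hq
          rw [List.getLast?_eq_getElem?, length_christoffelWord, hr, Nat.add_sub_cancel,
            List.getElem?_eq_some_iff] at hlast
          have hn := north_succ hlen
          have he := east_succ hlen
          rw [hlast.2, ← hr, north_christoffelWord_length hq] at hn
          rw [hlast.2, ← hr, east_christoffelWord_length hq] at he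
          rw [hr, north_cons_true, east_cons_true, north_append_left _ hlen.le,
            east_append_left _ hlen.le]
          simp at hn he
          rw [← hn, ← he]
          simp
        · refine ⟨(p + q) + m + 1, by simp at hm ⊢; omega, ?_⟩
          have e := north_append (christoffelWord p q) u m
          have e' := east_append (christoffelWord p q) u m
          rw [length_christoffelWord, north_christoffelWord_length hq] at e
          rw [length_christoffelWord, east_christoffelWord_length hq] at e'
          rw [north_cons_true, east_cons_true, north_cons_true, east_cons_true, e, e']
          ext
          · simp
          · simp; ring
      rintro ⟨x, y⟩ ⟨⟨hx1, hx2⟩, ⟨hy1, hy2⟩⟩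
      have := hsub (hcell (show (x - p, y - q) ∈ unitCell i j by
        push_cast at hx1 hx2 hy1 hy2
        exact ⟨⟨by simp only; linarith, by simp only; linarith⟩,
          ⟨by simp only; linarith, by simp only; linarith⟩⟩))
      simpa using this
    · rw [List.getElem?_cons_succ] at hk ⊢
      rw [List.getElem?_append_right (by simp)]
      simpa using hk
    · have e' := east_append (christoffelWord p q) u k
      rw [length_christoffelWord, east_christoffelWord_length hq] at e'
      rw [east_cons_true] at hi ⊢
      rw [add_comm k, e']
      push_cast
      omega
    · have e := north_append (christoffelWord p q) u k
      rw [length_christoffelWord, north_christoffelWord_length hq] at e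
      rw [north_cons_true] at hj ⊢
      rw [add_comm k, e]
      push_cast at hj ⊢
      omega

/-- Among the prefixes of maximal slope take the shortest one. -/
theorem exists_first_max {u : List Bool} (hu : u ≠ []) :
    ∃ k, 0 < k ∧ k ≤ u.length ∧ (∀ j ≤ u.length, north u j * k ≤ north u k * j) ∧
      ∀ j, 0 < j → j ≤ u.length → north u j * k = north u k * j → k ≤ j := by
  have hlen : 0 < u.length := List.length_pos_iff.2 hu
  obtain ⟨m, hm, hmax⟩ := Finset.exists_max_image (Finset.Icc 1 u.length)
    (fun k => (north u k : ℚ) / k) ⟨1, by simp; omega⟩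
  simp only [Finset.mem_Icc] at hm hmax
  have hP : ∃ k, 0 < k ∧ k ≤ u.length ∧ ∀ j ≤ u.length, north u j * k ≤ north u k * j := by
    refine ⟨m, hm.1, hm.2, fun j hj => ?_⟩
    rcases Nat.eq_zero_or_pos j with rfl | h0
    · simp
    · have := hmax j ⟨h0, hj⟩
      rw [div_le_div_iff₀ (by exact_mod_cast h0) (by exact_mod_cast hm.1)] at this
      exact_mod_cast this
  classical
  refine ⟨Nat.find hP, (Nat.find_spec hP).1, (Nat.find_spec hP).2.1, (Nat.find_spec hP).2.2,
    fun j hj0 hj h => Nat.find_min' hP ⟨hj0, hj, fun i hi => ?_⟩⟩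
  have hk0 := (Nat.find_spec hP).1
  have h1 := (Nat.find_spec hP).2.2 i hi
  -- A prefix with the same slope as the maximal one is maximal as well, so it competes in the
  -- minimum.
  refine Nat.le_of_mul_le_mul_left (?_ : Nat.find hP * _ ≤ Nat.find hP * _) hk0
  calc Nat.find hP * (north u i * j) = (north u i * Nat.find hP) * j := by ring
    _ ≤ (north u (Nat.find hP) * i) * j := Nat.mul_le_mul_right _ h1
    _ = Nat.find hP * (north u j * i) := by rw [mul_right_comm, ← h]; ring

/-- Greedy factorization by induction on the length. The first word is the shortest prefix of
maximal slope: minimality makes its pair coprime, maximality makes the next word no steeper, and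
convexity identifies its letters. -/
theorem exists_pathWord {w : List Bool} (hw : IsNWConvex w) :
    ∃ l, (∀ c ∈ l, IsPrim c) ∧ Sorted l ∧ w = true :: pathWord l := by
  obtain ⟨u, rfl⟩ : ∃ u, w = true :: u := by
    rcases w with _ | ⟨b, u⟩
    · exact absurd hw.1 (by simp)
    · have := hw.1
      simp at this
      exact ⟨u, by rw [this]⟩
  induction hn : u.length using Nat.strong_induction_on generalizing u with
  | _ n ih =>
  subst hn
  by_cases hu : u = []
  · exact ⟨[], by simp, List.Pairwise.nil, by simp [hu]⟩
  obtain ⟨k, hk0, hk, hmax, hmin⟩ := exists_first_max hu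
  set b := north u k with hb
  set a := east u k with ha
  have hs : b + a = k := north_add_east hk
  have hlast : u.getLast? = some true := by
    have := hw.2.1
    rcases u with _ | ⟨c, u⟩
    · exact absurd rfl hu
    · simpa using this
  -- The path ends with a north step, so the slope of the whole word, and a fortiori the maximal
  -- slope, is positive.
  have hb0 : 0 < b := by
    have hlen : 0 < u.length := List.length_pos_iff.2 hu
    rw [List.getLast?_eq_getElem?, List.getElem?_eq_some_iff] at hlast
    have h1 := north_succ hlast.1
    rw [hlast.2, Nat.sub_add_cancel hlen] at h1
    have h2 := hmax _ le_rfl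
    simp at h1
    rw [h1] at h2
    by_contra h
    rw [Nat.eq_zero_of_not_pos h] at h2
    nlinarith
  have hn := fun {j} => north_eq_of_isNWConvex hw hk hb0 (fun j hj => hmax j (hj.trans hk)) (j := j)
  -- If the gcd `g` exceeded `1`, the chord would contain the lattice point `(a / g, b / g)`,
  -- through which the path passes, giving a shorter prefix of the same slope.
  have hcop : Nat.Coprime a b := by
    set g := Nat.gcd a b with hg
    have hg0 : 0 < g := Nat.gcd_pos_of_pos_right _ hb0
    obtain ⟨a', ha'⟩ := Nat.gcd_dvd_left a b
    obtain ⟨b', hb'⟩ := Nat.gcd_dvd_right a b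
    rw [← hg] at ha' hb'
    have hb'0 : 0 < b' := by
      rcases Nat.eq_zero_or_pos b' with h | h
      · rw [h] at hb'; omega
      · exact h
    have hkg : k = g * (b' + a') := by rw [mul_add, ← ha', ← hb', hs]
    have hle : b' + a' ≤ k := by rw [hkg]; exact Nat.le_mul_of_pos_left _ hg0
    have h1 := hn hle
    have h2 : north u (b' + a') = b' := by
      rw [h1, ← hb]
      refine Nat.div_eq_of_eq_mul_right hk0 ?_
      rw [hb', hkg]; ring
    have h3 := hmin (b' + a') (by omega) (hle.trans hk) (by
      rw [h2, hkg, hb']; ring)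
    have : g * (b' + a') ≤ 1 * (b' + a') := by rw [← hkg]; omega
    have := Nat.le_of_mul_le_mul_right this (by omega)
    exact le_antisymm this hg0
  have htake : u.take k = christoffelWord a b := by
    refine eq_of_north (by simp; omega) fun j hj => ?_
    rw [List.length_take, min_eq_left hk] at hj
    rw [north_christoffelWord (by omega), add_comm a b, hs, ← hn hj]
    simp [north, List.take_take, min_eq_left hj]
  have hsplit : u = christoffelWord a b ++ u.drop k := by rw [← htake, List.take_append_drop]
  have hw' : IsNWConvex (true :: u.drop k) := by
    rw [hsplit] at hw
    exact hw.tail hb0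
  obtain ⟨l, hl, hsort, hl'⟩ := ih _ (by simp; omega) _ hw' rfl
  rw [List.cons_inj_right] at hl'
  rw [hl'] at hsplit
  refine ⟨(a, b) :: l, ?_, ?_, by rw [pathWord_cons, ← hsplit]⟩
  · intro c hc
    rcases List.mem_cons.1 hc with rfl | hc
    · exact ⟨hcop, hb0⟩
    · exact hl c hc
  · refine List.pairwise_cons.2 ⟨?_, hsort⟩
    rcases l with _ | ⟨d, l⟩
    · simp
    · have hd := (hl d (by simp)).2
      -- If `d` were steeper, appending it would give a prefix of larger slope.
      have hhead : Steeper (a, b) d := by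
        have hlen : k + (d.1 + d.2) ≤ u.length := by
          conv_rhs => rw [hsplit]
          simp; omega
        have h1 := hmax _ hlen
        have h2 : north u (k + (d.1 + d.2)) = b + d.2 := by
          rw [hsplit]
          have := north_append (christoffelWord a b) (pathWord (d :: l)) (d.1 + d.2)
          rw [length_christoffelWord, add_comm a b, hs] at this
          rw [this, pathWord_cons, north_append_left _ (by simp), north_christoffelWord_length hd,
            ← hs, add_comm b a, north_christoffelWord_length hb0]
        rw [h2] at h1
        change d.2 * a ≤ b * d.1
        nlinarith
      intro c hc
      rcases List.mem_cons.1 hc with rfl | hc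
      · exact hhead
      · exact hhead.trans hd ((List.pairwise_cons.1 hsort).1 c hc)

/-! ### Merge sort -/

theorem merge_perm (u v : List (ℕ × ℕ)) : (merge u v).1.Perm (u ++ v) := by
  induction u, v using merge.induct with
  | case1 v => simp [merge]
  | case2 a u => simp [merge]
  | case3 a u b v h ih => rw [merge, if_pos h]; exact ih.cons a
  | case4 a u b v h ih =>
    rw [merge, if_neg h]
    exact (ih.cons b).trans (List.perm_middle (a := b) (l₁ := a :: u) (l₂ := v)).symm

theorem merge_sorted {u v : List (ℕ × ℕ)} (hu : ∀ c ∈ u, 0 < c.2) (hv : ∀ c ∈ v, 0 < c.2)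
    (su : Sorted u) (sv : Sorted v) : Sorted (merge u v).1 := by
  induction u, v using merge.induct with
  | case1 v => simpa [merge] using sv
  | case2 a u => simpa [merge] using su
  | case3 a u b v h ih =>
    rw [merge, if_pos h]
    refine List.pairwise_cons.2 ⟨fun c hc => ?_, ih (fun c hc => hu c (by simp [hc])) hv
      (List.pairwise_cons.1 su).2 sv⟩
    rw [(merge_perm _ _).mem_iff, List.mem_append] at hc
    rcases hc with hc | hc
    · exact (List.pairwise_cons.1 su).1 c hc
    · rcases List.mem_cons.1 hc with rfl | hc
      · exact h
      · exact Steeper.trans (hv b (by simp)) h ((List.pairwise_cons.1 sv).1 c hc)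
  | case4 a u b v h ih =>
    rw [merge, if_neg h]
    have h' : Steeper b a := (not_le.1 h).le
    refine List.pairwise_cons.2 ⟨fun c hc => ?_, ih hu (fun c hc => hv c (by simp [hc]))
      su (List.pairwise_cons.1 sv).2⟩
    rw [(merge_perm _ _).mem_iff, List.mem_append] at hc
    rcases hc with hc | hc
    · rcases List.mem_cons.1 hc with rfl | hc
      · exact h'
      · exact Steeper.trans (hu a (by simp)) h' ((List.pairwise_cons.1 su).1 c hc)
    · exact (List.pairwise_cons.1 sv).1 c hc

theorem merge_steps (u v : List (ℕ × ℕ)) : (merge u v).2 ≤ u.length + v.length + 1 := by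
  induction u, v using merge.induct with
  | case1 v => simp [merge]
  | case2 a u => simp [merge]
  | case3 a u b v h ih => rw [merge, if_pos h]; simp at ih ⊢; omega
  | case4 a u b v h ih => rw [merge, if_neg h]; simp at ih ⊢; omega

theorem mergeSort_perm (d : ℕ) (l : List (ℕ × ℕ)) : (mergeSort d l).1.Perm l := by
  induction d generalizing l with
  | zero => simp [mergeSort]
  | succ d ih =>
    have h := (merge_perm (mergeSort d (l.take (l.length / 2))).1
      (mergeSort d (l.drop (l.length / 2))).1).trans ((ih _).append (ih _))
    rwa [List.take_append_drop] at h

theorem mergeSort_sorted {d : ℕ} {l : List (ℕ × ℕ)} (hl : ∀ c ∈ l, 0 < c.2)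
    (hd : l.length ≤ 2 ^ d) : Sorted (mergeSort d l).1 := by
  induction d generalizing l with
  | zero =>
    rcases l with _ | ⟨a, _ | ⟨b, l⟩⟩
    · exact List.Pairwise.nil
    · exact List.pairwise_singleton _ _
    · simp at hd
  | succ d ih =>
    rw [pow_succ] at hd
    have h1 : ∀ c ∈ l.take (l.length / 2), 0 < c.2 := fun c hc => hl c (List.mem_of_mem_take hc)
    have h2 : ∀ c ∈ l.drop (l.length / 2), 0 < c.2 := fun c hc => hl c (List.mem_of_mem_drop hc)
    refine merge_sorted (fun c hc => h1 c ?_) (fun c hc => h2 c ?_) (ih h1 ?_) (ih h2 ?_)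
    · exact (mergeSort_perm _ _).mem_iff.1 hc
    · exact (mergeSort_perm _ _).mem_iff.1 hc
    · rw [List.length_take]; omega
    · rw [List.length_drop]; omega

/-- The `+ 1` on the left absorbs the additive constant of each merge: every level costs at most
twice the length, and the leaves account for `2 * 2 ^ d`. -/
theorem mergeSort_steps (d : ℕ) (l : List (ℕ × ℕ)) :
    (mergeSort d l).2 + 1 ≤ 2 * l.length * d + 2 * 2 ^ d := by
  induction d generalizing l with
  | zero => simp [mergeSort]
  | succ d ih =>
    have h1 := ih (l.take (l.length / 2))
    have h2 := ih (l.drop (l.length / 2))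
    have h3 := merge_steps (mergeSort d (l.take (l.length / 2))).1
      (mergeSort d (l.drop (l.length / 2))).1
    rw [(mergeSort_perm _ _).length_eq, (mergeSort_perm _ _).length_eq] at h3
    have h4 : (l.take (l.length / 2)).length + (l.drop (l.length / 2)).length = l.length := by
      rw [← List.length_append, List.take_append_drop]
    set x := (l.take (l.length / 2)).length
    set y := (l.drop (l.length / 2)).length
    change l.length + (mergeSort d (l.take (l.length / 2))).2 +
      (mergeSort d (l.drop (l.length / 2))).2 + (merge _ _).2 + 1 ≤ _
    have h5 : 2 * l.length * (d + 1) = 2 * x * d + 2 * y * d + 2 * l.length := by rw [← h4]; ring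
    rw [pow_succ, h5]
    omega

/-- The list of pairs sorted by decreasing slope. -/
def sortList (l : List (ℕ × ℕ)) : List (ℕ × ℕ) := (mergeSort (Nat.clog 2 l.length) l).1

theorem sortList_perm (l : List (ℕ × ℕ)) : (sortList l).Perm l := mergeSort_perm _ _

theorem sortList_sorted {l : List (ℕ × ℕ)} (hl : ∀ c ∈ l, 0 < c.2) : Sorted (sortList l) :=
  mergeSort_sorted hl (Nat.le_pow_clog (by norm_num) _)

/-- The path that is written for a list of pairs. -/
def pathOf (l : List (ℕ × ℕ)) : List Bool := true :: pathWord (sortList l)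

theorem isNWConvex_pathOf {l : List (ℕ × ℕ)} (hl : ∀ c ∈ l, IsPrim c) : IsNWConvex (pathOf l) :=
  isNWConvex_of_sorted (fun c hc => (hl c ((sortList_perm l).mem_iff.1 hc)).2)
    (sortList_sorted fun c hc => (hl c hc).2)

theorem Sorted.eq_of_perm {l l' : List (ℕ × ℕ)} (hl : ∀ c ∈ l, IsPrim c)
    (hs : Sorted l) (hs' : Sorted l') (h : l.Perm l') : l = l' :=
  List.Perm.eq_of_pairwise (fun a b ha hb h1 h2 => Steeper.antisymm (hl a ha)
    (hl b (h.mem_iff.2 hb)) h1 h2) hs hs' h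

/-- With `exists_pathOf`, this identifies NW-convex paths with multisets of primitive pairs. -/
theorem pathOf_eq_iff {l l' : List (ℕ × ℕ)} (hl : ∀ c ∈ l, IsPrim c) (hl' : ∀ c ∈ l', IsPrim c) :
    pathOf l = pathOf l' ↔ l.Perm l' := by
  have h1 : ∀ c ∈ sortList l, IsPrim c := fun c hc => hl c ((sortList_perm l).mem_iff.1 hc)
  have h2 : ∀ c ∈ sortList l', IsPrim c := fun c hc => hl' c ((sortList_perm l').mem_iff.1 hc)
  have s1 := sortList_sorted fun c hc => (hl c hc).2
  have s2 := sortList_sorted fun c hc => (hl' c hc).2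
  constructor
  · intro h
    have := eq_of_pathWord_eq h1 h2 s1 s2 (by simpa [pathOf] using h)
    exact (sortList_perm l).symm.trans (this ▸ sortList_perm l')
  · intro h
    have := Sorted.eq_of_perm h1 s1 s2
      ((sortList_perm l).trans (h.trans (sortList_perm l').symm))
    rw [pathOf, pathOf, this]

theorem exists_pathOf {w : List Bool} (hw : IsNWConvex w) :
    ∃ l, (∀ c ∈ l, IsPrim c) ∧ pathOf l = w := by
  obtain ⟨l, hl, hs, rfl⟩ := exists_pathWord hw
  refine ⟨l, hl, ?_⟩
  have := Sorted.eq_of_perm hl hs (sortList_sorted fun c hc => (hl c hc).2)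
    (sortList_perm l).symm
  rw [pathOf, ← this]

theorem length_pathWord (l : List (ℕ × ℕ)) :
    (pathWord l).length = (l.map fun c => c.1 + c.2).sum := by
  simp [pathWord, List.length_flatMap]

theorem size_pathOf (l : List (ℕ × ℕ)) : size (pathOf l) = (l.map fun c => c.1 + c.2).sum := by
  simp only [size, pathOf, List.length_cons, Nat.add_sub_cancel, length_pathWord]
  exact ((sortList_perm l).map _).sum_eq

namespace Algo

variable {α β : Type}

/-! ### Expectations for random algorithms -/

theorem tsum_antidiagonal (F : ℕ × ℕ → ℝ≥0∞) :
    ∑' n, ∑ p ∈ Finset.HasAntidiagonal.antidiagonal n, F p = ∑' p, F p := by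
  rw [← Finset.HasAntidiagonal.sigmaAntidiagonalEquivProd.tsum_eq F, ENNReal.tsum_sigma']
  refine tsum_congr fun n => ?_
  rw [← Finset.tsum_subtype (Finset.HasAntidiagonal.antidiagonal n) F]
  rfl

/-- The probability of an output together with a step count. -/
def run (m : Algo α) : α × ℕ → ℝ≥0∞ := m

/-- The expected value of a function of the output and of the step count. -/
noncomputable def wsum (m : Algo α) (h : α × ℕ → ℝ≥0∞) : ℝ≥0∞ := ∑' z, m.run z * h z

/-- Laws, halting probabilities and mean costs of composed algorithms are all special cases of this
exchange of sums, which is unconditional in `ℝ≥0∞`. -/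
theorem wsum_bind (m : Algo α) (f : α → Algo β) (h : β × ℕ → ℝ≥0∞) :
    (m >>= f).wsum h = m.wsum fun z => (f z.1).wsum fun y => h (y.1, z.2 + y.2) := by
  unfold wsum
  calc ∑' z, (m >>= f).run z * h z
      = ∑' b, ∑' c, (∑' a, ∑ p ∈ Finset.HasAntidiagonal.antidiagonal c,
          m.run (a, p.1) * (f a).run (b, p.2)) * h (b, c) := ENNReal.tsum_prod'
    _ = ∑' b, ∑' c, ∑' a, ∑ p ∈ Finset.HasAntidiagonal.antidiagonal c,
          m.run (a, p.1) * ((f a).run (b, p.2) * h (b, p.1 + p.2)) := by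
        refine tsum_congr fun b => tsum_congr fun c => ?_
        rw [← ENNReal.tsum_mul_right]
        refine tsum_congr fun a => ?_
        rw [Finset.sum_mul]
        refine Finset.sum_congr rfl fun p hp => ?_
        rw [Finset.HasAntidiagonal.mem_antidiagonal.1 hp, mul_assoc]
    _ = ∑' b, ∑' a, ∑' p : ℕ × ℕ, m.run (a, p.1) * ((f a).run (b, p.2) * h (b, p.1 + p.2)) := by
        refine tsum_congr fun b => ?_
        rw [ENNReal.tsum_comm]
        exact tsum_congr fun a => tsum_antidiagonal fun p =>
          m.run (a, p.1) * ((f a).run (b, p.2) * h (b, p.1 + p.2))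
    _ = ∑' a, ∑' b, ∑' p : ℕ × ℕ, m.run (a, p.1) * ((f a).run (b, p.2) * h (b, p.1 + p.2)) :=
        ENNReal.tsum_comm
    _ = ∑' a, ∑' c, m.run (a, c) * ∑' y, (f a).run y * h (y.1, c + y.2) := by
        refine tsum_congr fun a => ?_
        calc ∑' b, ∑' p : ℕ × ℕ, m.run (a, p.1) * ((f a).run (b, p.2) * h (b, p.1 + p.2))
            = ∑' b, ∑' c, ∑' d, m.run (a, c) * ((f a).run (b, d) * h (b, c + d)) :=
              tsum_congr fun b => ENNReal.tsum_prod'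
          _ = ∑' c, ∑' b, ∑' d, m.run (a, c) * ((f a).run (b, d) * h (b, c + d)) :=
              ENNReal.tsum_comm
          _ = _ := by
            refine tsum_congr fun c => ?_
            rw [ENNReal.tsum_prod', ← ENNReal.tsum_mul_left]
            refine tsum_congr fun b => ?_
            rw [← ENNReal.tsum_mul_left]
    _ = _ := by rw [ENNReal.tsum_prod']

theorem expect_eq_wsum (m : Algo α) (g : α → ℝ≥0∞) : m.expect g = m.wsum fun z => g z.1 := rfl

theorem expectedCost_eq_wsum (m : Algo α) : m.expectedCost = m.wsum fun z => (z.2 : ℝ≥0∞) := rfl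

theorem haltProb_eq_wsum (m : Algo α) : m.haltProb = m.wsum fun _ => 1 := by
  simp only [wsum, mul_one]; rfl

theorem wsum_add (m : Algo α) (f g : α × ℕ → ℝ≥0∞) :
    (m.wsum fun z => f z + g z) = m.wsum f + m.wsum g := by
  simp only [wsum, mul_add, ENNReal.tsum_add]

theorem wsum_mono (m : Algo α) {f g : α × ℕ → ℝ≥0∞} (h : ∀ z, f z ≤ g z) :
    m.wsum f ≤ m.wsum g :=
  ENNReal.tsum_le_tsum fun z => by gcongr; exact h _

theorem wsum_const_mul (m : Algo α) (c : ℝ≥0∞) (f : α × ℕ → ℝ≥0∞) :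
    (m.wsum fun z => c * f z) = c * m.wsum f := by
  simp only [wsum, ← ENNReal.tsum_mul_left]
  exact tsum_congr fun z => by ring

theorem wsum_const (m : Algo α) (c : ℝ≥0∞) : (m.wsum fun _ => c) = m.haltProb * c := by
  rw [haltProb_eq_wsum, mul_comm, ← wsum_const_mul]
  simp

theorem haltProb_eq_expect (m : Algo α) : m.haltProb = m.expect 1 := by
  rw [haltProb_eq_wsum, expect_eq_wsum]; rfl

theorem expect_bind (m : Algo α) (f : α → Algo β) (g : β → ℝ≥0∞) :
    (m >>= f).expect g = m.expect fun a => (f a).expect g := wsum_bind m f fun z => g z.1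

theorem expectedCost_bind (m : Algo α) (f : α → Algo β) :
    (m >>= f).expectedCost = (m.wsum fun z => (f z.1).haltProb * z.2) +
      m.expect fun a => (f a).expectedCost := by
  rw [expectedCost_eq_wsum, wsum_bind, expect_eq_wsum, ← wsum_add]
  congr 1
  funext z
  simp only [Nat.cast_add]
  rw [wsum_add, wsum_const, expectedCost_eq_wsum]

theorem expectedCost_bind_le (m : Algo α) {f : α → Algo β} (hf : ∀ a, (f a).haltProb ≤ 1) :
    (m >>= f).expectedCost ≤ m.expectedCost + m.expect fun a => (f a).expectedCost := by
  rw [expectedCost_bind]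
  gcongr
  exact wsum_mono _ fun z => mul_le_of_le_one_left' (hf _)

theorem wsum_pure (a : α) (h : α × ℕ → ℝ≥0∞) : (pure a : Algo α).wsum h = h (a, 0) := by
  classical
  have hr : (pure a : Algo α).run = fun z => if z = (a, 0) then 1 else 0 := by
    funext z
    exact if_congr Iff.rfl rfl rfl
  simp [wsum, hr]

@[simp] theorem expect_pure (a : α) (g : α → ℝ≥0∞) : (pure a : Algo α).expect g = g a :=
  wsum_pure a fun z => g z.1

@[simp] theorem expectedCost_pure (a : α) : (pure a : Algo α).expectedCost = 0 :=
  (wsum_pure a fun z => (z.2 : ℝ≥0∞)).trans (by simp)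

theorem wsum_tick (c : ℕ) (h : Unit × ℕ → ℝ≥0∞) : (tick c).wsum h = h ((), c) := by
  classical
  have hr : (tick c).run = fun z => if z = ((), c) then 1 else 0 := by
    funext z
    exact if_congr Iff.rfl rfl rfl
  simp [wsum, hr]

@[simp] theorem expect_tick (c : ℕ) (g : Unit → ℝ≥0∞) : (tick c).expect g = g () :=
  wsum_tick c fun z => g z.1

@[simp] theorem expectedCost_tick (c : ℕ) : (tick c).expectedCost = c :=
  wsum_tick c fun z => (z.2 : ℝ≥0∞)

theorem wsum_draw (f : ℕ → ℝ) (h : ℕ × ℕ → ℝ≥0∞) :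
    (draw f).wsum h = ∑' k, ENNReal.ofReal (f k) * h (k, k + 1) := by
  have hr : (draw f).run = fun z => if z.2 = z.1 + 1 then ENNReal.ofReal (f z.1) else 0 := rfl
  rw [wsum, hr, ENNReal.tsum_prod']
  refine tsum_congr fun k => ?_
  rw [tsum_eq_single (k + 1)]
  · simp
  · intro c hc
    simp [hc]

theorem expect_draw (f : ℕ → ℝ) (g : ℕ → ℝ≥0∞) :
    (draw f).expect g = ∑' k, ENNReal.ofReal (f k) * g k :=
  wsum_draw f fun z => g z.1

theorem expectedCost_draw (f : ℕ → ℝ) :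
    (draw f).expectedCost = ∑' k, ENNReal.ofReal (f k) * (k + 1) :=
  (wsum_draw f fun z => (z.2 : ℝ≥0∞)).trans (by simp)

theorem haltProb_draw {f : ℕ → ℝ} (hf : ∀ k, 0 ≤ f k) (hs : HasSum f 1) :
    (draw f).haltProb = 1 := by
  rw [haltProb_eq_expect, expect_draw]
  simp only [Pi.one_apply, mul_one]
  rw [← ENNReal.ofReal_tsum_of_nonneg hf hs.summable, hs.tsum_eq, ENNReal.ofReal_one]

theorem haltProb_bind {m : Algo α} {f : α → Algo β} (hm : m.haltProb = 1)
    (hf : ∀ a, (f a).haltProb = 1) : (m >>= f).haltProb = 1 := by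
  simp only [haltProb_eq_expect] at *
  rw [expect_bind]
  simp only [hf]
  exact hm

/-- Needed for the height of a Christoffel word: for the length `0` the drawing of a height never
halts, but this length has probability zero. -/
theorem haltProb_bind_of_ne_zero {m : Algo α} {f : α → Algo β} (hm : m.haltProb = 1)
    (hf : ∀ a, m.law a ≠ 0 → (f a).haltProb = 1) : (m >>= f).haltProb = 1 := by
  rw [← hm, haltProb_eq_expect, expect_bind, haltProb_eq_expect, expect_eq_wsum, expect_eq_wsum]
  refine tsum_congr fun z => ?_
  by_cases h : m.run z = 0
  · simp [h]
  · have hl : m.law z.1 ≠ 0 := fun h0 => h ((ENNReal.tsum_eq_zero.1 h0) z.2)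
    have h1 := hf z.1 hl
    rw [haltProb_eq_expect] at h1
    simp only [h1, Pi.one_apply]

@[simp] theorem haltProb_pure (a : α) : (pure a : Algo α).haltProb = 1 := by
  rw [haltProb_eq_expect]; simp

@[simp] theorem haltProb_tick (c : ℕ) : (tick c).haltProb = 1 := by
  rw [haltProb_eq_expect]; simp

theorem expect_eq_tsum_law (m : Algo α) (g : α → ℝ≥0∞) : m.expect g = ∑' a, m.law a * g a := by
  rw [expect_eq_wsum, wsum, ENNReal.tsum_prod']
  refine tsum_congr fun a => ?_
  rw [show m.law a = ∑' c, m.run (a, c) from rfl, ← ENNReal.tsum_mul_right]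

open Classical in
theorem law_eq_expect (m : Algo α) (a : α) : m.law a = m.expect fun b => if b = a then 1 else 0 := by
  rw [expect_eq_tsum_law]
  simp

theorem expect_add (m : Algo α) (f g : α → ℝ≥0∞) :
    (m.expect fun a => f a + g a) = m.expect f + m.expect g := wsum_add m _ _

theorem expect_mono (m : Algo α) {f g : α → ℝ≥0∞} (h : ∀ a, f a ≤ g a) :
    m.expect f ≤ m.expect g := wsum_mono m fun z => h z.1

theorem expect_const_mul (m : Algo α) (c : ℝ≥0∞) (f : α → ℝ≥0∞) :
    (m.expect fun a => c * f a) = c * m.expect f := wsum_const_mul m c _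

theorem expect_const (m : Algo α) (c : ℝ≥0∞) : (m.expect fun _ => c) = m.haltProb * c :=
  wsum_const m c

/-! ### Rejection -/

/-- The probability that the output is accepted. -/
noncomputable def acceptProb (m : Algo α) (ok : α → Bool) : ℝ≥0∞ := m.expect fun a => if ok a then 1 else 0

theorem wsum_repeatUntil (m : Algo α) (ok : α → Bool) (h : (α × ℕ) × ℕ → ℝ≥0∞) :
    (repeatUntil m ok).wsum h =
      ∑' k, (rejections m ok k).wsum fun z => h ((z.1, k + 1), z.2) := by
  have h0 : ∀ a c, (repeatUntil m ok).run ((a, 0), c) = 0 := fun _ _ => rfl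
  have hk : ∀ a k c, (repeatUntil m ok).run ((a, k + 1), c) = (rejections m ok k).run (a, c) :=
    fun _ _ _ => rfl
  unfold wsum
  rw [ENNReal.tsum_prod', ENNReal.tsum_prod']
  calc ∑' a, ∑' k, ∑' c, (repeatUntil m ok).run ((a, k), c) * h ((a, k), c)
      = ∑' a, ∑' k, ∑' c, (rejections m ok k).run (a, c) * h ((a, k + 1), c) := by
        refine tsum_congr fun a => ?_
        rw [tsum_eq_zero_add' ENNReal.summable]
        simp [h0, hk]
    _ = ∑' k, ∑' a, ∑' c, (rejections m ok k).run (a, c) * h ((a, k + 1), c) := ENNReal.tsum_comm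
    _ = _ := tsum_congr fun k => by rw [ENNReal.tsum_prod']

/-- The part of a random algorithm whose output is rejected. -/
def rejected (m : Algo α) (ok : α → Bool) : Algo α := fun z => if ok z.1 then 0 else m z

/-- The part of a random algorithm whose output is accepted. -/
def accepted (m : Algo α) (ok : α → Bool) : Algo α := fun z => if ok z.1 then m z else 0

theorem rejections_succ (m : Algo α) (ok : α → Bool) (k : ℕ) :
    rejections m ok (k + 1) = (rejected m ok >>= fun _ => rejections m ok k) := rfl

theorem run_accepted (m : Algo α) (ok : α → Bool) (z : α × ℕ) :
    (accepted m ok).run z = if ok z.1 then m.run z else 0 := rfl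

theorem run_rejected (m : Algo α) (ok : α → Bool) (z : α × ℕ) :
    (rejected m ok).run z = if ok z.1 then 0 else m.run z := rfl

theorem accepted_add_rejected (m : Algo α) (ok : α → Bool) (h : α × ℕ → ℝ≥0∞) :
    (accepted m ok).wsum h + (rejected m ok).wsum h = m.wsum h := by
  unfold wsum
  rw [← ENNReal.tsum_add]
  refine tsum_congr fun z => ?_
  by_cases hz : ok z.1 <;> simp [run_accepted, run_rejected, hz]

theorem expect_accepted (m : Algo α) (ok : α → Bool) (g : α → ℝ≥0∞) :
    (accepted m ok).expect g = m.expect fun a => if ok a then g a else 0 := by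
  refine tsum_congr fun z => ?_
  change (accepted m ok).run z * _ = m.run z * _
  by_cases hz : ok z.1 <;> simp [run_accepted, hz]

theorem haltProb_accepted (m : Algo α) (ok : α → Bool) :
    (accepted m ok).haltProb = acceptProb m ok := by
  rw [haltProb_eq_expect, expect_accepted]; rfl

theorem expect_rejections (m : Algo α) (ok : α → Bool) (k : ℕ) (g : α → ℝ≥0∞) :
    (rejections m ok k).expect g =
      (rejected m ok).haltProb ^ k * m.expect fun a => if ok a then g a else 0 := by
  induction k with
  | zero => rw [pow_zero, one_mul, ← expect_accepted]; rfl
  | succ k ih => rw [rejections_succ, expect_bind, ih, expect_const, pow_succ]; ring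

/-- Geometric series. If no output is ever accepted, both sides are `⊤`. -/
theorem tsum_rejected_pow {m : Algo α} {ok : α → Bool} (hm : m.haltProb = 1) :
    ∑' k, (rejected m ok).haltProb ^ k = (acceptProb m ok)⁻¹ := by
  have h : acceptProb m ok + (rejected m ok).haltProb = 1 := by
    rw [← haltProb_accepted, ← hm]
    simp only [haltProb_eq_wsum]
    exact accepted_add_rejected m ok fun _ => 1
  have hr : (rejected m ok).haltProb ≠ ⊤ := by
    refine ne_top_of_le_ne_top ENNReal.one_ne_top (h ▸ le_add_self)
  rw [ENNReal.tsum_geometric, ← h, ENNReal.add_sub_cancel_right hr]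

/-- The Cauchy square of the geometric series. -/
theorem tsum_rejected_pow_mul {m : Algo α} {ok : α → Bool} (hm : m.haltProb = 1) :
    ∑' k : ℕ, (rejected m ok).haltProb ^ k * (k + 1) = (acceptProb m ok)⁻¹ ^ 2 := by
  rw [← tsum_rejected_pow hm, sq, ← ENNReal.tsum_mul_right]
  simp_rw [← ENNReal.tsum_mul_left]
  rw [← ENNReal.tsum_prod (f := fun i j : ℕ => (rejected m ok).haltProb ^ i *
    (rejected m ok).haltProb ^ j), ← tsum_antidiagonal]
  refine tsum_congr fun n => ?_
  rw [Finset.sum_congr rfl (g := fun _ => (rejected m ok).haltProb ^ n)]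
  · simp [mul_comm]
  · intro p hp
    rw [← pow_add, Finset.HasAntidiagonal.mem_antidiagonal.1 hp]

theorem acceptProb_le_one {m : Algo α} {ok : α → Bool} (hm : m.haltProb = 1) :
    acceptProb m ok ≤ 1 := by
  rw [← hm, haltProb_eq_expect]
  exact expect_mono _ fun a => by split_ifs <;> simp

theorem expect_repeatUntil {m : Algo α} {ok : α → Bool} (hm : m.haltProb = 1) (g : α → ℝ≥0∞) :
    ((repeatUntil m ok).expect fun r => g r.1) =
      (acceptProb m ok)⁻¹ * m.expect fun a => if ok a then g a else 0 := by
  rw [expect_eq_wsum, wsum_repeatUntil]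
  rw [← tsum_rejected_pow hm, ← ENNReal.tsum_mul_right]
  exact tsum_congr fun k => expect_rejections m ok k g

theorem haltProb_repeatUntil {m : Algo α} {ok : α → Bool} (hm : m.haltProb = 1)
    (h : acceptProb m ok ≠ 0) : (repeatUntil m ok).haltProb = 1 := by
  rw [haltProb_eq_expect]
  refine (expect_repeatUntil hm fun _ => 1).trans ?_
  exact ENNReal.inv_mul_cancel h
    (ne_top_of_le_ne_top ENNReal.one_ne_top (acceptProb_le_one hm))

theorem expect_trials {m : Algo α} {ok : α → Bool} (hm : m.haltProb = 1)
    (h : acceptProb m ok ≠ 0) :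
    ((repeatUntil m ok).expect fun r => (r.2 : ℝ≥0∞)) = (acceptProb m ok)⁻¹ := by
  have ht : acceptProb m ok ≠ ⊤ := ne_top_of_le_ne_top ENNReal.one_ne_top (acceptProb_le_one hm)
  rw [expect_eq_wsum, wsum_repeatUntil]
  have : ∀ k : ℕ, ((rejections m ok k).wsum fun _ => ((k + 1 : ℕ) : ℝ≥0∞)) =
      ((rejected m ok).haltProb ^ k * (k + 1)) * acceptProb m ok := by
    intro k
    rw [wsum_const, haltProb_eq_expect, expect_rejections]
    push_cast
    rw [mul_right_comm]
    rfl
  simp only [this]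
  rw [ENNReal.tsum_mul_right, tsum_rejected_pow_mul hm, sq, mul_assoc,
    ENNReal.inv_mul_cancel h ht, mul_one]

/-- Linearity of the mean: the accepted run contributes the first term, and each of the `k` rejected
runs contributes equally to the second. The truncated exponent `k - 1` is harmless, because its
factor vanishes for `k = 0`. -/
theorem expectedCost_rejections (m : Algo α) (ok : α → Bool) (k : ℕ) :
    (rejections m ok k).expectedCost =
      (rejected m ok).haltProb ^ k * (accepted m ok).expectedCost +
        k * (rejected m ok).haltProb ^ (k - 1) * acceptProb m ok *
          (rejected m ok).expectedCost := by
  induction k with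
  | zero => simp; rfl
  | succ k ih =>
    have hh : (rejections m ok k).haltProb =
        (rejected m ok).haltProb ^ k * acceptProb m ok := by
      rw [haltProb_eq_expect, expect_rejections]; rfl
    rw [rejections_succ, expectedCost_bind, expect_const, ih, hh]
    rw [wsum_const_mul, ← expectedCost_eq_wsum]
    rcases k with _ | k
    · simp; ring
    · simp only [Nat.add_sub_cancel]
      push_cast
      ring

/-- Wald's identity. With `p` the acceptance probability, the rejected part is multiplied by `p *
p⁻¹ ^ 2 = p⁻¹`, the same factor as the accepted part. -/
theorem expectedCost_repeatUntil {m : Algo α} {ok : α → Bool} (hm : m.haltProb = 1)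
    (h : acceptProb m ok ≠ 0) :
    (repeatUntil m ok).expectedCost = (acceptProb m ok)⁻¹ * m.expectedCost := by
  have ht : acceptProb m ok ≠ ⊤ := ne_top_of_le_ne_top ENNReal.one_ne_top (acceptProb_le_one hm)
  have h1 : (repeatUntil m ok).expectedCost = ∑' k, (rejections m ok k).expectedCost :=
    wsum_repeatUntil m ok fun z => (z.2 : ℝ≥0∞)
  have h2 : m.expectedCost = (accepted m ok).expectedCost + (rejected m ok).expectedCost :=
    (accepted_add_rejected m ok fun z => (z.2 : ℝ≥0∞)).symm
  rw [h1]
  simp only [expectedCost_rejections]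
  rw [ENNReal.tsum_add, ENNReal.tsum_mul_right, tsum_rejected_pow hm, ENNReal.tsum_mul_right,
    ENNReal.tsum_mul_right, h2, mul_add]
  congr 2
  rw [tsum_eq_zero_add' ENNReal.summable]
  simp only [CharP.cast_eq_zero, zero_mul, zero_add, Nat.add_sub_cancel]
  have := tsum_rejected_pow_mul (ok := ok) hm
  simp only [mul_comm (_ ^ _)] at this
  push_cast
  rw [this, sq, mul_assoc, ENNReal.inv_mul_cancel h ht, mul_one]

end Algo

open Algo

/-! ### Drawing primitive Christoffel words -/

theorem summable_totient_mul_pow {y : ℝ} (h0 : 0 ≤ y) (h1 : y < 1) :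
    Summable fun n : ℕ => (Nat.totient n : ℝ) * y ^ n := by
  refine Summable.of_nonneg_of_le (fun n => by positivity) (fun n => ?_)
    (summable_pow_mul_geometric_of_norm_lt_one 1 (by rwa [Real.norm_of_nonneg h0]))
  rw [pow_one]
  gcongr
  exact Nat.totient_le n

theorem le_christoffelGF {y : ℝ} (h0 : 0 ≤ y) (h1 : y < 1) : y ≤ christoffelGF y := by
  have := (summable_totient_mul_pow h0 h1).le_tsum 1 (fun n _ => by positivity)
  rw [christoffelGF]
  simpa using this

theorem christoffelGF_pos {y : ℝ} (h0 : 0 < y) (h1 : y < 1) : 0 < christoffelGF y :=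
  h0.trans_le (le_christoffelGF h0.le h1)

theorem lengthProb_nonneg {y : ℝ} (h0 : 0 < y) (h1 : y < 1) (n : ℕ) : 0 ≤ lengthProb y n :=
  div_nonneg (by positivity) (christoffelGF_pos h0 h1).le

theorem hasSum_lengthProb {y : ℝ} (h0 : 0 < y) (h1 : y < 1) : HasSum (lengthProb y) 1 := by
  have := (summable_totient_mul_pow h0.le h1).hasSum.div_const (christoffelGF y)
  rwa [← christoffelGF, div_self (christoffelGF_pos h0 h1).ne'] at this

theorem tsum_uniformProb (n : ℕ) (g : ℕ → ℝ≥0∞) :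
    ∑' k, ENNReal.ofReal (uniformProb n k) * g k = (n : ℝ≥0∞)⁻¹ * ∑ k ∈ Finset.Icc 1 n, g k := by
  rw [tsum_eq_sum (s := Finset.Icc 1 n), Finset.mul_sum]
  · refine Finset.sum_congr rfl fun k hk => ?_
    have hk' := Finset.mem_Icc.1 hk
    have hn : (0 : ℝ) < n := by exact_mod_cast (by omega : 0 < n)
    rw [uniformProb, if_pos hk', one_div, ENNReal.ofReal_inv_of_pos hn, ENNReal.ofReal_natCast]
  · intro k hk
    rw [uniformProb, if_neg (by simpa using hk)]
    simp

theorem haltProb_draw_uniformProb {n : ℕ} (hn : n ≠ 0) : (draw (uniformProb n)).haltProb = 1 := by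
  rw [haltProb_eq_expect, expect_draw, tsum_uniformProb]
  simp [ENNReal.inv_mul_cancel (Nat.cast_ne_zero.2 hn : (n : ℝ≥0∞) ≠ 0) (ENNReal.natCast_ne_top n)]

/-- One attempt at drawing the height of a word of length `n`. -/
noncomputable def heightTrial (n : ℕ) : Algo ℕ := do
  let q ← draw (uniformProb n)
  tick (euclidSteps n q)
  pure q

theorem haltProb_heightTrial {n : ℕ} (hn : n ≠ 0) : (heightTrial n).haltProb = 1 :=
  haltProb_bind (haltProb_draw_uniformProb hn) fun q =>
    haltProb_bind (haltProb_tick _) fun _ => haltProb_pure q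

theorem expect_heightTrial (n : ℕ) (g : ℕ → ℝ≥0∞) :
    (heightTrial n).expect g = (n : ℝ≥0∞)⁻¹ * ∑ k ∈ Finset.Icc 1 n, g k := by
  rw [heightTrial, expect_bind, expect_draw, ← tsum_uniformProb]
  simp [expect_bind]

/-- A linear bound is enough, because drawing `q` by sequential search already costs `q + 1`. -/
theorem euclidSteps_le (a b : ℕ) : euclidSteps a b ≤ b + 1 := by
  induction b using Nat.strong_induction_on generalizing a with
  | _ b ih =>
    rw [euclidSteps]
    split_ifs with h
    · omega
    · have hlt : a % b < b := Nat.mod_lt a (Nat.pos_of_ne_zero h)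
      have := ih _ hlt b
      simp only
      omega

theorem expectedCost_heightTrial_le {n : ℕ} (hn : n ≠ 0) :
    (heightTrial n).expectedCost ≤ 2 * n + 2 := by
  have hmean : ∀ g : ℕ → ℝ≥0∞, (∀ k ≤ n, g k ≤ n + 1) →
      ∑' k, ENNReal.ofReal (uniformProb n k) * g k ≤ n + 1 := by
    intro g hg
    rw [tsum_uniformProb]
    calc (n : ℝ≥0∞)⁻¹ * ∑ k ∈ Finset.Icc 1 n, g k
        ≤ (n : ℝ≥0∞)⁻¹ * ∑ k ∈ Finset.Icc 1 n, ((n : ℝ≥0∞) + 1) := by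
          gcongr with k hk
          exact hg k (Finset.mem_Icc.1 hk).2
      _ = n + 1 := by
          simp only [Finset.sum_const, Nat.card_Icc, Nat.add_sub_cancel, nsmul_eq_mul]
          rw [← mul_assoc, ENNReal.inv_mul_cancel (Nat.cast_ne_zero.2 hn : (n : ℝ≥0∞) ≠ 0)
            (ENNReal.natCast_ne_top n), one_mul]
  have htail : ∀ q, (do tick (euclidSteps n q); pure q : Algo ℕ).expectedCost ≤ euclidSteps n q := by
    intro q
    refine (expectedCost_bind_le _ fun _ => (haltProb_pure q).le).trans ?_
    simp [expect_const]
  rw [heightTrial]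
  refine (expectedCost_bind_le _ fun q => (haltProb_bind (haltProb_tick _)
    fun _ => haltProb_pure q).le).trans ?_
  rw [expectedCost_draw, expect_draw]
  calc _ ≤ ((n : ℝ≥0∞) + 1) + (n + 1) := by
        refine add_le_add (hmean _ fun k hk => ?_) (hmean _ fun k hk => (htail k).trans ?_)
        · gcongr
        · exact_mod_cast (euclidSteps_le n k).trans (by omega)
    _ = 2 * n + 2 := by ring

theorem acceptProb_heightTrial (n : ℕ) :
    acceptProb (heightTrial n) (fun q => Nat.gcd n q == 1) = (n : ℝ≥0∞)⁻¹ * Nat.totient n := by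
  rw [acceptProb, expect_heightTrial]
  congr 1
  simp only [beq_iff_eq]
  rw [Finset.sum_boole, ← Nat.filter_coprime_Ico_eq_totient n 1]
  congr 2
  ext k
  simp only [Finset.mem_filter, Finset.mem_Icc, Finset.mem_Ico, Nat.Coprime]
  omega

open Classical in
/-- The Boltzmann weight of a primitive Christoffel word. -/
noncomputable def weight (y : ℝ) (c : ℕ × ℕ) : ℝ≥0∞ :=
  if IsPrim c then ENNReal.ofReal (y ^ (c.1 + c.2)) else 0

/-- A word drawn with parameter `y ^ j` has the weight that `j` copies of it carry in a multiset
with parameter `y`. -/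
theorem weight_pow {y : ℝ} (hy : 0 ≤ y) {j : ℕ} (hj : j ≠ 0) (c : ℕ × ℕ) :
    weight (y ^ j) c = weight y c ^ j := by
  unfold weight
  split_ifs
  · rw [← ENNReal.ofReal_pow (by positivity), ← pow_mul, ← pow_mul, mul_comm]
  · rw [zero_pow hj]

/-- Words are grouped by length `n`; `gcd(n - q, q) = gcd(n, q)` turns primitivity into the test
made by the sampler. -/
theorem tsum_weight_mul (y : ℝ) (g : ℕ × ℕ → ℝ≥0∞) :
    ∑' c, weight y c * g c =
      ∑' n : ℕ, ENNReal.ofReal (y ^ n) * ∑ q ∈ Finset.Icc 1 n,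
        if Nat.gcd n q = 1 then g (n - q, q) else 0 := by
  rw [← tsum_antidiagonal]
  refine tsum_congr fun n => ?_
  rw [← Finset.Nat.sum_antidiagonal_swap,
    Finset.Nat.sum_antidiagonal_eq_sum_range_succ_mk, Finset.mul_sum]
  symm
  refine Finset.sum_subset_zero_on_sdiff (fun q hq => ?_) (fun q hq => ?_) (fun q hq => ?_)
  · simp at hq ⊢; omega
  · have : q = 0 := by
      simp only [Finset.mem_sdiff, Finset.mem_range, Finset.mem_Icc] at hq
      omega
    subst this
    simp [weight, IsPrim]
  · obtain ⟨h1, h2⟩ := Finset.mem_Icc.1 hq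
    have e : IsPrim (n - q, q) ↔ Nat.gcd n q = 1 := by
      unfold IsPrim Nat.Coprime
      rw [and_iff_left (by exact h1), Nat.gcd_sub_self_left h2]
    simp only [Prod.swap_prod_mk, weight, e, Nat.sub_add_cancel h2]
    split_ifs <;> simp

theorem ofReal_lengthProb {y : ℝ} (h0 : 0 < y) (h1 : y < 1) (n : ℕ) :
    ENNReal.ofReal (lengthProb y n) =
      (ENNReal.ofReal (christoffelGF y))⁻¹ * (Nat.totient n * ENNReal.ofReal (y ^ n)) := by
  rw [lengthProb, ENNReal.ofReal_div_of_pos (christoffelGF_pos h0 h1),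
    ENNReal.ofReal_mul (by positivity), ENNReal.ofReal_natCast, div_eq_mul_inv, mul_comm]

/-- The factor `φ(n)` in the law of the length cancels against the uniform choice among the `φ(n)`
admissible heights. -/
theorem expect_drawChristoffel {y : ℝ} (h0 : 0 < y) (h1 : y < 1) (g : ℕ × ℕ → ℝ≥0∞) :
    (drawChristoffel y).expect g =
      (ENNReal.ofReal (christoffelGF y))⁻¹ * ∑' c, weight y c * g c := by
  rw [drawChristoffel, expect_bind, expect_draw, tsum_weight_mul, ← ENNReal.tsum_mul_left]
  refine tsum_congr fun n => ?_
  rw [ofReal_lengthProb h0 h1]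
  rcases Nat.eq_zero_or_pos n with rfl | hn
  · simp
  have hn0 : (n : ℝ≥0∞) ≠ 0 := Nat.cast_ne_zero.2 hn.ne'
  have hφ : (Nat.totient n : ℝ≥0∞) ≠ 0 := Nat.cast_ne_zero.2 (Nat.totient_pos.2 hn).ne'
  change _ * ((repeatUntil (heightTrial n) (fun q => Nat.gcd n q == 1) >>=
    fun r => pure (n - r.1, r.1)).expect g) = _
  rw [expect_bind]
  simp only [expect_pure]
  rw [expect_repeatUntil (haltProb_heightTrial hn.ne') fun q => g (n - q, q),
    acceptProb_heightTrial, expect_heightTrial, ENNReal.mul_inv (Or.inr (ENNReal.natCast_ne_top _))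
    (Or.inr hφ), inv_inv]
  simp only [beq_iff_eq]
  rw [mul_assoc, mul_assoc]
  congr 1
  rw [mul_left_comm]
  congr 1
  have e : (n : ℝ≥0∞) * (n : ℝ≥0∞)⁻¹ = 1 := ENNReal.mul_inv_cancel hn0 (ENNReal.natCast_ne_top _)
  have e' : (Nat.totient n : ℝ≥0∞) * (Nat.totient n : ℝ≥0∞)⁻¹ = 1 :=
    ENNReal.mul_inv_cancel hφ (ENNReal.natCast_ne_top _)
  generalize (∑ q ∈ Finset.Icc 1 n, if Nat.gcd n q = 1 then g (n - q, q) else 0) = s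
  calc _ = ((Nat.totient n : ℝ≥0∞) * (Nat.totient n : ℝ≥0∞)⁻¹) * ((n : ℝ≥0∞) * (n : ℝ≥0∞)⁻¹) * s := by
        ring
    _ = _ := by rw [e, e', one_mul, one_mul]

theorem acceptProb_heightTrial_ne_zero {n : ℕ} (hn : n ≠ 0) :
    acceptProb (heightTrial n) (fun q => Nat.gcd n q == 1) ≠ 0 := by
  rw [acceptProb_heightTrial]
  refine mul_ne_zero (ENNReal.inv_ne_zero.2 (ENNReal.natCast_ne_top _)) ?_
  exact Nat.cast_ne_zero.2 (Nat.totient_pos.2 (Nat.pos_of_ne_zero hn)).ne'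

theorem law_draw (f : ℕ → ℝ) (k : ℕ) : (draw f).law k = ENNReal.ofReal (f k) := by
  classical
  rw [law_eq_expect, expect_draw, tsum_eq_single k]
  · simp
  · intro b hb; simp [hb]

theorem haltProb_drawChristoffel {y : ℝ} (h0 : 0 < y) (h1 : y < 1) :
    (drawChristoffel y).haltProb = 1 := by
  refine haltProb_bind_of_ne_zero (haltProb_draw (lengthProb_nonneg h0 h1)
    (hasSum_lengthProb h0 h1)) fun n hn => ?_
  have hn0 : n ≠ 0 := by
    rintro rfl
    rw [law_draw] at hn
    simp [lengthProb] at hn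
  exact haltProb_bind (haltProb_repeatUntil (haltProb_heightTrial hn0)
    (acceptProb_heightTrial_ne_zero hn0)) fun r => haltProb_pure _

/-- The sum of `n ^ 2 * y ^ n`. -/
noncomputable def sqSum (y : ℝ) : ℝ≥0∞ := ∑' n : ℕ, (n : ℝ≥0∞) ^ 2 * ENNReal.ofReal (y ^ n)

/-- Read off from the fact that the sampler halts with probability one. -/
theorem tsum_weight {y : ℝ} (h0 : 0 < y) (h1 : y < 1) :
    ∑' c, weight y c = ENNReal.ofReal (christoffelGF y) := by
  have h := expect_drawChristoffel h0 h1 1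
  rw [← haltProb_eq_expect, haltProb_drawChristoffel h0 h1] at h
  simp only [Pi.one_apply, mul_one] at h
  have hA : ENNReal.ofReal (christoffelGF y) ≠ 0 := by simpa using christoffelGF_pos h0 h1
  have := congrArg (fun z => ENNReal.ofReal (christoffelGF y) * z) h
  simp only [mul_one] at this
  rw [← mul_assoc, ENNReal.mul_inv_cancel hA ENNReal.ofReal_ne_top, one_mul] at this
  exact this.symm

/-- A length `n` needs `n / φ(n)` attempts on average, each costing `O(n)`; the factor `φ(n)` in the
law of `n` cancels the denominator. The constant comes from `n (n + 1) + n (2 n + 2) ≤ 6 n ^ 2` for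
`n ≥ 1`. -/
theorem expectedCost_drawChristoffel_le {y : ℝ} (h0 : 0 < y) (h1 : y < 1) :
    (drawChristoffel y).expectedCost ≤
      (ENNReal.ofReal (christoffelGF y))⁻¹ * (6 * sqSum y) := by
  have hcost : ∀ n : ℕ, n ≠ 0 → (do
      let r ← repeatUntil (heightTrial n) (fun q => Nat.gcd n q == 1)
      pure (n - r.1, r.1) : Algo (ℕ × ℕ)).expectedCost ≤
        n * (Nat.totient n : ℝ≥0∞)⁻¹ * (2 * n + 2) := by
    intro n hn
    refine (expectedCost_bind_le _ fun r => (haltProb_pure _).le).trans ?_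
    simp only [expectedCost_pure, expect_const, mul_zero, add_zero]
    rw [expectedCost_repeatUntil (haltProb_heightTrial hn) (acceptProb_heightTrial_ne_zero hn),
      acceptProb_heightTrial, ENNReal.mul_inv (Or.inr (ENNReal.natCast_ne_top _))
      (Or.inl (ENNReal.inv_ne_top.2 (Nat.cast_ne_zero.2 hn))), inv_inv]
    gcongr
    exact expectedCost_heightTrial_le hn
  rw [drawChristoffel, expectedCost_bind]
  have h2 : ((draw (lengthProb y)).wsum fun z => (do
      let r ← repeatUntil (heightTrial z.1) (fun q => Nat.gcd z.1 q == 1)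
      pure (z.1 - r.1, r.1) : Algo (ℕ × ℕ)).haltProb * z.2) ≤ (draw (lengthProb y)).expectedCost := by
    rw [wsum_draw, expectedCost_draw]
    refine ENNReal.tsum_le_tsum fun n => ?_
    rcases Nat.eq_zero_or_pos n with rfl | hn
    · simp [lengthProb]
    · rw [haltProb_bind (haltProb_repeatUntil (haltProb_heightTrial hn.ne')
        (acceptProb_heightTrial_ne_zero hn.ne')) fun r => haltProb_pure _]
      simp
  refine (add_le_add_left h2 _).trans ?_
  rw [expectedCost_draw, expect_draw, ← ENNReal.tsum_add, sqSum, ← ENNReal.tsum_mul_left,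
    ← ENNReal.tsum_mul_left]
  refine ENNReal.tsum_le_tsum fun n => ?_
  rcases Nat.eq_zero_or_pos n with rfl | hn
  · simp [lengthProb]
  have hφ : (Nat.totient n : ℝ≥0∞) ≠ 0 := Nat.cast_ne_zero.2 (Nat.totient_pos.2 hn).ne'
  refine (add_le_add le_rfl (mul_le_mul_right (hcost n hn.ne') _)).trans ?_
  rw [ofReal_lengthProb h0 h1]
  calc _ = (ENNReal.ofReal (christoffelGF y))⁻¹ * ((Nat.totient n * (n + 1) +
        ((Nat.totient n : ℝ≥0∞) * (Nat.totient n : ℝ≥0∞)⁻¹) * (n * (2 * n + 2))) *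
          ENNReal.ofReal (y ^ n)) := by ring
    _ ≤ _ := by
      rw [ENNReal.mul_inv_cancel hφ (ENNReal.natCast_ne_top _), one_mul, ← mul_assoc 6]
      gcongr
      have h3 := Nat.totient_le n
      have : Nat.totient n * (n + 1) + n * (2 * n + 2) ≤ 6 * n ^ 2 := by nlinarith
      exact_mod_cast this

/-! ### Convolution operators on functions of multisets -/

/-- An operator that averages a function over translates of its argument. -/
def IsConv {C : Type} (O : (Multiset C → ℝ≥0∞) → Multiset C → ℝ≥0∞) : Prop :=
  ∃ (ι : Type) (k : ι → ℝ≥0∞) (s : ι → Multiset C), ∀ G μ, O G μ = ∑' i, k i * G (μ + s i)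

namespace IsConv

variable {C : Type} {O O' : (Multiset C → ℝ≥0∞) → Multiset C → ℝ≥0∞}

theorem id : IsConv (fun G : Multiset C → ℝ≥0∞ => G) :=
  ⟨Unit, fun _ => 1, fun _ => 0, fun G μ => by simp⟩

theorem comp (h : IsConv O) (h' : IsConv O') : IsConv fun G => O (O' G) := by
  obtain ⟨ι, k, s, h⟩ := h
  obtain ⟨ι', k', s', h'⟩ := h'
  refine ⟨ι × ι', fun i => k i.1 * k' i.2, fun i => s i.1 + s' i.2, fun G μ => ?_⟩
  change O (O' G) μ = _
  rw [h, ENNReal.tsum_prod']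
  refine tsum_congr fun i => ?_
  rw [h', ← ENNReal.tsum_mul_left]
  exact tsum_congr fun i' => by rw [mul_assoc, add_assoc]

theorem iterate (h : IsConv O) (n : ℕ) : IsConv (O^[n]) := by
  induction n with
  | zero => exact IsConv.id
  | succ n ih => rw [Function.iterate_succ']; exact h.comp ih

theorem tsum {Os : ℕ → (Multiset C → ℝ≥0∞) → Multiset C → ℝ≥0∞} (h : ∀ n, IsConv (Os n))
    (a : ℕ → ℝ≥0∞) : IsConv fun G μ => ∑' n, a n * Os n G μ := by
  choose ι k s h using h
  refine ⟨Σ n, ι n, fun i => a i.1 * k i.1 i.2, fun i => s i.1 i.2, fun G μ => ?_⟩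
  rw [ENNReal.tsum_sigma']
  refine tsum_congr fun n => ?_
  rw [h, ← ENNReal.tsum_mul_left]
  exact tsum_congr fun i => by rw [mul_assoc]

theorem add_apply (h : IsConv O) (F G : Multiset C → ℝ≥0∞) (μ : Multiset C) :
    O (fun ν => F ν + G ν) μ = O F μ + O G μ := by
  obtain ⟨ι, k, s, h⟩ := h
  simp only [h, mul_add, ENNReal.tsum_add]

theorem const_mul_apply (h : IsConv O) (a : ℝ≥0∞) (G : Multiset C → ℝ≥0∞) (μ : Multiset C) :
    O (fun ν => a * G ν) μ = a * O G μ := by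
  obtain ⟨ι, k, s, h⟩ := h
  simp only [h, ← ENNReal.tsum_mul_left]
  exact tsum_congr fun i => by ring

theorem zero_apply (h : IsConv O) (μ : Multiset C) : O (fun _ => 0) μ = 0 := by
  have := h.const_mul_apply 0 (fun _ => 0) μ
  simpa using this

theorem sum_apply (h : IsConv O) {κ : Type} (S : Finset κ) (F : κ → Multiset C → ℝ≥0∞)
    (μ : Multiset C) : O (fun ν => ∑ i ∈ S, F i ν) μ = ∑ i ∈ S, O (F i) μ := by
  classical
  induction S using Finset.induction_on with
  | empty => simpa using h.zero_apply μ
  | insert i S hi ih =>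
    simp only [Finset.sum_insert hi]
    rw [h.add_apply, ih]

theorem shift_apply (h : IsConv O) (ν : Multiset C) (G : Multiset C → ℝ≥0∞) (μ : Multiset C) :
    O (fun ξ => G (ξ + ν)) μ = O G (μ + ν) := by
  obtain ⟨ι, k, s, h⟩ := h
  simp only [h]
  exact tsum_congr fun i => by rw [add_right_comm]

end IsConv

section Operators

variable {C : Type} (v : C → ℝ≥0∞)

/-- Add `j` copies of a random element of weight `v c ^ j`. -/
noncomputable def addOp (j : ℕ) (G : Multiset C → ℝ≥0∞) (μ : Multiset C) : ℝ≥0∞ :=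
  ∑' c, v c ^ j * G (μ + Multiset.replicate j c)

/-- The coefficients of the exponential of `1 / j` times an operator. -/
noncomputable def expCoeff (j r : ℕ) : ℝ≥0∞ := (j : ℝ≥0∞)⁻¹ ^ r * (Nat.factorial r : ℝ≥0∞)⁻¹

/-- The exponential of `addOp v j / j`. -/
noncomputable def expOp (j : ℕ) (G : Multiset C → ℝ≥0∞) (μ : Multiset C) : ℝ≥0∞ :=
  ∑' r, expCoeff j r * (addOp v j)^[r] G μ

/-- The exponential of `addOp v j / j`, without the term of order zero. -/
noncomputable def posExpOp (j : ℕ) (G : Multiset C → ℝ≥0∞) (μ : Multiset C) : ℝ≥0∞ :=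
  ∑' r, expCoeff j (r + 1) * (addOp v j)^[r + 1] G μ

/-- The product of the exponentials for the indices `1, …, M`. -/
noncomputable def blockOp : ℕ → (Multiset C → ℝ≥0∞) → Multiset C → ℝ≥0∞
  | 0, G => G
  | M + 1, G => expOp v (M + 1) (blockOp M G)

theorem isConv_addOp (j : ℕ) : IsConv (addOp v j) :=
  ⟨C, fun c => v c ^ j, fun c => Multiset.replicate j c, fun _ _ => rfl⟩

theorem isConv_expOp (j : ℕ) : IsConv (expOp v j) :=
  IsConv.tsum (fun r => (isConv_addOp v j).iterate r) _

theorem isConv_blockOp (M : ℕ) : IsConv (blockOp v M) := by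
  induction M with
  | zero => exact IsConv.id
  | succ M ih => exact (isConv_expOp v (M + 1)).comp ih

theorem expOp_eq (j : ℕ) (G : Multiset C → ℝ≥0∞) (μ : Multiset C) :
    expOp v j G μ = G μ + posExpOp v j G μ := by
  rw [expOp, tsum_eq_zero_add' ENNReal.summable]
  simp [expCoeff, posExpOp]

/-- A Leibniz rule: adding `j` copies of `d` changes the multiplicity of `c` only when `d = c`, and
then by `j`. -/
theorem addOp_count [DecidableEq C] (j : ℕ) (c : C) (G : Multiset C → ℝ≥0∞) (μ : Multiset C) :
    addOp v j (fun ν => ν.count c * G ν) μ =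
      μ.count c * addOp v j G μ + j * (v c ^ j * G (μ + Multiset.replicate j c)) := by
  simp only [addOp]
  have h : ∀ d, v d ^ j * (((μ + Multiset.replicate j d).count c : ℕ) *
      G (μ + Multiset.replicate j d)) = μ.count c * (v d ^ j * G (μ + Multiset.replicate j d)) +
        if d = c then j * (v c ^ j * G (μ + Multiset.replicate j c)) else 0 := by
    intro d
    rw [Multiset.count_add, Multiset.count_replicate]
    by_cases hd : d = c
    · subst hd; simp; ring
    · simp [hd]; ring
  simp only [h]
  rw [ENNReal.tsum_add, ENNReal.tsum_mul_left, tsum_ite_eq]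

theorem iterate_addOp_count [DecidableEq C] (j : ℕ) (c : C) (G : Multiset C → ℝ≥0∞) (r : ℕ) (μ : Multiset C) :
    (addOp v j)^[r + 1] (fun ν => ν.count c * G ν) μ =
      μ.count c * (addOp v j)^[r + 1] G μ +
        (r + 1) * j * v c ^ j * (addOp v j)^[r] G (μ + Multiset.replicate j c) := by
  induction r generalizing μ with
  | zero =>
    simp only [zero_add, Function.iterate_one, Function.iterate_zero, id_eq]
    rw [addOp_count]
    simp; ring
  | succ r ih =>
    rw [Function.iterate_succ_apply', funext ih, (isConv_addOp v j).add_apply, addOp_count,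
      (isConv_addOp v j).const_mul_apply,
      (isConv_addOp v j).shift_apply (Multiset.replicate j c) ((addOp v j)^[r] G),
      ← Function.iterate_succ_apply' (addOp v j) r G,
      ← Function.iterate_succ_apply' (addOp v j) (r + 1) G]
    push_cast
    ring

theorem expCoeff_succ {j : ℕ} (hj : j ≠ 0) (r : ℕ) :
    expCoeff j (r + 1) * ((r + 1) * j) = expCoeff j r := by
  have h1 : (j : ℝ≥0∞)⁻¹ * j = 1 :=
    ENNReal.inv_mul_cancel (Nat.cast_ne_zero.2 hj) (ENNReal.natCast_ne_top j)
  have h2 : ((r + 1 : ℕ) : ℝ≥0∞)⁻¹ * ((r + 1 : ℕ) : ℝ≥0∞) = 1 :=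
    ENNReal.inv_mul_cancel (Nat.cast_ne_zero.2 (by omega)) (ENNReal.natCast_ne_top _)
  unfold expCoeff
  rw [Nat.factorial_succ, Nat.cast_mul, ENNReal.mul_inv (Or.inr (ENNReal.natCast_ne_top _))
    (Or.inl (ENNReal.natCast_ne_top _)), pow_succ]
  calc _ = (j : ℝ≥0∞)⁻¹ ^ r * (Nat.factorial r : ℝ≥0∞)⁻¹ * ((j : ℝ≥0∞)⁻¹ * j) *
        (((r + 1 : ℕ) : ℝ≥0∞)⁻¹ * ((r + 1 : ℕ) : ℝ≥0∞)) := by push_cast; ring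
    _ = _ := by rw [h1, h2, mul_one, mul_one]

/-- The commutator with multiplication by the multiplicity commutes with `addOp v j`, so
exponentiation differentiates formally; the factor `1 / j` in the exponent cancels the `j` copies.
-/
theorem expOp_count [DecidableEq C] {j : ℕ} (hj : j ≠ 0) (c : C) (G : Multiset C → ℝ≥0∞) (μ : Multiset C) :
    expOp v j (fun ν => ν.count c * G ν) μ =
      μ.count c * expOp v j G μ + v c ^ j * expOp v j G (μ + Multiset.replicate j c) := by
  rw [expOp_eq, posExpOp, expOp_eq v j G μ, mul_add, add_assoc]
  congr 1
  simp only [iterate_addOp_count, mul_add]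
  rw [ENNReal.tsum_add, posExpOp, expOp, ← ENNReal.tsum_mul_left, ← ENNReal.tsum_mul_left]
  congr 1
  · exact tsum_congr fun r => by ring
  · refine tsum_congr fun r => ?_
    rw [← expCoeff_succ hj r]; ring

theorem blockOp_count [DecidableEq C] (M : ℕ) (c : C) (G : Multiset C → ℝ≥0∞) (μ : Multiset C) :
    blockOp v M (fun ν => ν.count c * G ν) μ = μ.count c * blockOp v M G μ +
      ∑ j ∈ Finset.Icc 1 M, v c ^ j * blockOp v M G (μ + Multiset.replicate j c) := by
  induction M generalizing μ with
  | zero => simp [blockOp]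
  | succ M ih =>
    have hE := isConv_expOp v (M + 1)
    rw [blockOp, funext ih, hE.add_apply, expOp_count v (by omega), hE.sum_apply,
      Finset.sum_Icc_succ_top (by omega), add_assoc]
    congr 1
    rw [add_comm]
    congr 1
    refine Finset.sum_congr rfl fun j _ => ?_
    rw [hE.const_mul_apply, hE.shift_apply (Multiset.replicate j c) (blockOp v M G)]
    rfl

theorem addOp_single_zero {j : ℕ} (hj : j ≠ 0) (G : Multiset C → ℝ≥0∞)
    (hG : ∀ μ, μ ≠ 0 → G μ = 0) (μ : Multiset C) : addOp v j G μ = 0 := by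
  rw [addOp, ENNReal.tsum_eq_zero]
  intro c
  rw [hG, mul_zero]
  intro h
  have := congrArg Multiset.card h
  simp at this
  exact hj this.2

theorem blockOp_single_zero (M : ℕ) (G : Multiset C → ℝ≥0∞) (hG : ∀ μ, μ ≠ 0 → G μ = 0) :
    blockOp v M G = G := by
  induction M with
  | zero => rfl
  | succ M ih =>
    rw [blockOp, ih]
    funext μ
    rw [expOp_eq, posExpOp, ENNReal.tsum_eq_zero.2, add_zero]
    intro r
    have : addOp v (M + 1) G = fun _ => 0 := funext (addOp_single_zero v (by omega) G hG)
    rw [Function.iterate_succ_apply, this, ((isConv_addOp v (M + 1)).iterate r).zero_apply,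
      mul_zero]

/-- The total weight that the blocks `1, …, M` give to a multiset of at most `M` elements. -/
theorem blockOp_single [DecidableEq C] {M : ℕ} (μ : Multiset C) (hμ : μ.card ≤ M) :
    blockOp v M (fun ν => if ν = μ then 1 else 0) 0 = (μ.map v).prod := by
  induction hn : μ.card using Nat.strong_induction_on generalizing μ with
  | _ n ih =>
  subst hn
  rcases Multiset.empty_or_exists_mem μ with rfl | ⟨c, hc⟩
  · rw [blockOp_single_zero v M _ (fun μ hμ => if_neg hμ)]
    simp
  set m := μ.count c with hm
  have hm0 : m ≠ 0 := (Multiset.count_pos.2 hc).ne'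
  have hmM : m ≤ M := (Multiset.count_le_card _ _).trans hμ
  -- On the indicator of `μ` the multiplicity is the constant `m`. Hence `m` times the unknown
  -- weight is the sum over `1 ≤ j ≤ m` of `v c ^ j` times the weight of `μ` with `j` copies of `c`
  -- removed. By induction these `m` terms all equal the product of the weights. All of them occur
  -- because `m ≤ M`.
  have h1 := blockOp_count v M c (fun ν => if ν = μ then 1 else 0) 0
  have h2 : (fun ν : Multiset C => (ν.count c : ℝ≥0∞) * if ν = μ then 1 else 0) =
      fun ν => (m : ℝ≥0∞) * if ν = μ then 1 else 0 := by
    funext ν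
    by_cases h : ν = μ
    · rw [h]
    · simp [h]
  rw [h2, (isConv_blockOp v M).const_mul_apply, Multiset.count_zero, Nat.cast_zero, zero_mul,
    zero_add] at h1
  have h3 : ∀ j ∈ Finset.Icc 1 M, v c ^ j * blockOp v M (fun ν => if ν = μ then 1 else 0)
      (0 + Multiset.replicate j c) = if j ≤ m then (μ.map v).prod else 0 := by
    intro j hj
    have hj1 := (Finset.mem_Icc.1 hj).1
    rw [← (isConv_blockOp v M).shift_apply (Multiset.replicate j c)
      (fun ν => if ν = μ then 1 else 0) 0]
    split_ifs with hjm
    · have hle : Multiset.replicate j c ≤ μ := Multiset.le_count_iff_replicate_le.1 hjm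
      have hcard := Multiset.card_sub hle
      rw [Multiset.card_replicate] at hcard
      have hpos : 0 < μ.card := Multiset.card_pos_iff_exists_mem.2 ⟨c, hc⟩
      have e : (fun ξ : Multiset C => (if ξ + Multiset.replicate j c = μ then 1 else 0 : ℝ≥0∞)) =
          fun ξ => if ξ = μ - Multiset.replicate j c then 1 else 0 := by
        funext ξ
        congr 1
        exact propext (eq_tsub_iff_add_eq_of_le hle).symm
      rw [e, ih _ (by omega) (μ - Multiset.replicate j c) (by omega) rfl]
      conv_rhs => rw [← Multiset.sub_add_cancel hle, Multiset.map_add, Multiset.prod_add,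
        Multiset.map_replicate, Multiset.prod_replicate]
      ring
    · have e : (fun ξ : Multiset C => (if ξ + Multiset.replicate j c = μ then 1 else 0 : ℝ≥0∞)) =
          fun _ => 0 := by
        funext ξ
        refine if_neg fun h => hjm ?_
        rw [hm, ← h]
        simp
      rw [e, (isConv_blockOp v M).zero_apply, mul_zero]
  rw [Finset.sum_congr rfl h3, ← Finset.sum_filter] at h1
  have h4 : (Finset.Icc 1 M).filter (fun j => j ≤ m) = Finset.Icc 1 m := by
    ext j; simp; omega
  rw [h4, Finset.sum_const, Nat.card_Icc, Nat.add_sub_cancel, nsmul_eq_mul] at h1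
  exact (ENNReal.mul_right_inj (Nat.cast_ne_zero.2 hm0) (ENNReal.natCast_ne_top _)).1 h1

theorem blockOp_mono_index (G : Multiset C → ℝ≥0∞) (μ : Multiset C) :
    Monotone fun M => blockOp v M G μ :=
  monotone_nat_of_le_succ fun M => by rw [blockOp, expOp_eq]; exact le_self_add

theorem add_sum_posExpOp (G : Multiset C → ℝ≥0∞) (μ : Multiset C) (M : ℕ) :
    G μ + ∑ k ∈ Finset.range M, posExpOp v (k + 1) (blockOp v k G) μ = blockOp v M G μ := by
  induction M with
  | zero => simp [blockOp]
  | succ M ih => rw [Finset.sum_range_succ, ← add_assoc, ih, blockOp, expOp_eq]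

/-- A decomposition according to the largest index whose block is not empty; the partial sums
telescope. -/
theorem add_tsum_posExpOp (G : Multiset C → ℝ≥0∞) (μ : Multiset C) :
    G μ + ∑' k, posExpOp v (k + 1) (blockOp v k G) μ = ⨆ M, blockOp v M G μ := by
  rw [ENNReal.tsum_eq_iSup_nat, ENNReal.add_iSup]
  simp only [add_sum_posExpOp]

/-- The sequence increases with `M` and is constant from `M = card μ` on. -/
theorem iSup_blockOp_single [DecidableEq C] (μ : Multiset C) :
    ⨆ M, blockOp v M (fun ν => if ν = μ then 1 else 0) 0 = (μ.map v).prod := by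
  refine le_antisymm (iSup_le fun M => ?_) ?_
  · rw [← blockOp_single v μ (le_max_right M μ.card)]
    exact blockOp_mono_index v _ _ (le_max_left M μ.card)
  · rw [← blockOp_single v μ le_rfl]
    exact le_iSup (fun M => blockOp v M (fun ν => if ν = μ then 1 else 0) 0) μ.card

end Operators

/-! ### The law of the multiset sampler -/

theorem christoffelGF_le {x y : ℝ} (h0 : 0 ≤ y) (hyx : y ≤ x) (h1 : x < 1) :
    christoffelGF y ≤ y * ((1 - x) ^ 2)⁻¹ := by
  have hy1 : y < 1 := hyx.trans_lt h1
  have hn : ‖y‖ < 1 := by rwa [Real.norm_of_nonneg h0]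
  have hs : Summable fun n : ℕ => (n : ℝ) * y ^ n :=
    (hasSum_coe_mul_geometric_of_norm_lt_one hn).summable
  calc christoffelGF y ≤ ∑' n : ℕ, (n : ℝ) * y ^ n := by
        refine (summable_totient_mul_pow h0 hy1).tsum_le_tsum (fun n => ?_) hs
        gcongr
        exact Nat.totient_le n
    _ = y * ((1 - y) ^ 2)⁻¹ := by rw [tsum_coe_mul_geometric_of_norm_lt_one hn, div_eq_mul_inv]
    _ ≤ _ := by
        have : 0 < 1 - x := by linarith
        gcongr

theorem pow_mem_Ioo {x : ℝ} (h0 : 0 < x) (h1 : x < 1) (j : ℕ) :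
    0 < x ^ (j + 1) ∧ x ^ (j + 1) < 1 :=
  ⟨by positivity, pow_lt_one₀ h0.le h1 (by omega)⟩

theorem rate_pos {x : ℝ} (h0 : 0 < x) (h1 : x < 1) (j : ℕ) : 0 < rate x (j + 1) :=
  div_pos (christoffelGF_pos (pow_mem_Ioo h0 h1 j).1 (pow_mem_Ioo h0 h1 j).2) (by positivity)

theorem summable_rate {x : ℝ} (h0 : 0 < x) (h1 : x < 1) : Summable fun j => rate x (j + 1) := by
  have hx : 0 < 1 - x := by linarith
  have hs : Summable fun j : ℕ => x ^ (j + 1) * ((1 - x) ^ 2)⁻¹ := by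
    refine Summable.mul_right _ ?_
    exact (summable_nat_add_iff 1).2 (summable_geometric_of_lt_one h0.le h1)
  refine Summable.of_nonneg_of_le (fun j => (rate_pos h0 h1 j).le) (fun j => ?_) hs
  refine le_trans ?_ (christoffelGF_le (pow_mem_Ioo h0 h1 j).1.le
    (pow_le_of_le_one h0.le h1.le (by omega)) h1)
  refine div_le_self (christoffelGF_pos (pow_mem_Ioo h0 h1 j).1 (pow_mem_Ioo h0 h1 j).2).le ?_
  exact_mod_cast Nat.succ_pos j

/-- The sum of the rates of index larger than `k`. -/
noncomputable def tailRate (x : ℝ) (k : ℕ) : ℝ := ∑' i : ℕ, rate x (k + 1 + i)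

theorem tailRate_eq {x : ℝ} (h0 : 0 < x) (h1 : x < 1) (k : ℕ) :
    tailRate x k = rate x (k + 1) + tailRate x (k + 1) := by
  have hs : Summable fun i : ℕ => rate x (k + 1 + i) := by
    have := (summable_nat_add_iff k).2 (summable_rate h0 h1)
    refine this.congr fun i => ?_
    congr 1; ring
  rw [tailRate, hs.tsum_eq_zero_add, tailRate, add_zero]
  congr 2
  funext i
  congr 1; ring

theorem tailRate_zero_eq {x : ℝ} (h0 : 0 < x) (h1 : x < 1) (k : ℕ) :
    tailRate x 0 = ∑ j ∈ Finset.range k, rate x (j + 1) + tailRate x k := by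
  induction k with
  | zero => simp
  | succ k ih => rw [ih, Finset.sum_range_succ, tailRate_eq h0 h1 k]; ring

theorem tendsto_tailRate (x : ℝ) : Tendsto (tailRate x) atTop (𝓝 0) := by
  have := tendsto_sum_nat_add fun j => rate x (j + 1)
  refine this.congr fun k => tsum_congr fun i => ?_
  congr 1; ring

/-- The product form: all larger indices are empty and the index `k + 1` is not. -/
theorem maxIndexProb_succ {x : ℝ} (h0 : 0 < x) (h1 : x < 1) (k : ℕ) :
    maxIndexProb x (k + 1) =
      Real.exp (-tailRate x (k + 1)) * (1 - Real.exp (-rate x (k + 1))) := by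
  change Real.exp (-tailRate x (k + 1)) - Real.exp (-tailRate x k) = _
  rw [tailRate_eq h0 h1 k, neg_add, Real.exp_add]
  ring

theorem one_sub_exp_neg_rate_pos {x : ℝ} (h0 : 0 < x) (h1 : x < 1) (k : ℕ) :
    0 < 1 - Real.exp (-rate x (k + 1)) := by
  rw [sub_pos, Real.exp_lt_one_iff]
  linarith [rate_pos h0 h1 k]

theorem maxIndexProb_nonneg {x : ℝ} (h0 : 0 < x) (h1 : x < 1) (k : ℕ) : 0 ≤ maxIndexProb x k := by
  rcases k with _ | k
  · exact (Real.exp_pos _).le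
  · rw [maxIndexProb_succ h0 h1]
    exact mul_nonneg (Real.exp_pos _).le (one_sub_exp_neg_rate_pos h0 h1 k).le

theorem hasSum_maxIndexProb {x : ℝ} (h0 : 0 < x) (h1 : x < 1) : HasSum (maxIndexProb x) 1 := by
  rw [hasSum_iff_tendsto_nat_of_nonneg (maxIndexProb_nonneg h0 h1), ← tendsto_add_atTop_iff_nat 1]
  have h : ∀ n, ∑ i ∈ Finset.range (n + 1), maxIndexProb x i = Real.exp (-tailRate x n) := by
    intro n
    induction n with
    | zero => simp [maxIndexProb, maxIndexCDF, tailRate]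
    | succ n ih =>
      rw [Finset.sum_range_succ, ih]
      change _ + (Real.exp (-tailRate x (n + 1)) - Real.exp (-tailRate x n)) = _
      ring
  simp only [h]
  have := (Real.continuous_exp.tendsto _).comp (tendsto_tailRate x).neg
  rwa [neg_zero, Real.exp_zero] at this

theorem poissonProb_nonneg {l : ℝ} (hl : 0 ≤ l) (k : ℕ) : 0 ≤ poissonProb l k := by
  unfold poissonProb; positivity

theorem hasSum_poissonProb (l : ℝ) : HasSum (poissonProb l) 1 := by
  have h := (NormedSpace.expSeries_div_hasSum_exp l).mul_left (Real.exp (-l))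
  rw [← Real.exp_eq_exp_ℝ, ← Real.exp_add, neg_add_cancel, Real.exp_zero] at h
  refine h.congr_fun fun k => ?_
  rw [poissonProb, mul_div_assoc]

theorem posPoissonProb_nonneg {l : ℝ} (hl : 0 < l) (k : ℕ) : 0 ≤ posPoissonProb l k := by
  unfold posPoissonProb
  split_ifs
  · exact le_rfl
  · refine div_nonneg (poissonProb_nonneg hl.le k) ?_
    rw [sub_nonneg, Real.exp_le_one_iff]; linarith

theorem hasSum_posPoissonProb {l : ℝ} (hl : 0 < l) : HasSum (posPoissonProb l) 1 := by
  have hne : 1 - Real.exp (-l) ≠ 0 := by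
    have : Real.exp (-l) < 1 := Real.exp_lt_one_iff.2 (by linarith)
    linarith
  have h := hasSum_poissonProb l
  have h0 : poissonProb l 0 = Real.exp (-l) := by simp [poissonProb]
  rw [← hasSum_nat_add_iff' 1] at h ⊢
  simp only [Finset.range_one, Finset.sum_singleton, h0] at h ⊢
  have h2 := h.div_const (1 - Real.exp (-l))
  rw [div_self hne] at h2
  simpa [posPoissonProb] using h2

theorem haltProb_addWords {x : ℝ} (h0 : 0 < x) (h1 : x < 1) (j r : ℕ) (acc : List (ℕ × ℕ)) :
    (addWords x (j + 1) r acc).haltProb = 1 := by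
  induction r generalizing acc with
  | zero => exact haltProb_pure _
  | succ r ih =>
    exact haltProb_bind (haltProb_drawChristoffel (pow_mem_Ioo h0 h1 j).1 (pow_mem_Ioo h0 h1 j).2)
      fun w => haltProb_bind (haltProb_tick _) fun _ => ih _

theorem haltProb_addBlocks {x : ℝ} (h0 : 0 < x) (h1 : x < 1) (M i : ℕ) (acc : List (ℕ × ℕ)) :
    (addBlocks x M i acc).haltProb = 1 := by
  induction i generalizing acc with
  | zero => exact haltProb_pure _
  | succ i ih =>
    refine haltProb_bind ?_ fun r => haltProb_bind (haltProb_addWords h0 h1 i r acc) fun _ => ih _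
    have hr := rate_pos h0 h1 i
    split_ifs
    · exact haltProb_draw (posPoissonProb_nonneg hr) (hasSum_posPoissonProb hr)
    · exact haltProb_draw (poissonProb_nonneg hr.le) (hasSum_poissonProb _)

theorem haltProb_drawMultiset {x : ℝ} (h0 : 0 < x) (h1 : x < 1) :
    (drawMultiset x).haltProb = 1 :=
  haltProb_bind (haltProb_draw (maxIndexProb_nonneg h0 h1) (hasSum_maxIndexProb h0 h1))
    fun _ => haltProb_addBlocks h0 h1 _ _ _

theorem expect_addWords {x : ℝ} (h0 : 0 < x) (h1 : x < 1) (j r : ℕ)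
    (G : Multiset (ℕ × ℕ) → ℝ≥0∞) (acc : List (ℕ × ℕ)) :
    ((addWords x (j + 1) r acc).expect fun l => G l) =
      (ENNReal.ofReal (christoffelGF (x ^ (j + 1))))⁻¹ ^ r *
        (addOp (weight x) (j + 1))^[r] G acc := by
  induction r generalizing acc with
  | zero => simp [addWords]
  | succ r ih =>
    rw [addWords, expect_bind]
    simp only [expect_bind, expect_tick, ih]
    rw [expect_drawChristoffel (pow_mem_Ioo h0 h1 j).1 (pow_mem_Ioo h0 h1 j).2,
      Function.iterate_succ_apply', addOp]
    simp only [← ENNReal.tsum_mul_left]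
    refine tsum_congr fun c => ?_
    rw [weight_pow h0.le (by omega), ← Multiset.coe_add, Multiset.coe_replicate, add_comm (acc : Multiset (ℕ × ℕ))]
    ring

/-- Normalizing `r` independent words costs `A(x^j)^{-r}`, which cancels the power in the Poisson
law and leaves the coefficients of an operator exponential. -/
theorem ofReal_poissonProb {x : ℝ} (h0 : 0 < x) (h1 : x < 1) (j r : ℕ) :
    ENNReal.ofReal (poissonProb (rate x (j + 1)) r) *
        (ENNReal.ofReal (christoffelGF (x ^ (j + 1))))⁻¹ ^ r =
      ENNReal.ofReal (Real.exp (-rate x (j + 1))) * expCoeff (j + 1) r := by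
  have hA := christoffelGF_pos (pow_mem_Ioo h0 h1 j).1 (pow_mem_Ioo h0 h1 j).2
  have hj : (0 : ℝ) < (j + 1 : ℕ) := by positivity
  have hr : (0 : ℝ) < Nat.factorial r := by positivity
  rw [← ENNReal.ofReal_inv_of_pos hA, ← ENNReal.ofReal_pow (inv_nonneg.2 hA.le),
    ← ENNReal.ofReal_mul (poissonProb_nonneg (rate_pos h0 h1 j).le r), expCoeff,
    ← ENNReal.ofReal_natCast (j + 1), ← ENNReal.ofReal_natCast (Nat.factorial r),
    ← ENNReal.ofReal_inv_of_pos hj, ← ENNReal.ofReal_inv_of_pos hr,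
    ← ENNReal.ofReal_pow (inv_nonneg.2 hj.le), ← ENNReal.ofReal_mul (by positivity),
    ← ENNReal.ofReal_mul (Real.exp_pos _).le]
  congr 1
  rw [poissonProb]
  have : rate x (j + 1) ^ r * (christoffelGF (x ^ (j + 1)))⁻¹ ^ r = ((j + 1 : ℕ) : ℝ)⁻¹ ^ r := by
    rw [← mul_pow, rate]
    congr 1
    field_simp
  rw [← this]
  field_simp

theorem expect_addBlocks {x : ℝ} (h0 : 0 < x) (h1 : x < 1) {M i : ℕ} (hi : i < M)
    (G : Multiset (ℕ × ℕ) → ℝ≥0∞) (acc : List (ℕ × ℕ)) :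
    ((addBlocks x M i acc).expect fun l => G l) =
      ENNReal.ofReal (Real.exp (-∑ j ∈ Finset.range i, rate x (j + 1))) *
        blockOp (weight x) i G acc := by
  induction i generalizing acc with
  | zero => simp [addBlocks, blockOp]
  | succ i ih =>
    rw [addBlocks, if_neg hi.ne, expect_bind, expect_draw]
    have hw : ∀ r, (addWords x (i + 1) r acc >>= fun acc' => addBlocks x M i acc').expect
        (fun l => G l) = (ENNReal.ofReal (christoffelGF (x ^ (i + 1))))⁻¹ ^ r *
          (ENNReal.ofReal (Real.exp (-∑ j ∈ Finset.range i, rate x (j + 1))) *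
            (addOp (weight x) (i + 1))^[r] (blockOp (weight x) i G) acc) := by
      intro r
      rw [expect_bind]
      simp only [ih (Nat.lt_of_succ_lt hi)]
      rw [expect_const_mul, expect_addWords h0 h1]
      ring
    simp only [hw]
    rw [blockOp, expOp, ← ENNReal.tsum_mul_left]
    refine tsum_congr fun r => ?_
    rw [← mul_assoc, ofReal_poissonProb h0 h1, Finset.sum_range_succ, neg_add, Real.exp_add,
      ENNReal.ofReal_mul (Real.exp_pos _).le]
    ring

theorem expect_addBlocks_self {x : ℝ} (h0 : 0 < x) (h1 : x < 1) (i : ℕ)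
    (G : Multiset (ℕ × ℕ) → ℝ≥0∞) (acc : List (ℕ × ℕ)) :
    ((addBlocks x (i + 1) (i + 1) acc).expect fun l => G l) =
      (ENNReal.ofReal (1 - Real.exp (-rate x (i + 1))))⁻¹ *
      ENNReal.ofReal (Real.exp (-∑ j ∈ Finset.range (i + 1), rate x (j + 1))) *
        posExpOp (weight x) (i + 1) (blockOp (weight x) i G) acc := by
  rw [addBlocks, if_pos rfl, expect_bind, expect_draw]
  have hw : ∀ r, (addWords x (i + 1) r acc >>= fun acc' => addBlocks x (i + 1) i acc').expect
      (fun l => G l) = (ENNReal.ofReal (christoffelGF (x ^ (i + 1))))⁻¹ ^ r *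
        (ENNReal.ofReal (Real.exp (-∑ j ∈ Finset.range i, rate x (j + 1))) *
          (addOp (weight x) (i + 1))^[r] (blockOp (weight x) i G) acc) := by
    intro r
    rw [expect_bind]
    simp only [expect_addBlocks h0 h1 (Nat.lt_succ_self i)]
    rw [expect_const_mul, expect_addWords h0 h1]
    ring
  simp only [hw]
  rw [tsum_eq_zero_add' ENNReal.summable, posPoissonProb, if_pos rfl, ENNReal.ofReal_zero, zero_mul,
    zero_add, posExpOp, ← ENNReal.tsum_mul_left]
  refine tsum_congr fun r => ?_
  rw [posPoissonProb, if_neg (by omega),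
    ENNReal.ofReal_div_of_pos (one_sub_exp_neg_rate_pos h0 h1 i), div_eq_mul_inv,
    mul_right_comm, ← mul_assoc (ENNReal.ofReal _), ofReal_poissonProb h0 h1, Finset.sum_range_succ,
    neg_add, Real.exp_add, ENNReal.ofReal_mul (Real.exp_pos _).le]
  ring

/-- The factor `1 - exp(-rate)` in the law of `M` cancels the conditioning of the last block, and
the remaining exponentials multiply to the same constant for every `M`. The sum over `M` is then the
decomposition by the largest index. -/
theorem expect_drawMultiset {x : ℝ} (h0 : 0 < x) (h1 : x < 1)
    (G : Multiset (ℕ × ℕ) → ℝ≥0∞) :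
    ((drawMultiset x).expect fun l => G l) =
      ENNReal.ofReal (Real.exp (-tailRate x 0)) * ⨆ M, blockOp (weight x) M G 0 := by
  rw [drawMultiset, expect_bind, expect_draw, tsum_eq_zero_add' ENNReal.summable,
    ← add_tsum_posExpOp, mul_add, ← ENNReal.tsum_mul_left]
  congr 1
  · simp [addBlocks, maxIndexProb, maxIndexCDF, tailRate]
  · refine tsum_congr fun k => ?_
    rw [expect_addBlocks_self h0 h1, maxIndexProb_succ h0 h1,
      ENNReal.ofReal_mul (Real.exp_pos _).le, tailRate_zero_eq h0 h1 (k + 1), neg_add, Real.exp_add,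
      ENNReal.ofReal_mul (Real.exp_pos _).le]
    have hne : ENNReal.ofReal (1 - Real.exp (-rate x (k + 1))) ≠ 0 := by
      simpa using one_sub_exp_neg_rate_pos h0 h1 k
    rw [Multiset.coe_nil]
    have hc := ENNReal.mul_inv_cancel hne ENNReal.ofReal_ne_top
    generalize (ENNReal.ofReal (1 - Real.exp (-rate x (k + 1))))⁻¹ = b at hc ⊢
    generalize ENNReal.ofReal (1 - Real.exp (-rate x (k + 1))) = a at hc ⊢
    generalize ENNReal.ofReal (Real.exp (-tailRate x (k + 1))) = u
    generalize ENNReal.ofReal (Real.exp (-∑ j ∈ Finset.range (k + 1), rate x (j + 1))) = w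
    generalize posExpOp (weight x) (k + 1) (blockOp (weight x) k G) 0 = p
    calc u * a * (b * w * p) = (a * b) * (w * u * p) := by ring
      _ = _ := by rw [hc, one_mul]

theorem expect_drawMultiset_single {x : ℝ} (h0 : 0 < x) (h1 : x < 1) (μ : Multiset (ℕ × ℕ)) :
    ((drawMultiset x).expect fun l => if (l : Multiset (ℕ × ℕ)) = μ then 1 else 0) =
      ENNReal.ofReal (Real.exp (-tailRate x 0)) * (μ.map (weight x)).prod := by
  rw [expect_drawMultiset h0 h1 fun ν => if ν = μ then 1 else 0, iSup_blockOp_single]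

/-- The law of the multiset of words that is drawn. -/
theorem expect_drawMultiset_eq_tsum {x : ℝ} (h0 : 0 < x) (h1 : x < 1)
    (G : Multiset (ℕ × ℕ) → ℝ≥0∞) :
    ((drawMultiset x).expect fun l => G l) =
      ENNReal.ofReal (Real.exp (-tailRate x 0)) * ∑' μ, (μ.map (weight x)).prod * G μ := by
  rw [← ENNReal.tsum_mul_left]
  have h : ∀ μ : Multiset (ℕ × ℕ), ENNReal.ofReal (Real.exp (-tailRate x 0)) *
      ((μ.map (weight x)).prod * G μ) =
        ∑' z, (drawMultiset x).run z * ((if (z.1 : Multiset (ℕ × ℕ)) = μ then 1 else 0) * G μ) := by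
    intro μ
    rw [← mul_assoc, ← expect_drawMultiset_single h0 h1, expect_eq_wsum, wsum,
      ← ENNReal.tsum_mul_right]
    exact tsum_congr fun z => by rw [mul_assoc]
  simp only [h]
  rw [ENNReal.tsum_comm, expect_eq_wsum, wsum]
  refine tsum_congr fun z => ?_
  rw [ENNReal.tsum_mul_left]
  congr 1
  rw [tsum_eq_single (z.1 : Multiset (ℕ × ℕ))]
  · simp
  · intro μ hμ
    rw [if_neg hμ.symm, zero_mul]

open Classical in
theorem prod_weight {x : ℝ} (h0 : 0 ≤ x) (μ : Multiset (ℕ × ℕ)) :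
    (μ.map (weight x)).prod =
      if ∀ c ∈ μ, IsPrim c then ENNReal.ofReal (x ^ (μ.map fun c => c.1 + c.2).sum) else 0 := by
  induction μ using Multiset.induction_on with
  | empty => simp
  | cons c μ ih =>
    rw [Multiset.map_cons, Multiset.prod_cons, ih, weight, Multiset.map_cons, Multiset.sum_cons]
    simp only [Multiset.forall_mem_cons]
    by_cases h1 : IsPrim c
    · by_cases h2 : ∀ c ∈ μ, IsPrim c
      · rw [if_pos h1, if_pos h2, if_pos (And.intro h1 h2), pow_add x (c.1 + c.2),
          ENNReal.ofReal_mul (by positivity)]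
      · rw [if_neg h2, if_neg (fun h : IsPrim c ∧ ∀ c ∈ μ, IsPrim c => h2 h.2), mul_zero]
    · rw [if_neg h1, if_neg (fun h : IsPrim c ∧ ∀ c ∈ μ, IsPrim c => h1 h.1), zero_mul]

/-! ### The law of the free sampler -/

theorem isPrim_of_run_ne_zero {x : ℝ} (h0 : 0 < x) (h1 : x < 1) {z : List (ℕ × ℕ) × ℕ}
    (hz : (drawMultiset x).run z ≠ 0) : ∀ c ∈ z.1, IsPrim c := by
  classical
  have h := expect_drawMultiset_eq_tsum h0 h1 fun μ => if ∀ c ∈ μ, IsPrim c then 0 else 1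
  have h2 : ∑' μ : Multiset (ℕ × ℕ), (μ.map (weight x)).prod *
      (if ∀ c ∈ μ, IsPrim c then (0 : ℝ≥0∞) else 1) = 0 := by
    rw [ENNReal.tsum_eq_zero]
    intro μ
    rw [prod_weight h0.le]
    split_ifs <;> simp
  rw [h2, mul_zero, expect_eq_wsum, wsum, ENNReal.tsum_eq_zero] at h
  have h3 := (mul_eq_zero.1 (h z)).resolve_left hz
  by_contra hc
  simp only [Multiset.mem_coe] at h3
  rw [if_neg hc] at h3
  exact one_ne_zero h3

theorem expect_drawMultiset_congr {x : ℝ} (h0 : 0 < x) (h1 : x < 1)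
    {f g : List (ℕ × ℕ) → ℝ≥0∞} (h : ∀ l, (∀ c ∈ l, IsPrim c) → f l = g l) :
    (drawMultiset x).expect f = (drawMultiset x).expect g := by
  rw [expect_eq_wsum, expect_eq_wsum]
  refine tsum_congr fun z => ?_
  by_cases hz : (drawMultiset x).run z = 0
  · simp [hz]
  · simp only [h z.1 (isPrim_of_run_ne_zero h0 h1 hz)]

/-- The NW-convex path of a multiset of primitive Christoffel words. -/
noncomputable def pathOfMultiset (μ : {μ : Multiset (ℕ × ℕ) // ∀ c ∈ μ, IsPrim c}) :
    {w : List Bool // IsNWConvex w} :=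
  ⟨pathOf μ.1.toList, isNWConvex_pathOf fun c hc => μ.2 c (Multiset.mem_toList.1 hc)⟩

theorem pathOfMultiset_bijective : Function.Bijective pathOfMultiset := by
  constructor
  · intro μ ν h
    have h' := (pathOf_eq_iff (fun c hc => μ.2 c (Multiset.mem_toList.1 hc))
      (fun c hc => ν.2 c (Multiset.mem_toList.1 hc))).1 (congrArg Subtype.val h)
    refine Subtype.ext ?_
    rw [← Multiset.coe_toList μ.1, ← Multiset.coe_toList ν.1]
    exact Multiset.coe_eq_coe.2 h'
  · rintro ⟨w, hw⟩
    obtain ⟨l, hl, rfl⟩ := exists_pathOf hw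
    refine ⟨⟨(l : Multiset (ℕ × ℕ)), fun c hc => hl c (by simpa using hc)⟩, Subtype.ext ?_⟩
    refine (pathOf_eq_iff (fun c hc => hl c ?_) hl).2 (Multiset.coe_eq_coe.1 (by simp))
    simpa using Multiset.mem_toList.1 hc

theorem size_pathOfMultiset (μ : {μ : Multiset (ℕ × ℕ) // ∀ c ∈ μ, IsPrim c}) :
    size (pathOfMultiset μ).1 = (μ.1.map fun c => c.1 + c.2).sum := by
  rw [pathOfMultiset, size_pathOf, ← Multiset.sum_coe, ← Multiset.map_coe, Multiset.coe_toList]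

theorem expect_toPath (l : List (ℕ × ℕ)) (g : List Bool → ℝ≥0∞) :
    (toPath l).expect g = g (pathOf l) := by
  change (tick (mergeSort (Nat.clog 2 l.length) l).2 >>= fun _ =>
    tick (pathOf l).length >>= fun _ => pure (pathOf l)).expect g = _
  simp [expect_bind]

theorem haltProb_toPath (l : List (ℕ × ℕ)) : (toPath l).haltProb = 1 := by
  rw [haltProb_eq_expect, expect_toPath]; rfl

theorem haltProb_freeSampler {x : ℝ} (h0 : 0 < x) (h1 : x < 1) :
    (freeSampler x).haltProb = 1 :=
  haltProb_bind (haltProb_drawMultiset h0 h1) haltProb_toPath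

theorem expect_freeSampler {x : ℝ} (h0 : 0 < x) (h1 : x < 1) (g : List Bool → ℝ≥0∞) :
    (freeSampler x).expect g = ENNReal.ofReal (Real.exp (-tailRate x 0)) *
      ∑' w : {w : List Bool // IsNWConvex w}, ENNReal.ofReal (x ^ size w.1) * g w.1 := by
  classical
  rw [freeSampler, expect_bind]
  simp only [expect_toPath]
  set G : Multiset (ℕ × ℕ) → ℝ≥0∞ := fun μ =>
    if h : ∀ c ∈ μ, IsPrim c then g (pathOfMultiset ⟨μ, h⟩).1 else 0 with hG
  have h2 : (drawMultiset x).expect (fun l => g (pathOf l)) =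
      (drawMultiset x).expect fun l => G l := by
    refine expect_drawMultiset_congr h0 h1 fun l hl => ?_
    have hl' : ∀ c ∈ (l : Multiset (ℕ × ℕ)), IsPrim c := fun c hc => hl c (by simpa using hc)
    simp only [hG]
    rw [dif_pos hl']
    congr 1
    refine (pathOf_eq_iff hl fun c hc => hl' c (Multiset.mem_toList.1 hc)).2
      (Multiset.coe_eq_coe.1 (by simp))
  rw [h2, expect_drawMultiset_eq_tsum h0 h1]
  congr 1
  rw [← (Equiv.ofBijective _ pathOfMultiset_bijective).tsum_eq]
  have h3 : ∀ μ : Multiset (ℕ × ℕ), (μ.map (weight x)).prod * G μ =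
      Set.indicator {μ | ∀ c ∈ μ, IsPrim c} (fun μ => (μ.map (weight x)).prod * G μ) μ := by
    intro μ
    by_cases h : ∀ c ∈ μ, IsPrim c
    · rw [Set.indicator_of_mem (show μ ∈ {μ : Multiset (ℕ × ℕ) | ∀ c ∈ μ, IsPrim c} from h)]
    · rw [Set.indicator_of_notMem (show μ ∉ {μ : Multiset (ℕ × ℕ) | ∀ c ∈ μ, IsPrim c} from h)]
      simp only [hG]
      rw [dif_neg h, mul_zero]
  rw [tsum_congr h3, ← tsum_subtype {μ : Multiset (ℕ × ℕ) | ∀ c ∈ μ, IsPrim c}]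
  refine tsum_congr fun μ => ?_
  have hμ : ∀ c ∈ μ.1, IsPrim c := μ.2
  rw [prod_weight h0.le, if_pos hμ, Equiv.ofBijective_apply, size_pathOfMultiset]
  simp only [hG]
  rw [dif_pos hμ]
  rfl

/-- Total mass one of the sampler determines the normalizing constant, so no infinite product has to
be expanded. -/
theorem tsum_ofReal_pow_size {x : ℝ} (h0 : 0 < x) (h1 : x < 1) :
    ∑' w : {w : List Bool // IsNWConvex w}, ENNReal.ofReal (x ^ size w.1) =
      ENNReal.ofReal (Real.exp (tailRate x 0)) := by
  have h := expect_freeSampler h0 h1 1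
  rw [← haltProb_eq_expect, haltProb_freeSampler h0 h1] at h
  simp only [Pi.one_apply, mul_one] at h
  have := congrArg (fun z => ENNReal.ofReal (Real.exp (tailRate x 0)) * z) h
  simp only [mul_one] at this
  rw [this, ← mul_assoc, ← ENNReal.ofReal_mul (Real.exp_pos _).le, ← Real.exp_add, add_neg_cancel,
    Real.exp_zero, ENNReal.ofReal_one, one_mul]

theorem summable_pow_size {x : ℝ} (h0 : 0 < x) (h1 : x < 1) :
    Summable fun w : {w : List Bool // IsNWConvex w} => x ^ size w.1 := by
  have h := ENNReal.summable_toReal (f := fun w : {w : List Bool // IsNWConvex w} =>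
    ENNReal.ofReal (x ^ size w.1)) (by rw [tsum_ofReal_pow_size h0 h1]; exact ENNReal.ofReal_ne_top)
  refine h.congr fun w => ?_
  rw [ENNReal.toReal_ofReal (by positivity)]

theorem genFun_eq_exp {x : ℝ} (h0 : 0 < x) (h1 : x < 1) : genFun x = Real.exp (tailRate x 0) := by
  have h := tsum_ofReal_pow_size h0 h1
  rw [← ENNReal.ofReal_tsum_of_nonneg (fun w => by positivity) (summable_pow_size h0 h1)] at h
  exact (ENNReal.ofReal_eq_ofReal_iff (tsum_nonneg fun w => by positivity)
    (Real.exp_pos _).le).1 h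

theorem genFun_pos {x : ℝ} (h0 : 0 < x) (h1 : x < 1) : 0 < genFun x := by
  rw [genFun_eq_exp h0 h1]; exact Real.exp_pos _

theorem expect_freeSampler_eq_tsum {x : ℝ} (h0 : 0 < x) (h1 : x < 1) (g : List Bool → ℝ≥0∞) :
    (freeSampler x).expect g = ∑' w : {w : List Bool // IsNWConvex w},
      ENNReal.ofReal (x ^ size w.1 / genFun x) * g w.1 := by
  rw [expect_freeSampler h0 h1, ← ENNReal.tsum_mul_left]
  refine tsum_congr fun w => ?_
  rw [← mul_assoc, ← ENNReal.ofReal_mul (Real.exp_pos _).le, genFun_eq_exp h0 h1, Real.exp_neg,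
    div_eq_inv_mul]

theorem isBoltzmannSampler_freeSampler {x : ℝ} (h0 : 0 < x) (h1 : x < 1) :
    IsBoltzmannSampler (freeSampler x) x := by
  classical
  constructor
  · intro w hw
    rw [law_eq_expect, expect_freeSampler_eq_tsum h0 h1, tsum_eq_single ⟨w, hw⟩]
    · simp
    · intro w' hw'
      rw [if_neg (fun h => hw' (Subtype.ext h)), mul_zero]
  · intro w hw
    rw [law_eq_expect, expect_freeSampler_eq_tsum h0 h1, ENNReal.tsum_eq_zero]
    intro w'
    rw [if_neg (fun h : w'.1 = w => hw (h ▸ w'.2)), mul_zero]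

/-! ### The exact-size sampler -/

/-- One trial of the exact-size sampler. -/
noncomputable def trial (x : ℝ) : Algo (List Bool) := do
  let w ← freeSampler x
  tick w.length
  pure w

theorem haltProb_trial {x : ℝ} (h0 : 0 < x) (h1 : x < 1) : (trial x).haltProb = 1 :=
  haltProb_bind (haltProb_freeSampler h0 h1) fun w =>
    haltProb_bind (haltProb_tick _) fun _ => haltProb_pure w

/-- The probability that a Boltzmann distributed path has size `n`. -/
noncomputable def sizeProb (x : ℝ) (n : ℕ) : ℝ :=
  (∑' w : {w : List Bool // IsNWConvex w}, if size w.1 = n then x ^ size w.1 else 0) / genFun x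

theorem summable_pow_size_ite {x : ℝ} (h0 : 0 < x) (h1 : x < 1) (n : ℕ) :
    Summable fun w : {w : List Bool // IsNWConvex w} =>
      if size w.1 = n then x ^ size w.1 else 0 := by
  refine Summable.of_nonneg_of_le (fun w => ?_) (fun w => ?_) (summable_pow_size h0 h1)
  · split_ifs <;> positivity
  · split_ifs
    · exact le_rfl
    · positivity

theorem acceptProb_trial {x : ℝ} (h0 : 0 < x) (h1 : x < 1) (n : ℕ) :
    acceptProb (trial x) (fun w => size w == n) = ENNReal.ofReal (sizeProb x n) := by
  have h : acceptProb (trial x) (fun w => size w == n) =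
      (freeSampler x).expect fun w => if size w = n then 1 else 0 := by
    rw [acceptProb, trial, expect_bind]
    simp [expect_bind]
  rw [h, expect_freeSampler_eq_tsum h0 h1, sizeProb, ← tsum_div_const,
    ENNReal.ofReal_tsum_of_nonneg]
  · refine tsum_congr fun w => ?_
    split_ifs <;> simp
  · intro w
    refine div_nonneg ?_ (genFun_pos h0 h1).le
    split_ifs <;> positivity
  · exact (summable_pow_size_ite h0 h1 n).div_const _

/-- The vertical path has no east step. It shows that every size is attained, so that each trial
succeeds with positive probability. -/
theorem isNWConvex_replicate (n : ℕ) : IsNWConvex (List.replicate (n + 1) true) := by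
  refine ⟨by simp [List.replicate_succ], by simp [List.getLast?_replicate], ?_⟩
  rintro i j - ⟨k, hk, -⟩
  have := List.mem_of_getElem? hk
  simp at this

theorem sizeProb_pos {x : ℝ} (h0 : 0 < x) (h1 : x < 1) (n : ℕ) : 0 < sizeProb x n := by
  refine div_pos ?_ (genFun_pos h0 h1)
  have h := (summable_pow_size_ite h0 h1 n).le_tsum ⟨_, isNWConvex_replicate n⟩ fun w _ => by
    split_ifs <;> positivity
  refine lt_of_lt_of_le ?_ h
  simp only [size, List.length_replicate, Nat.add_sub_cancel, if_true]
  positivity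

theorem acceptProb_trial_ne_zero {x : ℝ} (h0 : 0 < x) (h1 : x < 1) (n : ℕ) :
    acceptProb (trial x) (fun w => size w == n) ≠ 0 := by
  rw [acceptProb_trial h0 h1]
  simpa using sizeProb_pos h0 h1 n

theorem haltProb_exactSampler {x : ℝ} (h0 : 0 < x) (h1 : x < 1) (n : ℕ) :
    (exactSampler x n).haltProb = 1 :=
  haltProb_repeatUntil (haltProb_trial h0 h1) (acceptProb_trial_ne_zero h0 h1 n)

theorem expectedTrials_eq {x : ℝ} (h0 : 0 < x) (h1 : x < 1) (n : ℕ) :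
    expectedTrials x n = (ENNReal.ofReal (sizeProb x n))⁻¹ := by
  rw [← acceptProb_trial h0 h1]
  exact expect_trials (haltProb_trial h0 h1) (acceptProb_trial_ne_zero h0 h1 n)

theorem expectedCost_exactSampler {x : ℝ} (h0 : 0 < x) (h1 : x < 1) (n : ℕ) :
    (exactSampler x n).expectedCost =
      (ENNReal.ofReal (sizeProb x n))⁻¹ * (trial x).expectedCost := by
  rw [← acceptProb_trial h0 h1]
  exact expectedCost_repeatUntil (haltProb_trial h0 h1) (acceptProb_trial_ne_zero h0 h1 n)

/-! ### Moments of the multiset of words -/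

theorem multiset_sum_map_eq_tsum {C : Type} [DecidableEq C] (h : C → ℝ≥0∞) (μ : Multiset C) :
    (μ.map h).sum = ∑' c, h c * μ.count c := by
  rw [Finset.sum_multiset_map_count, tsum_eq_sum (s := μ.toFinset)]
  · exact Finset.sum_congr rfl fun c _ => by rw [nsmul_eq_mul, mul_comm]
  · intro c hc
    rw [Multiset.count_eq_zero_of_notMem (by simpa using hc)]
    simp

/-- The multiplicity of `c` is the number of `j ≥ 1` for which `μ` contains `j` copies of `c`; for
each `j` these copies are split off. -/
theorem tsum_prod_mul_count {C : Type} [DecidableEq C] (v : C → ℝ≥0∞) (c : C)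
    (g : Multiset C → ℝ≥0∞) :
    ∑' μ : Multiset C, (μ.map v).prod * (μ.count c * g μ) =
      ∑' j : ℕ, v c ^ (j + 1) *
        ∑' μ : Multiset C, (μ.map v).prod * g (μ + Multiset.replicate (j + 1) c) := by
  have h1 : ∀ μ : Multiset C, (μ.map v).prod * (μ.count c * g μ) =
      ∑' j : ℕ, if Multiset.replicate (j + 1) c ≤ μ then (μ.map v).prod * g μ else 0 := by
    intro μ
    rw [tsum_eq_sum (s := Finset.range (μ.count c))]
    · rw [Finset.sum_congr rfl (g := fun _ => (μ.map v).prod * g μ)]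
      · simp; ring
      · intro j hj
        rw [if_pos (Multiset.le_count_iff_replicate_le.1 (Finset.mem_range.1 hj))]
    · intro j hj
      rw [if_neg]
      intro h
      exact hj (Finset.mem_range.2 (Multiset.le_count_iff_replicate_le.2 h))
  simp only [h1]
  rw [ENNReal.tsum_comm]
  refine tsum_congr fun j => ?_
  rw [← ENNReal.tsum_mul_left]
  have hinj : Function.Injective fun μ : Multiset C => μ + Multiset.replicate (j + 1) c :=
    add_left_injective _
  rw [← hinj.tsum_eq]
  · refine tsum_congr fun μ => ?_
    rw [if_pos (Multiset.le_add_left _ _), Multiset.map_add, Multiset.prod_add,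
      Multiset.map_replicate, Multiset.prod_replicate]
    ring
  · intro μ hμ
    have hle : Multiset.replicate (j + 1) c ≤ μ := by
      by_contra h
      exact hμ (if_neg h)
    exact ⟨μ - Multiset.replicate (j + 1) c, Multiset.sub_add_cancel hle⟩

/-- The Mecke formula for the random multiset of words. -/
theorem expect_drawMultiset_sum_mul {x : ℝ} (h0 : 0 < x) (h1 : x < 1) (h : ℕ × ℕ → ℝ≥0∞)
    (g : Multiset (ℕ × ℕ) → ℝ≥0∞) :
    ((drawMultiset x).expect fun l => ((l : Multiset (ℕ × ℕ)).map h).sum * g l) =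
      ∑' j : ℕ, ∑' c, weight (x ^ (j + 1)) c * (h c *
        (drawMultiset x).expect fun l => g (l + Multiset.replicate (j + 1) c)) := by
  rw [expect_drawMultiset_eq_tsum h0 h1 fun μ => (μ.map h).sum * g μ]
  have e : ∀ (j : ℕ) (c : ℕ × ℕ),
      ((drawMultiset x).expect fun l => g (l + Multiset.replicate (j + 1) c)) =
        ENNReal.ofReal (Real.exp (-tailRate x 0)) *
          ∑' μ : Multiset (ℕ × ℕ), (μ.map (weight x)).prod * g (μ + Multiset.replicate (j + 1) c) :=
    fun j c => expect_drawMultiset_eq_tsum h0 h1 fun μ => g (μ + Multiset.replicate (j + 1) c)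
  simp only [e]
  rw [ENNReal.tsum_comm (α := ℕ)]
  have e2 : ∑' μ : Multiset (ℕ × ℕ), (μ.map (weight x)).prod * ((μ.map h).sum * g μ) =
      ∑' c, h c * ∑' j : ℕ, weight x c ^ (j + 1) * ∑' μ : Multiset (ℕ × ℕ),
        (μ.map (weight x)).prod * g (μ + Multiset.replicate (j + 1) c) := by
    have e3 : ∀ c, h c * ∑' j : ℕ, weight x c ^ (j + 1) * ∑' μ : Multiset (ℕ × ℕ),
        (μ.map (weight x)).prod * g (μ + Multiset.replicate (j + 1) c) =
          ∑' μ : Multiset (ℕ × ℕ), h c * ((μ.map (weight x)).prod * (μ.count c * g μ)) := by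
      intro c
      rw [← tsum_prod_mul_count, ENNReal.tsum_mul_left]
    rw [tsum_congr e3, ENNReal.tsum_comm]
    refine tsum_congr fun μ => ?_
    rw [multiset_sum_map_eq_tsum, ← ENNReal.tsum_mul_right, ← ENNReal.tsum_mul_left]
    exact tsum_congr fun c => by ring
  rw [e2, ← ENNReal.tsum_mul_left]
  refine tsum_congr fun c => ?_
  rw [← mul_assoc, ← ENNReal.tsum_mul_left]
  refine tsum_congr fun j => ?_
  rw [weight_pow h0.le (by omega)]
  ring

/-- The sum of `n * y ^ n`. -/
noncomputable def linSum (y : ℝ) : ℝ≥0∞ := ∑' n : ℕ, (n : ℝ≥0∞) * ENNReal.ofReal (y ^ n)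

theorem linSum_le_sqSum (y : ℝ) : linSum y ≤ sqSum y := by
  refine ENNReal.tsum_le_tsum fun n => ?_
  gcongr
  exact_mod_cast Nat.le_self_pow (by norm_num) n

theorem tsum_weight_mul_le (y : ℝ) {g : ℕ × ℕ → ℝ≥0∞} {b : ℕ → ℝ≥0∞}
    (hg : ∀ c : ℕ × ℕ, g c ≤ b (c.1 + c.2)) :
    ∑' c, weight y c * g c ≤ ∑' n : ℕ, n * b n * ENNReal.ofReal (y ^ n) := by
  rw [tsum_weight_mul]
  refine ENNReal.tsum_le_tsum fun n => ?_
  rw [mul_comm]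
  gcongr
  calc _ ≤ ∑ q ∈ Finset.Icc 1 n, b n := by
        refine Finset.sum_le_sum fun q hq => ?_
        have hq' := (Finset.mem_Icc.1 hq).2
        split_ifs
        · refine (hg _).trans (le_of_eq ?_)
          simp [Nat.sub_add_cancel hq']
        · exact zero_le
    _ = n * b n := by simp

theorem tsum_weight_le_linSum (y : ℝ) : ∑' c, weight y c ≤ linSum y := by
  have := tsum_weight_mul_le y (g := fun _ => 1) (b := fun _ => 1) fun _ => le_rfl
  simpa [linSum] using this

theorem tsum_weight_mul_length_le (y : ℝ) :
    ∑' c : ℕ × ℕ, weight y c * ((c.1 + c.2 : ℕ) : ℝ≥0∞) ≤ sqSum y := by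
  refine (tsum_weight_mul_le y (b := fun n => n) fun c => le_rfl).trans (le_of_eq ?_)
  simp only [sqSum, sq]

/-- Bound for the expected number of words. -/
noncomputable def linTotal (x : ℝ) : ℝ≥0∞ := ∑' j : ℕ, linSum (x ^ (j + 1))

/-- Bound for the variance of the number of words. -/
noncomputable def varTotal (x : ℝ) : ℝ≥0∞ := ∑' j : ℕ, (j + 1) * linSum (x ^ (j + 1))

/-- Bound for the expected size. -/
noncomputable def sqTotal (x : ℝ) : ℝ≥0∞ := ∑' j : ℕ, sqSum (x ^ (j + 1))

theorem linTotal_le_sqTotal (x : ℝ) : linTotal x ≤ sqTotal x :=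
  ENNReal.tsum_le_tsum fun _ => linSum_le_sqSum _

theorem expect_card_le {x : ℝ} (h0 : 0 < x) (h1 : x < 1) :
    ((drawMultiset x).expect fun l => (l.length : ℝ≥0∞)) ≤ linTotal x := by
  have h := expect_drawMultiset_sum_mul h0 h1 (fun _ => 1) fun _ => 1
  simp only [Multiset.map_const', Multiset.sum_replicate, Multiset.coe_card, nsmul_eq_mul, mul_one,
    expect_const, haltProb_drawMultiset h0 h1] at h
  rw [h]
  exact ENNReal.tsum_le_tsum fun j => tsum_weight_le_linSum _

/-- The Mecke formula applied to the cardinality: the inserted `j + 1` copies increase it by `j +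
1`, which produces `varTotal` besides the square of the mean. -/
theorem expect_card_sq_le {x : ℝ} (h0 : 0 < x) (h1 : x < 1) :
    ((drawMultiset x).expect fun l => (l.length : ℝ≥0∞) ^ 2) ≤ linTotal x ^ 2 + varTotal x := by
  have h := expect_drawMultiset_sum_mul h0 h1 (fun _ => 1) fun μ => (μ.card : ℝ≥0∞)
  simp only [Multiset.map_const', Multiset.sum_replicate, Multiset.coe_card, nsmul_eq_mul, mul_one,
    one_mul, Multiset.card_add, Multiset.card_replicate, Nat.cast_add, ← sq] at h
  rw [h]
  simp only [expect_add, expect_const, haltProb_drawMultiset h0 h1, one_mul, mul_add]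
  simp only [ENNReal.tsum_add, ENNReal.tsum_mul_right]
  refine add_le_add ?_ ?_
  · rw [sq]
    gcongr
    · exact ENNReal.tsum_le_tsum fun j => tsum_weight_le_linSum _
    · exact expect_card_le h0 h1
  · refine (le_of_eq ?_).trans (ENNReal.tsum_le_tsum fun j =>
      mul_le_mul_right (tsum_weight_le_linSum (x ^ (j + 1))) _)
    rw [Nat.cast_one, mul_one, ← ENNReal.tsum_add]
    exact tsum_congr fun j => by ring

theorem expect_size_le {x : ℝ} (h0 : 0 < x) (h1 : x < 1) :
    ((drawMultiset x).expect fun l => (size (pathOf l) : ℝ≥0∞)) ≤ sqTotal x := by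
  have h := expect_drawMultiset_sum_mul h0 h1 (fun c => ((c.1 + c.2 : ℕ) : ℝ≥0∞)) fun _ => 1
  simp only [mul_one, expect_const, haltProb_drawMultiset h0 h1] at h
  have e : ∀ l : List (ℕ × ℕ), (size (pathOf l) : ℝ≥0∞) =
      ((l : Multiset (ℕ × ℕ)).map fun c => ((c.1 + c.2 : ℕ) : ℝ≥0∞)).sum := by
    intro l
    rw [size_pathOf, Multiset.map_coe, Multiset.sum_coe, Nat.cast_list_sum, List.map_map]
    rfl
  simp only [e]
  rw [h]
  exact ENNReal.tsum_le_tsum fun j => tsum_weight_mul_length_le _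

/-! ### The cost of one trial -/

theorem expectedCost_addWords_le {x : ℝ} (h0 : 0 < x) (h1 : x < 1) (j r : ℕ)
    (acc : List (ℕ × ℕ)) :
    (addWords x (j + 1) r acc).expectedCost ≤
      r * ((drawChristoffel (x ^ (j + 1))).expectedCost + (j + 1)) := by
  induction r generalizing acc with
  | zero => simp [addWords]
  | succ r ih =>
    rw [addWords]
    refine (expectedCost_bind_le _ fun w => (haltProb_bind (haltProb_tick _)
      fun _ => haltProb_addWords h0 h1 j r _).le).trans ?_
    have h : ∀ w, (tick (j + 1) >>= fun _ =>
        addWords x (j + 1) r (List.replicate (j + 1) w ++ acc)).expectedCost ≤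
          (j + 1) + r * ((drawChristoffel (x ^ (j + 1))).expectedCost + (j + 1)) := by
      intro w
      refine (expectedCost_bind_le _ fun _ => (haltProb_addWords h0 h1 j r _).le).trans ?_
      rw [expectedCost_tick, expect_tick]
      push_cast
      gcongr
      exact ih _
    refine (add_le_add_right (expect_mono _ h) _).trans ?_
    rw [expect_const, haltProb_drawChristoffel (pow_mem_Ioo h0 h1 j).1 (pow_mem_Ioo h0 h1 j).2,
      one_mul]
    push_cast
    exact le_of_eq (by ring)

theorem tsum_poissonProb_mul {l : ℝ} (hl : 0 ≤ l) :
    ∑' k, ENNReal.ofReal (poissonProb l k) * k = ENNReal.ofReal l := by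
  have h : ∀ k : ℕ, poissonProb l (k + 1) * ((k + 1 : ℕ) : ℝ) = poissonProb l k * l := by
    intro k
    rw [poissonProb, poissonProb, Nat.factorial_succ, pow_succ]
    push_cast
    field_simp
  rw [tsum_eq_zero_add' ENNReal.summable]
  simp only [Nat.cast_zero, mul_zero, zero_add]
  have h2 : ∀ k : ℕ, ENNReal.ofReal (poissonProb l (k + 1)) * ((k + 1 : ℕ) : ℝ≥0∞) =
      ENNReal.ofReal (poissonProb l k) * ENNReal.ofReal l := by
    intro k
    rw [← ENNReal.ofReal_natCast, ← ENNReal.ofReal_mul (poissonProb_nonneg hl _), h,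
      ENNReal.ofReal_mul (poissonProb_nonneg hl _)]
  simp only [h2]
  rw [ENNReal.tsum_mul_right, ← ENNReal.ofReal_tsum_of_nonneg (poissonProb_nonneg hl)
    (hasSum_poissonProb l).summable, (hasSum_poissonProb l).tsum_eq, ENNReal.ofReal_one, one_mul]

theorem tsum_posPoissonProb_mul {l : ℝ} (hl : 0 < l) :
    ∑' k, ENNReal.ofReal (posPoissonProb l k) * k =
      (ENNReal.ofReal (1 - Real.exp (-l)))⁻¹ * ENNReal.ofReal l := by
  have hpos : 0 < 1 - Real.exp (-l) := by
    rw [sub_pos, Real.exp_lt_one_iff]; linarith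
  rw [← tsum_poissonProb_mul hl.le, ← ENNReal.tsum_mul_left]
  refine tsum_congr fun k => ?_
  rcases k with _ | k
  · simp
  · rw [posPoissonProb, if_neg (by omega), ENNReal.ofReal_div_of_pos hpos, div_eq_mul_inv]
    ring

/-- Bound for the expected cost of drawing the words of one block. -/
noncomputable def blockCost (x : ℝ) (j : ℕ) : ℝ≥0∞ :=
  ENNReal.ofReal (rate x (j + 1)) * (1 + ((drawChristoffel (x ^ (j + 1))).expectedCost + (j + 1)))

/-- The law `f` is left general in order to cover both the Poisson blocks and the conditioned last
block. -/
theorem expectedCost_block_le {x : ℝ} (h0 : 0 < x) (h1 : x < 1) (i : ℕ) {f : ℕ → ℝ}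
    (hf0 : ∀ k, 0 ≤ f k) (hf : HasSum f 1) {b m : ℝ≥0∞}
    (hm : ∑' k, ENNReal.ofReal (f k) * k ≤ m)
    {next : List (ℕ × ℕ) → Algo (List (ℕ × ℕ))} (hn : ∀ l, (next l).haltProb = 1)
    (hb : ∀ l, (next l).expectedCost ≤ b) (acc : List (ℕ × ℕ)) :
    (draw f >>= fun r => addWords x (i + 1) r acc >>= next).expectedCost ≤
      m * (1 + ((drawChristoffel (x ^ (i + 1))).expectedCost + (i + 1))) + 1 + b := by
  refine (expectedCost_bind_le _ fun r =>
    (haltProb_bind (haltProb_addWords h0 h1 i r acc) hn).le).trans ?_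
  set D := (drawChristoffel (x ^ (i + 1))).expectedCost + (i + 1)
  have h : ∀ r : ℕ, (addWords x (i + 1) r acc >>= next).expectedCost ≤ r * D + b := by
    intro r
    refine (expectedCost_bind_le _ fun l => (hn l).le).trans ?_
    refine add_le_add (expectedCost_addWords_le h0 h1 i r acc) ?_
    refine (expect_mono _ hb).trans ?_
    rw [expect_const, haltProb_addWords h0 h1, one_mul]
  refine (add_le_add_right (expect_mono _ h) _).trans ?_
  have hone : ∑' k, ENNReal.ofReal (f k) = 1 := by
    rw [← ENNReal.ofReal_tsum_of_nonneg hf0 hf.summable, hf.tsum_eq, ENNReal.ofReal_one]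
  rw [expectedCost_draw, expect_add, expect_const, haltProb_draw hf0 hf, one_mul, expect_draw]
  simp only [mul_add, mul_one, ← mul_assoc]
  rw [ENNReal.tsum_add, hone, ENNReal.tsum_mul_right]
  calc _ ≤ m + 1 + (m * D + b) := by gcongr
    _ = _ := by ring

theorem expectedCost_addBlocks_le {x : ℝ} (h0 : 0 < x) (h1 : x < 1) {M i : ℕ} (hi : i < M)
    (acc : List (ℕ × ℕ)) :
    (addBlocks x M i acc).expectedCost ≤ ∑ j ∈ Finset.range i, (blockCost x j + 1) := by
  induction i generalizing acc with
  | zero => simp [addBlocks]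
  | succ i ih =>
    rw [addBlocks, if_neg hi.ne]
    have hr := rate_pos h0 h1 i
    refine (expectedCost_block_le h0 h1 i (poissonProb_nonneg hr.le) (hasSum_poissonProb _)
      (tsum_poissonProb_mul hr.le).le (fun l => haltProb_addBlocks h0 h1 M i l)
      (ih (Nat.lt_of_succ_lt hi)) acc).trans ?_
    rw [Finset.sum_range_succ, add_comm (∑ j ∈ Finset.range i, (blockCost x j + 1))]
    rfl

theorem expectedCost_addBlocks_self_le {x : ℝ} (h0 : 0 < x) (h1 : x < 1) (i : ℕ)
    (acc : List (ℕ × ℕ)) :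
    (addBlocks x (i + 1) (i + 1) acc).expectedCost ≤
      (ENNReal.ofReal (1 - Real.exp (-rate x (i + 1))))⁻¹ * blockCost x i +
        ((i + 1) + ∑ j ∈ Finset.range i, blockCost x j) := by
  rw [addBlocks, if_pos rfl]
  have hr := rate_pos h0 h1 i
  refine (expectedCost_block_le h0 h1 i (posPoissonProb_nonneg hr) (hasSum_posPoissonProb hr)
    (tsum_posPoissonProb_mul hr).le (fun l => haltProb_addBlocks h0 h1 (i + 1) i l)
    (expectedCost_addBlocks_le h0 h1 (Nat.lt_succ_self i)) acc).trans ?_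
  rw [Finset.sum_add_distrib, blockCost]
  simp only [Finset.sum_const, Finset.card_range, nsmul_eq_mul, mul_one]
  exact le_of_eq (by ring)

/-- The conditioned block of index `k` has mean cost inflated by `1 / (1 - exp(-rate))`, but `M = k`
has probability at most `1 - exp(-rate)`, which compensates. The further bound by the rate itself
controls the mean of `M`. -/
theorem expectedCost_drawMultiset_le_blockCost {x : ℝ} (h0 : 0 < x) (h1 : x < 1) :
    (drawMultiset x).expectedCost ≤
      2 * (1 + ∑' k : ℕ, ENNReal.ofReal (rate x (k + 1)) * (k + 1)) + 2 * ∑' k, blockCost x k := by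
  have hp : ∀ k, ENNReal.ofReal (maxIndexProb x (k + 1)) ≤
      ENNReal.ofReal (1 - Real.exp (-rate x (k + 1))) := by
    intro k
    refine ENNReal.ofReal_le_ofReal ?_
    rw [maxIndexProb_succ h0 h1]
    refine mul_le_of_le_one_left (one_sub_exp_neg_rate_pos h0 h1 k).le ?_
    rw [Real.exp_le_one_iff, neg_nonpos]
    exact tsum_nonneg fun i => by rw [add_right_comm]; exact (rate_pos h0 h1 _).le
  have hp2 : ∀ k, ENNReal.ofReal (maxIndexProb x (k + 1)) ≤ ENNReal.ofReal (rate x (k + 1)) := by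
    intro k
    refine (hp k).trans (ENNReal.ofReal_le_ofReal ?_)
    linarith [Real.add_one_le_exp (-rate x (k + 1))]
  have hone : ∑' k, ENNReal.ofReal (maxIndexProb x k) = 1 := by
    rw [← ENNReal.ofReal_tsum_of_nonneg (maxIndexProb_nonneg h0 h1)
      (hasSum_maxIndexProb h0 h1).summable, (hasSum_maxIndexProb h0 h1).tsum_eq, ENNReal.ofReal_one]
  have hone' : ∑' k, ENNReal.ofReal (maxIndexProb x (k + 1)) ≤ 1 := by
    rw [← hone, tsum_eq_zero_add' (f := fun k => ENNReal.ofReal (maxIndexProb x k))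
      ENNReal.summable]
    exact le_add_self
  rw [drawMultiset]
  refine (expectedCost_bind_le _ fun M => (haltProb_addBlocks h0 h1 M M []).le).trans ?_
  have hmean : ∑' k : ℕ, ENNReal.ofReal (maxIndexProb x (k + 1)) * (k + 1) ≤
      ∑' k : ℕ, ENNReal.ofReal (rate x (k + 1)) * (k + 1) :=
    ENNReal.tsum_le_tsum fun k => mul_le_mul_left (hp2 k) _
  have hd : (draw (maxIndexProb x)).expectedCost ≤
      1 + ∑' k : ℕ, ENNReal.ofReal (rate x (k + 1)) * (k + 1) := by
    rw [expectedCost_draw]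
    simp only [mul_add, mul_one]
    rw [ENNReal.tsum_add, hone, add_comm]
    refine add_le_add le_rfl ?_
    rw [tsum_eq_zero_add' ENNReal.summable]
    simp only [Nat.cast_zero, mul_zero, zero_add]
    push_cast
    simpa only [mul_add, mul_one] using hmean
  have hb : ((draw (maxIndexProb x)).expect fun M => (addBlocks x M M []).expectedCost) ≤
      ∑' k : ℕ, ENNReal.ofReal (rate x (k + 1)) * (k + 1) + 2 * ∑' k, blockCost x k := by
    rw [expect_draw, tsum_eq_zero_add' ENNReal.summable]
    have hz : (addBlocks x 0 0 []).expectedCost = 0 := expectedCost_pure _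
    rw [hz, mul_zero, zero_add]
    calc _ ≤ ∑' k : ℕ, (blockCost x k + (ENNReal.ofReal (maxIndexProb x (k + 1)) * (k + 1) +
          ENNReal.ofReal (maxIndexProb x (k + 1)) * ∑' k, blockCost x k)) := by
          refine ENNReal.tsum_le_tsum fun k => ?_
          refine (mul_le_mul_right (expectedCost_addBlocks_self_le h0 h1 k []) _).trans ?_
          rw [mul_add, mul_add]
          gcongr
          · rw [← mul_assoc]
            refine mul_le_of_le_one_left' ?_
            calc _ ≤ ENNReal.ofReal (1 - Real.exp (-rate x (k + 1))) *
                  (ENNReal.ofReal (1 - Real.exp (-rate x (k + 1))))⁻¹ := by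
                  exact mul_le_mul' (hp k) le_rfl
              _ ≤ 1 := ENNReal.mul_inv_le_one _
          · exact ENNReal.sum_le_tsum _
      _ ≤ _ := by
          rw [ENNReal.tsum_add, ENNReal.tsum_add, ENNReal.tsum_mul_right]
          calc _ ≤ ∑' k, blockCost x k + (∑' k : ℕ, ENNReal.ofReal (rate x (k + 1)) * (k + 1) +
                1 * ∑' k, blockCost x k) := by gcongr
            _ = _ := by ring
  calc _ ≤ (1 + ∑' k : ℕ, ENNReal.ofReal (rate x (k + 1)) * (k + 1)) +
        (∑' k : ℕ, ENNReal.ofReal (rate x (k + 1)) * (k + 1) + 2 * ∑' k, blockCost x k) :=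
      add_le_add hd hb
    _ ≤ (1 + ∑' k : ℕ, ENNReal.ofReal (rate x (k + 1)) * (k + 1)) +
        (1 + ∑' k : ℕ, ENNReal.ofReal (rate x (k + 1)) * (k + 1) + 2 * ∑' k, blockCost x k) := by
      gcongr
      exact le_add_self
    _ = _ := by ring

theorem ofReal_rate_mul {x : ℝ} (h0 : 0 < x) (h1 : x < 1) (k : ℕ) :
    ENNReal.ofReal (rate x (k + 1)) * (k + 1) = ENNReal.ofReal (christoffelGF (x ^ (k + 1))) := by
  have : ((k : ℝ≥0∞) + 1) = ENNReal.ofReal ((k + 1 : ℕ) : ℝ) := by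
    rw [ENNReal.ofReal_natCast]; push_cast; rfl
  rw [this, ← ENNReal.ofReal_mul (rate_pos h0 h1 k).le, rate, div_mul_cancel₀]
  exact_mod_cast Nat.succ_ne_zero k

theorem ofReal_christoffelGF_le {x : ℝ} (h0 : 0 < x) (h1 : x < 1) (k : ℕ) :
    ENNReal.ofReal (christoffelGF (x ^ (k + 1))) ≤ linSum (x ^ (k + 1)) := by
  rw [← tsum_weight (pow_mem_Ioo h0 h1 k).1 (pow_mem_Ioo h0 h1 k).2]
  exact tsum_weight_le_linSum _

theorem blockCost_le {x : ℝ} (h0 : 0 < x) (h1 : x < 1) (k : ℕ) :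
    blockCost x k ≤ 8 * sqSum (x ^ (k + 1)) := by
  have hy := pow_mem_Ioo h0 h1 k
  have hA : ENNReal.ofReal (christoffelGF (x ^ (k + 1))) ≠ 0 := by
    simpa using christoffelGF_pos hy.1 hy.2
  have hle : ENNReal.ofReal (rate x (k + 1)) ≤ ENNReal.ofReal (christoffelGF (x ^ (k + 1))) := by
    rw [← ofReal_rate_mul h0 h1]
    exact le_mul_of_one_le_right' le_add_self
  have hS := (ofReal_christoffelGF_le h0 h1 k).trans (linSum_le_sqSum _)
  -- The three terms are the search for the Poisson number, the drawing of the words and their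
  -- copying, whence `8 = 1 + 6 + 1`.
  calc blockCost x k = ENNReal.ofReal (rate x (k + 1)) +
        ENNReal.ofReal (rate x (k + 1)) * (drawChristoffel (x ^ (k + 1))).expectedCost +
          ENNReal.ofReal (rate x (k + 1)) * (k + 1) := by rw [blockCost]; ring
    _ ≤ sqSum (x ^ (k + 1)) + 6 * sqSum (x ^ (k + 1)) + sqSum (x ^ (k + 1)) := by
        refine add_le_add (add_le_add (hle.trans hS) ?_) ?_
        · calc _ ≤ ENNReal.ofReal (christoffelGF (x ^ (k + 1))) *
                ((ENNReal.ofReal (christoffelGF (x ^ (k + 1))))⁻¹ * (6 * sqSum (x ^ (k + 1)))) := by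
                gcongr
                exact expectedCost_drawChristoffel_le hy.1 hy.2
            _ = _ := by
                rw [← mul_assoc, ENNReal.mul_inv_cancel hA ENNReal.ofReal_ne_top, one_mul]
        · rw [ofReal_rate_mul h0 h1]; exact hS
    _ = _ := by ring

theorem expectedCost_drawMultiset_le {x : ℝ} (h0 : 0 < x) (h1 : x < 1) :
    (drawMultiset x).expectedCost ≤ 2 + 18 * sqTotal x := by
  refine (expectedCost_drawMultiset_le_blockCost h0 h1).trans ?_
  have e1 : ∑' k : ℕ, ENNReal.ofReal (rate x (k + 1)) * (k + 1) ≤ sqTotal x := by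
    refine ENNReal.tsum_le_tsum fun k => ?_
    rw [ofReal_rate_mul h0 h1]
    exact (ofReal_christoffelGF_le h0 h1 k).trans (linSum_le_sqSum _)
  have e2 : ∑' k, blockCost x k ≤ 8 * sqTotal x := by
    rw [sqTotal, ← ENNReal.tsum_mul_left]
    exact ENNReal.tsum_le_tsum fun k => blockCost_le h0 h1 k
  calc _ ≤ 2 * (1 + sqTotal x) + 2 * (8 * sqTotal x) := by gcongr
    _ = _ := by ring

theorem sq_le_two_pow (d : ℕ) : d ^ 2 ≤ 2 * 2 ^ d := by
  induction d with
  | zero => simp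
  | succ d ih =>
    rcases Nat.lt_or_ge d 3 with h | h
    · interval_cases d <;> norm_num
    · rw [pow_succ 2 d]; nlinarith

theorem two_pow_clog_le (n : ℕ) : 2 ^ Nat.clog 2 n ≤ 2 * n + 1 := by
  rcases Nat.lt_or_ge 1 n with h | h
  · have h1 := Nat.pow_pred_clog_lt_self (b := 2) (by norm_num) h
    have h2 := Nat.clog_pos (b := 2) (by norm_num) h
    obtain ⟨d, hd⟩ := Nat.exists_eq_succ_of_ne_zero h2.ne'
    rw [hd, Nat.pred_succ] at h1
    rw [hd, pow_succ]
    omega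
  · interval_cases n <;> simp

/-- The inequality of arithmetic and geometric means. It replaces the mean of `L log L` in the
sorting cost by the first two moments of `L`. -/
theorem two_mul_le_sq_mul_add_inv {t : ℝ} (ht : 0 < t) (d : ℕ) :
    (2 * d : ℝ≥0∞) ≤ d ^ 2 * ENNReal.ofReal t + (ENNReal.ofReal t)⁻¹ := by
  have h : (2 * d : ℝ) ≤ d ^ 2 * t + t⁻¹ := by
    have h1 : (d : ℝ) ^ 2 * t + t⁻¹ - 2 * d = t * (d - t⁻¹) ^ 2 := by field_simp; ring
    have h2 : 0 ≤ t * (d - t⁻¹) ^ 2 := by positivity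
    linarith
  have h' := ENNReal.ofReal_le_ofReal h
  rwa [ENNReal.ofReal_add (by positivity) (by positivity), ENNReal.ofReal_mul (by norm_num),
    ENNReal.ofReal_mul (by positivity), ENNReal.ofReal_pow (by positivity), ENNReal.ofReal_natCast,
    ENNReal.ofReal_inv_of_pos ht, ENNReal.ofReal_ofNat] at h'

theorem mergeSort_cost_le {t : ℝ} (ht : 0 < t) (l : List (ℕ × ℕ)) :
    ((mergeSort (Nat.clog 2 l.length) l).2 : ℝ≥0∞) ≤
      6 * ENNReal.ofReal t * l.length ^ 2 + (ENNReal.ofReal t)⁻¹ * l.length + 4 * l.length + 2 := by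
  set L := l.length
  set d := Nat.clog 2 L
  have h1 : (mergeSort d l).2 + 1 ≤ 2 * L * d + 2 * 2 ^ d := mergeSort_steps d l
  have h2 : 2 ^ d ≤ 2 * L + 1 := two_pow_clog_le L
  have h3 := sq_le_two_pow d
  have h4 : (mergeSort d l).2 ≤ 2 * L * d + (4 * L + 2) := by
    have : 2 * 2 ^ d ≤ 4 * L + 2 := by omega
    omega
  -- Here `d ^ 2 ≤ 2 * 2 ^ d ≤ 4 L + 2 ≤ 6 L` for `L ≥ 1`.
  have h5 : L * d ^ 2 ≤ 6 * L ^ 2 := by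
    rcases Nat.eq_zero_or_pos L with h | h
    · simp [h]
    · have : d ^ 2 ≤ 6 * L := by omega
      nlinarith
  calc ((mergeSort d l).2 : ℝ≥0∞) ≤ ((2 * L * d + (4 * L + 2) : ℕ) : ℝ≥0∞) := by exact_mod_cast h4
    _ = L * (2 * d) + (4 * L + 2) := by push_cast; ring
    _ ≤ L * (d ^ 2 * ENNReal.ofReal t + (ENNReal.ofReal t)⁻¹) + (4 * L + 2) := by
        gcongr
        exact two_mul_le_sq_mul_add_inv ht d
    _ = ((L * d ^ 2 : ℕ) : ℝ≥0∞) * ENNReal.ofReal t + (ENNReal.ofReal t)⁻¹ * L + 4 * L + 2 := by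
        push_cast; ring
    _ ≤ ((6 * L ^ 2 : ℕ) : ℝ≥0∞) * ENNReal.ofReal t + (ENNReal.ofReal t)⁻¹ * L + 4 * L + 2 := by
        gcongr
    _ = _ := by push_cast; ring

theorem length_pathOf (l : List (ℕ × ℕ)) : (pathOf l).length = size (pathOf l) + 1 := by
  simp [size, pathOf]

theorem expectedCost_toPath_le (l : List (ℕ × ℕ)) :
    (toPath l).expectedCost ≤
      (mergeSort (Nat.clog 2 l.length) l).2 + (size (pathOf l) + 1) := by
  change (tick (mergeSort (Nat.clog 2 l.length) l).2 >>= fun _ =>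
    tick (pathOf l).length >>= fun _ => pure (pathOf l)).expectedCost ≤ _
  refine (expectedCost_bind_le _ fun _ => (haltProb_bind (haltProb_tick _)
    fun _ => haltProb_pure _).le).trans ?_
  rw [expectedCost_tick, expect_tick]
  gcongr
  refine (expectedCost_bind_le _ fun _ => (haltProb_pure _).le).trans ?_
  rw [length_pathOf]
  simp

/-- Bound for the expected cost of one trial of the exact-size sampler. -/
theorem expectedCost_trial_le {x t : ℝ} (h0 : 0 < x) (h1 : x < 1) (ht : 0 < t) :
    (trial x).expectedCost ≤ 6 + 24 * sqTotal x +
      6 * ENNReal.ofReal t * (linTotal x ^ 2 + varTotal x) +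
        (ENNReal.ofReal t)⁻¹ * linTotal x := by
  have hM := haltProb_drawMultiset h0 h1
  have hs : ((freeSampler x).expect fun w => (w.length : ℝ≥0∞)) ≤ sqTotal x + 1 := by
    rw [freeSampler, expect_bind]
    simp only [expect_toPath, length_pathOf, Nat.cast_add, Nat.cast_one]
    rw [expect_add, expect_const, hM, one_mul]
    gcongr
    exact expect_size_le h0 h1
  have hf : (freeSampler x).expectedCost ≤ 2 + 18 * sqTotal x +
      (6 * ENNReal.ofReal t * (linTotal x ^ 2 + varTotal x) + (ENNReal.ofReal t)⁻¹ * linTotal x +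
        4 * linTotal x + 2 + (sqTotal x + 1)) := by
    rw [freeSampler]
    refine (expectedCost_bind_le _ fun l => (haltProb_toPath l).le).trans ?_
    refine add_le_add (expectedCost_drawMultiset_le h0 h1) ?_
    refine (expect_mono _ fun l => (expectedCost_toPath_le l).trans
      (add_le_add_left (mergeSort_cost_le ht l) _)).trans ?_
    simp only [expect_add, expect_const_mul, expect_const, hM, one_mul]
    gcongr
    · exact expect_card_sq_le h0 h1
    · exact expect_card_le h0 h1
    · exact expect_card_le h0 h1
    · exact expect_size_le h0 h1
  rw [trial]
  refine (expectedCost_bind_le _ fun w => (haltProb_bind (haltProb_tick _)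
    fun _ => haltProb_pure _).le).trans ?_
  have ht' : ∀ w : List Bool, (tick w.length >>= fun _ => pure w : Algo (List Bool)).expectedCost ≤
      w.length := by
    intro w
    refine (expectedCost_bind_le _ fun _ => (haltProb_pure _).le).trans ?_
    simp
  refine (add_le_add hf ((expect_mono _ ht').trans hs)).trans ?_
  calc _ ≤ 2 + 18 * sqTotal x +
      (6 * ENNReal.ofReal t * (linTotal x ^ 2 + varTotal x) + (ENNReal.ofReal t)⁻¹ * linTotal x +
        4 * sqTotal x + 2 + (sqTotal x + 1)) + (sqTotal x + 1) := by
        gcongr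
        exact linTotal_le_sqTotal x
    _ = _ := by ring

/-! ### Asymptotics of exponential sums -/

/-- The sum of `n ^ r * exp (- n s)`. -/
noncomputable def powExp (r : ℕ) (s : ℝ) : ℝ := ∑' n : ℕ, (n : ℝ) ^ r * Real.exp (-(n * s))

theorem exp_neg_nat_mul (n : ℕ) (s : ℝ) : Real.exp (-(n * s)) = Real.exp (-s) ^ n := by
  rw [← Real.exp_nat_mul]; congr 1; ring

theorem norm_exp_neg_lt_one {s : ℝ} (hs : 0 < s) : ‖Real.exp (-s)‖ < 1 := by
  rw [Real.norm_of_nonneg (Real.exp_pos _).le, Real.exp_lt_one_iff]; linarith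

theorem summable_powExp (r : ℕ) {s : ℝ} (hs : 0 < s) :
    Summable fun n : ℕ => (n : ℝ) ^ r * Real.exp (-(n * s)) := by
  simp only [exp_neg_nat_mul]
  exact summable_pow_mul_geometric_of_norm_lt_one r (norm_exp_neg_lt_one hs)

theorem powExp_nonneg (r : ℕ) (s : ℝ) : 0 ≤ powExp r s := tsum_nonneg fun n => by positivity

/-- Half of the exponential absorbs the power through `y ^ r / r! ≤ e ^ y`, and the other half is
summed as a geometric series. The bound holds for all `s > 0`, as dominated convergence over dilates
requires. For `r = 0` it would fail, because of the term `n = 0`. -/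
theorem powExp_le {r : ℕ} (hr : r ≠ 0) {s : ℝ} (hs : 0 < s) :
    s ^ (r + 1) * powExp r s ≤ Nat.factorial r * 2 ^ (r + 1) := by
  have hgeo : HasSum (fun n : ℕ => Real.exp (-((n + 1 : ℕ) * (s / 2))))
      (Real.exp (-(s / 2)) * (1 - Real.exp (-(s / 2)))⁻¹) := by
    have h := (hasSum_geometric_of_norm_lt_one (norm_exp_neg_lt_one (half_pos hs))).mul_left
      (Real.exp (-(s / 2)))
    refine h.congr_fun fun n => ?_
    rw [exp_neg_nat_mul, pow_succ']
  have hterm : ∀ n : ℕ, s ^ (r + 1) * ((n : ℝ) ^ r * Real.exp (-(n * s))) ≤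
      s * (Nat.factorial r * 2 ^ r) * Real.exp (-(n * (s / 2))) := by
    intro n
    have h1 := Real.pow_div_factorial_le_exp (n * (s / 2)) (by positivity) r
    rw [div_le_iff₀ (by positivity)] at h1
    have h2 : (s * n) ^ r ≤ 2 ^ r * (Real.exp (n * (s / 2)) * Nat.factorial r) := by
      calc (s * n) ^ r = 2 ^ r * (n * (s / 2)) ^ r := by rw [← mul_pow]; congr 1; ring
        _ ≤ _ := by gcongr
    have h3 : Real.exp (n * (s / 2)) * Real.exp (-(n * s)) = Real.exp (-(n * (s / 2))) := by
      rw [← Real.exp_add]; congr 1; ring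
    calc s ^ (r + 1) * ((n : ℝ) ^ r * Real.exp (-(n * s)))
        = s * (s * n) ^ r * Real.exp (-(n * s)) := by rw [mul_pow]; ring
      _ ≤ s * (2 ^ r * (Real.exp (n * (s / 2)) * Nat.factorial r)) * Real.exp (-(n * s)) := by
          gcongr
      _ = s * (Nat.factorial r * 2 ^ r) * (Real.exp (n * (s / 2)) * Real.exp (-(n * s))) := by ring
      _ = _ := by rw [h3]
  have h0 : powExp r s = ∑' n : ℕ, ((n + 1 : ℕ) : ℝ) ^ r * Real.exp (-((n + 1 : ℕ) * s)) := by
    rw [powExp, (summable_powExp r hs).tsum_eq_zero_add]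
    simp [hr]
  have hs1 : Summable fun n : ℕ => ((n + 1 : ℕ) : ℝ) ^ r * Real.exp (-((n + 1 : ℕ) * s)) :=
    (summable_nat_add_iff 1).2 (summable_powExp r hs)
  rw [h0, ← tsum_mul_left]
  refine ((hs1.mul_left _).tsum_le_tsum (fun n => hterm (n + 1))
    (hgeo.summable.mul_left _)).trans ?_
  rw [tsum_mul_left, hgeo.tsum_eq]
  have he : s / 2 * Real.exp (-(s / 2)) ≤ 1 - Real.exp (-(s / 2)) := by
    have h1 := Real.add_one_le_exp (s / 2)
    have h2 : Real.exp (s / 2) * Real.exp (-(s / 2)) = 1 := by rw [← Real.exp_add]; simp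
    nlinarith [Real.exp_pos (-(s / 2))]
  have hpos : 0 < 1 - Real.exp (-(s / 2)) := by
    rw [sub_pos, Real.exp_lt_one_iff]; linarith
  have h5 : s * (Real.exp (-(s / 2)) * (1 - Real.exp (-(s / 2)))⁻¹) ≤ 2 := by
    rw [← mul_assoc, ← div_eq_mul_inv, div_le_iff₀ hpos]
    linarith
  calc _ = (Nat.factorial r * 2 ^ r) * (s * (Real.exp (-(s / 2)) * (1 - Real.exp (-(s / 2)))⁻¹)) := by
        ring
    _ ≤ (Nat.factorial r * 2 ^ r) * 2 := by gcongr
    _ = _ := by ring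

theorem tendsto_div_one_sub_exp :
    Tendsto (fun s : ℝ => s * (1 / (1 - Real.exp (-s)))) (𝓝[>] 0) (𝓝 1) := by
  have h : HasDerivAt (fun s : ℝ => 1 - Real.exp (-s)) 1 0 := by
    have := ((hasDerivAt_neg (0 : ℝ)).exp).const_sub 1
    simpa using this
  have h2 := h.tendsto_slope_zero_right
  simp only [zero_add, neg_zero, Real.exp_zero, sub_self, sub_zero, smul_eq_mul] at h2
  have h3 := h2.inv₀ one_ne_zero
  rw [inv_one] at h3
  refine h3.congr fun s => ?_
  rw [mul_inv, inv_inv, one_div]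

theorem hasSum_choose_exp (k : ℕ) {s : ℝ} (hs : 0 < s) :
    HasSum (fun n : ℕ => ((n + k).choose k : ℝ) * Real.exp (-(n * s)))
      ((1 / (1 - Real.exp (-s))) ^ (k + 1)) := by
  have := hasSum_choose_mul_geometric_of_norm_lt_one k (norm_exp_neg_lt_one hs)
  simp only [exp_neg_nat_mul]
  rwa [one_div_pow]

/-- From `n ^ 2 = 2 C(n+2, 2) - 3 C(n+1, 1) + 1` and the negative binomial series; `powExp_three` is
analogous. -/
theorem powExp_two {s : ℝ} (hs : 0 < s) : powExp 2 s = 2 * (1 / (1 - Real.exp (-s))) ^ 3 -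
    3 * (1 / (1 - Real.exp (-s))) ^ 2 + 1 / (1 - Real.exp (-s)) := by
  have h := (((hasSum_choose_exp 2 hs).mul_left 2).sub ((hasSum_choose_exp 1 hs).mul_left 3)).add
    (hasSum_choose_exp 0 hs)
  rw [zero_add, pow_one] at h
  rw [← h.tsum_eq, powExp]
  refine tsum_congr fun n => ?_
  have h2 : ((n + 2).choose 2 : ℝ) = (n + 2) * (n + 1) / 2 := by
    rw [Nat.cast_choose_two]; push_cast; ring
  rw [h2, Nat.choose_one_right, Nat.choose_zero_right]
  push_cast
  ring

theorem cast_choose_three (n : ℕ) : ((n + 3).choose 3 : ℝ) = (n + 3) * (n + 2) * (n + 1) / 6 := by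
  have h := Nat.add_one_mul_choose_eq (n + 2) 2
  have h2 : ((n + 2).choose 2 : ℝ) = (n + 2) * (n + 1) / 2 := by
    rw [Nat.cast_choose_two]; push_cast; ring
  have h' : ((n + 2 + 1 : ℕ) : ℝ) * ((n + 2).choose 2 : ℝ) = ((n + 3).choose 3 : ℝ) * 3 := by
    exact_mod_cast h
  rw [h2] at h'
  push_cast at h'
  linarith

theorem powExp_three {s : ℝ} (hs : 0 < s) : powExp 3 s = 6 * (1 / (1 - Real.exp (-s))) ^ 4 -
    12 * (1 / (1 - Real.exp (-s))) ^ 3 + 7 * (1 / (1 - Real.exp (-s))) ^ 2 -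
      1 / (1 - Real.exp (-s)) := by
  have h := ((((hasSum_choose_exp 3 hs).mul_left 6).sub ((hasSum_choose_exp 2 hs).mul_left 12)).add
    ((hasSum_choose_exp 1 hs).mul_left 7)).sub (hasSum_choose_exp 0 hs)
  rw [zero_add, pow_one] at h
  rw [← h.tsum_eq, powExp]
  refine tsum_congr fun n => ?_
  have h2 : ((n + 2).choose 2 : ℝ) = (n + 2) * (n + 1) / 2 := by
    rw [Nat.cast_choose_two]; push_cast; ring
  rw [h2, cast_choose_three, Nat.choose_one_right, Nat.choose_zero_right]
  push_cast
  ring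

theorem tendsto_id_nhdsGT_zero : Tendsto (fun s : ℝ => s) (𝓝[>] 0) (𝓝 0) :=
  tendsto_nhdsWithin_of_tendsto_nhds tendsto_id

theorem tendsto_powExp_two :
    Tendsto (fun s : ℝ => s ^ 3 * powExp 2 s) (𝓝[>] 0) (𝓝 2) := by
  have u := tendsto_div_one_sub_exp
  have s := tendsto_id_nhdsGT_zero
  have h := (((u.pow 3).const_mul 2).sub ((s.mul (u.pow 2)).const_mul 3)).add ((s.pow 2).mul u)
  norm_num at h
  refine h.congr' ?_
  filter_upwards [self_mem_nhdsWithin] with s hs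
  rw [powExp_two hs]
  ring

theorem tendsto_powExp_three :
    Tendsto (fun s : ℝ => s ^ 4 * powExp 3 s) (𝓝[>] 0) (𝓝 6) := by
  have u := tendsto_div_one_sub_exp
  have s := tendsto_id_nhdsGT_zero
  have h := ((((u.pow 4).const_mul 6).sub ((s.mul (u.pow 3)).const_mul 12)).add
    (((s.pow 2).mul (u.pow 2)).const_mul 7)).sub ((s.pow 3).mul u)
  norm_num at h
  refine h.congr' ?_
  filter_upwards [self_mem_nhdsWithin] with s hs
  rw [powExp_three hs]
  ring

/-- Tannery's theorem for sums of dilates of a bounded function. -/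
theorem tendsto_tsum_dilates {ι : Type} {V : ℝ → ℝ} {w k : ι → ℝ} {C L : ℝ}
    (hC : ∀ s, 0 < s → |V s| ≤ C) (hV : Tendsto V (𝓝[>] 0) (𝓝 L)) (hw : Summable fun i => |w i|)
    (hk : ∀ i, w i ≠ 0 → 0 < k i) :
    Tendsto (fun t => ∑' i, w i * V (k i * t)) (𝓝[>] 0) (𝓝 (L * ∑' i, w i)) := by
  rw [← tsum_mul_left]
  refine tendsto_tsum_of_dominated_convergence (bound := fun i => |w i| * C) (hw.mul_right C)
    (fun i => ?_) ?_
  · by_cases hi : w i = 0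
    · simp [hi]
    · rw [mul_comm]
      refine Tendsto.const_mul _ (hV.comp ?_)
      refine tendsto_nhdsWithin_iff.2 ⟨?_, ?_⟩
      · have := tendsto_id_nhdsGT_zero.const_mul (k i)
        rwa [mul_zero] at this
      · filter_upwards [self_mem_nhdsWithin] with t ht
        exact mul_pos (hk i hi) ht
  · filter_upwards [self_mem_nhdsWithin] with t ht i
    rw [Real.norm_eq_abs, abs_mul]
    by_cases hi : w i = 0
    · simp [hi]
    · gcongr
      exact hC _ (mul_pos (hk i hi) ht)

theorem abs_tsum_dilates_le {ι : Type} {V : ℝ → ℝ} {w k : ι → ℝ} {C : ℝ}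
    (hC : ∀ s, 0 < s → |V s| ≤ C) (hw : Summable fun i => |w i|)
    (hk : ∀ i, w i ≠ 0 → 0 < k i) {t : ℝ} (ht : 0 < t) :
    |∑' i, w i * V (k i * t)| ≤ (∑' i, |w i|) * C := by
  rw [← tsum_mul_right]
  have hle : ∀ i, ‖w i * V (k i * t)‖ ≤ |w i| * C := by
    intro i
    rw [Real.norm_eq_abs, abs_mul]
    by_cases hi : w i = 0
    · simp [hi]
    · gcongr
      exact hC _ (mul_pos (hk i hi) ht)
  rw [← Real.norm_eq_abs]
  exact tsum_of_norm_bounded (hw.mul_right C).hasSum hle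

/-! ### Totient sums by Möbius inversion -/

/-- The sum of `φ m * m ^ r * exp (- m s)`. -/
noncomputable def totExp (r : ℕ) (s : ℝ) : ℝ :=
  ∑' m : ℕ, (Nat.totient m : ℝ) * m ^ r * Real.exp (-(m * s))

theorem summable_totExp (r : ℕ) {s : ℝ} (hs : 0 < s) :
    Summable fun m : ℕ => (Nat.totient m : ℝ) * m ^ r * Real.exp (-(m * s)) := by
  refine Summable.of_nonneg_of_le (fun m => by positivity) (fun m => ?_) (summable_powExp (r + 1) hs)
  gcongr
  rw [pow_succ']
  gcongr
  exact Nat.totient_le m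

theorem totExp_nonneg (r : ℕ) (s : ℝ) : 0 ≤ totExp r s := tsum_nonneg fun n => by positivity

theorem totExp_le (r : ℕ) {s : ℝ} (hs : 0 < s) :
    s ^ (r + 2) * totExp r s ≤ Nat.factorial (r + 1) * 2 ^ (r + 2) := by
  refine le_trans ?_ (powExp_le (r := r + 1) (by omega) hs)
  gcongr
  refine (summable_totExp r hs).tsum_le_tsum (fun m => ?_) (summable_powExp (r + 1) hs)
  gcongr
  rw [pow_succ']
  gcongr
  exact Nat.totient_le m

theorem sum_moebius_mul {n : ℕ} (hn : 0 < n) :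
    ∑ x ∈ n.divisorsAntidiagonal, (ArithmeticFunction.moebius x.1 : ℝ) * (x.2 : ℝ) =
      Nat.totient n := by
  refine (ArithmeticFunction.sum_eq_iff_sum_mul_moebius_eq (f := fun n => (Nat.totient n : ℝ))
    (g := fun n => (n : ℝ))).1 (fun m _ => ?_) n hn
  exact_mod_cast Nat.sum_totient m

/-- The weights of the Dirichlet series of the Möbius function at `2`. -/
noncomputable def moebiusWeight (d : ℕ) : ℝ := (ArithmeticFunction.moebius d : ℝ) / d ^ 2

theorem abs_moebius_le (d : ℕ) : |(ArithmeticFunction.moebius d : ℝ)| ≤ 1 := by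
  exact_mod_cast ArithmeticFunction.abs_moebius_le_one

theorem summable_abs_moebiusWeight : Summable fun d => |moebiusWeight d| := by
  refine Summable.of_nonneg_of_le (fun d => abs_nonneg _) (fun d => ?_)
    (Real.summable_one_div_nat_pow.2 one_lt_two)
  rw [moebiusWeight, abs_div, abs_of_nonneg (by positivity : (0 : ℝ) ≤ (d : ℝ) ^ 2)]
  gcongr
  exact abs_moebius_le d

/-- The value is `1 / ζ(2)`, as the Dirichlet series of the Möbius function is the inverse of zeta.
-/
theorem tsum_moebiusWeight : ∑' d, moebiusWeight d = 6 / Real.pi ^ 2 := by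
  have h2 : (1 : ℝ) < (2 : ℂ).re := by norm_num
  have h := ArithmeticFunction.LSeries_zeta_mul_Lseries_moebius h2
  rw [ArithmeticFunction.LSeries_zeta_eq_riemannZeta h2, riemannZeta_two] at h
  have e : LSeries (fun n => (ArithmeticFunction.moebius n : ℂ)) 2 =
      ((∑' d, moebiusWeight d : ℝ) : ℂ) := by
    rw [LSeries, Complex.ofReal_tsum]
    refine tsum_congr fun d => ?_
    rw [LSeries.term_def₀ (by simp), moebiusWeight]
    push_cast
    rw [Complex.cpow_neg, ← div_eq_mul_inv]
    norm_cast
  rw [e] at h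
  have h' : Real.pi ^ 2 / 6 * ∑' d, moebiusWeight d = 1 := by exact_mod_cast h
  have := Real.pi_pos
  field_simp at h' ⊢
  linarith

/-- Write `φ = μ * id` and sum over the factorizations `m = d e`. The double series converges
absolutely: the sum over `e` is `O((d s)^{-(r+2)})`, which leaves `O(d^{-2})`. -/
theorem totExp_eq {r : ℕ} (hr : r ≠ 0) {s : ℝ} (hs : 0 < s) :
    totExp r s = ∑' d : ℕ, (ArithmeticFunction.moebius d : ℝ) * d ^ r * powExp (r + 1) (d * s) := by
  set T : ℕ × ℕ → ℝ := fun p => (ArithmeticFunction.moebius p.1 : ℝ) * p.1 ^ r *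
    ((p.2 : ℝ) ^ (r + 1) * Real.exp (-(p.2 * (p.1 * s)))) with hT
  have hfib : ∀ d : ℕ, d ≠ 0 → Summable fun e : ℕ => (e : ℝ) ^ (r + 1) * Real.exp (-(e * (d * s))) :=
    fun d hd => summable_powExp (r + 1) (mul_pos (by positivity) hs)
  have hsum : Summable T := by
    refine Summable.of_norm ?_
    rw [summable_prod_of_nonneg fun p => norm_nonneg _]
    have hn : ∀ d e : ℕ, ‖T (d, e)‖ = |(ArithmeticFunction.moebius d : ℝ) * d ^ r| *
        ((e : ℝ) ^ (r + 1) * Real.exp (-(e * (d * s)))) := by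
      intro d e
      rw [Real.norm_eq_abs, hT, abs_mul]
      congr 1
      exact abs_of_nonneg (by positivity)
    simp only [hn]
    constructor
    · intro d
      rcases eq_or_ne d 0 with rfl | hd
      · simp [hr]
      · exact (hfib d hd).mul_left _
    · simp only [tsum_mul_left]
      change Summable fun d : ℕ => |(ArithmeticFunction.moebius d : ℝ) * d ^ r| *
        powExp (r + 1) (d * s)
      refine Summable.of_nonneg_of_le (fun d => mul_nonneg (abs_nonneg _) (powExp_nonneg _ _))
        (fun d => ?_) ((Real.summable_one_div_nat_pow.2 one_lt_two).mul_right
          (Nat.factorial (r + 1) * 2 ^ (r + 2) / s ^ (r + 2)))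
      rcases eq_or_ne d 0 with rfl | hd
      · simp [hr]
      · have hd' : (0 : ℝ) < d := by positivity
        have h1 := powExp_le (r := r + 1) (by omega) (mul_pos hd' hs)
        rw [abs_mul, abs_of_nonneg (by positivity : (0 : ℝ) ≤ (d : ℝ) ^ r)]
        calc _ ≤ 1 * (d : ℝ) ^ r * powExp (r + 1) (d * s) := by
              gcongr
              · exact powExp_nonneg _ _
              · exact abs_moebius_le d
          _ = 1 / (d : ℝ) ^ 2 * ((d * s) ^ (r + 2) * powExp (r + 1) (d * s) / s ^ (r + 2)) := by
              field_simp
              ring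
          _ ≤ _ := by gcongr
  have hA : ∑' p, T p = ∑' d : ℕ, (ArithmeticFunction.moebius d : ℝ) * d ^ r *
      powExp (r + 1) (d * s) := by
    rw [hsum.tsum_prod]
    refine tsum_congr fun d => ?_
    rw [powExp, ← tsum_mul_left]
  rw [← hA]
  have hB := hsum.hasSum.tsum_fiberwise fun p : ℕ × ℕ => p.1 * p.2
  rw [← hB.tsum_eq, totExp]
  refine tsum_congr fun n => ?_
  rcases Nat.eq_zero_or_pos n with rfl | hn
  · simp only [Nat.totient_zero, Nat.cast_zero, zero_mul]
    symm
    rw [tsum_congr (g := fun _ => (0 : ℝ)), tsum_zero]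
    rintro ⟨⟨d, e⟩, hde⟩
    have : d * e = 0 := hde
    rcases Nat.mul_eq_zero.1 this with rfl | rfl <;> simp [hT]
  · have hset : (fun p : ℕ × ℕ => p.1 * p.2) ⁻¹' {n} = ↑n.divisorsAntidiagonal := by
      ext p
      simp [Nat.mem_divisorsAntidiagonal, hn.ne']
    rw [hset, Finset.tsum_subtype' n.divisorsAntidiagonal T, ← sum_moebius_mul hn, Finset.sum_mul,
      Finset.sum_mul]
    refine Finset.sum_congr rfl fun p hp => ?_
    have hp' : (n : ℝ) = p.1 * p.2 := by
      rw [← (Nat.mem_divisorsAntidiagonal.1 hp).1]; push_cast; rfl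
    rw [hp', hT]
    have : (p.1 : ℝ) * p.2 * s = p.2 * (p.1 * s) := by ring
    rw [this]
    ring

theorem pow_mul_totExp {r : ℕ} (hr : r ≠ 0) {s : ℝ} (hs : 0 < s) :
    s ^ (r + 2) * totExp r s =
      ∑' d : ℕ, moebiusWeight d * ((d * s) ^ (r + 2) * powExp (r + 1) (d * s)) := by
  rw [totExp_eq hr hs, ← tsum_mul_left]
  refine tsum_congr fun d => ?_
  rcases eq_or_ne d 0 with rfl | hd
  · simp [moebiusWeight]
  · rw [moebiusWeight]
    field_simp
    ring

theorem tendsto_totExp {r : ℕ} (hr : r ≠ 0) {L : ℝ}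
    (hL : Tendsto (fun s : ℝ => s ^ (r + 2) * powExp (r + 1) s) (𝓝[>] 0) (𝓝 L)) :
    Tendsto (fun s : ℝ => s ^ (r + 2) * totExp r s) (𝓝[>] 0) (𝓝 (L * (6 / Real.pi ^ 2))) := by
  rw [← tsum_moebiusWeight]
  have h := tendsto_tsum_dilates (w := moebiusWeight) (k := fun d : ℕ => (d : ℝ))
    (C := Nat.factorial (r + 1) * 2 ^ (r + 2))
    (fun s hs => by
      rw [abs_of_nonneg (mul_nonneg (by positivity) (powExp_nonneg _ _))]
      exact powExp_le (by omega) hs) hL summable_abs_moebiusWeight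
    (fun d hd => by
      rcases eq_or_ne d 0 with rfl | h
      · simp [moebiusWeight] at hd
      · positivity)
  refine h.congr' ?_
  filter_upwards [self_mem_nhdsWithin] with s hs
  rw [pow_mul_totExp hr hs]

/-! ### Cumulants of the size -/

/-- The weights of the expansion of the logarithm of the generating function. -/
noncomputable def coef (p : ℕ × ℕ) : ℝ := (Nat.totient p.2 : ℝ) / (p.1 + 1)

/-- The exponents of the expansion of the logarithm of the generating function. -/
def expo (p : ℕ × ℕ) : ℕ := (p.1 + 1) * p.2

/-- The cumulant of order `r` of the size of a Boltzmann distributed path. -/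
noncomputable def moment (r : ℕ) (t : ℝ) : ℝ :=
  ∑' p, coef p * (expo p : ℝ) ^ r * Real.exp (-(expo p * t))

theorem coef_nonneg (p : ℕ × ℕ) : 0 ≤ coef p := by unfold coef; positivity

theorem moment_term_nonneg (r : ℕ) (t : ℝ) (p : ℕ × ℕ) :
    0 ≤ coef p * (expo p : ℝ) ^ r * Real.exp (-(expo p * t)) :=
  mul_nonneg (mul_nonneg (coef_nonneg p) (by positivity)) (Real.exp_pos _).le

theorem moment_term_eq (r : ℕ) (t : ℝ) (i m : ℕ) :
    coef (i, m) * (expo (i, m) : ℝ) ^ (r + 1) * Real.exp (-(expo (i, m) * t)) =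
      ((i : ℝ) + 1) ^ r * ((Nat.totient m : ℝ) * m ^ (r + 1) *
        Real.exp (-(m * ((i + 1 : ℝ) * t)))) := by
  have h : ((expo (i, m) : ℕ) : ℝ) = (i + 1) * m := by simp [expo]
  rw [h, coef]
  have h2 : ((i : ℝ) + 1) * m * t = m * ((i + 1) * t) := by ring
  rw [h2]
  field_simp
  simp only [mul_pow]; ring

/-- With `j = i + 1`, the inner sum is `j ^ r * totExp (r + 1) (j t) = O(j^{-3})`, which is also the
origin of `ζ(3)`. -/
theorem summable_moment_succ (r : ℕ) {t : ℝ} (ht : 0 < t) :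
    Summable fun p => coef p * (expo p : ℝ) ^ (r + 1) * Real.exp (-(expo p * t)) := by
  rw [summable_prod_of_nonneg (moment_term_nonneg (r + 1) t)]
  simp only [moment_term_eq]
  constructor
  · intro i
    exact (summable_totExp (r + 1) (by positivity : 0 < ((i : ℝ) + 1) * t)).mul_left _
  · simp only [tsum_mul_left]
    change Summable fun i : ℕ => ((i : ℝ) + 1) ^ r * totExp (r + 1) ((i + 1) * t)
    have hs : Summable fun i : ℕ => 1 / ((i + 1 : ℕ) : ℝ) ^ 3 :=
      (summable_nat_add_iff 1).2 (Real.summable_one_div_nat_pow.2 (by norm_num : 1 < 3))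
    refine Summable.of_nonneg_of_le (fun i => mul_nonneg (by positivity) (totExp_nonneg _ _))
      (fun i => ?_) (hs.mul_right (Nat.factorial (r + 2) * 2 ^ (r + 3) / t ^ (r + 3)))
    have h := totExp_le (r + 1) (by positivity : 0 < ((i : ℝ) + 1) * t)
    calc _ = 1 / ((i : ℝ) + 1) ^ 3 *
          (((i + 1) * t) ^ (r + 3) * totExp (r + 1) ((i + 1) * t) / t ^ (r + 3)) := by field_simp; simp only [mul_pow]; ring
      _ ≤ _ := by push_cast; gcongr

theorem summable_moment (r : ℕ) {t : ℝ} (ht : 0 < t) :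
    Summable fun p => coef p * (expo p : ℝ) ^ r * Real.exp (-(expo p * t)) := by
  refine Summable.of_nonneg_of_le (moment_term_nonneg r t) (fun p => ?_) (summable_moment_succ r ht)
  rcases Nat.eq_zero_or_pos (expo p) with h | h
  · have : p.2 = 0 := by simpa [expo] using h
    simp [coef, this]
  · have h1 : (1 : ℝ) ≤ expo p := by exact_mod_cast h
    have := coef_nonneg p
    gcongr
    omega

theorem moment_nonneg (r : ℕ) (t : ℝ) : 0 ≤ moment r t := tsum_nonneg (moment_term_nonneg r t)

/-- The weights `1 / (i + 1) ^ 3`. -/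
noncomputable def cubeWeight (i : ℕ) : ℝ := 1 / ((i : ℝ) + 1) ^ 3

theorem summable_cubeWeight : Summable cubeWeight := by
  have hs : Summable fun i : ℕ => 1 / ((i + 1 : ℕ) : ℝ) ^ 3 :=
    (summable_nat_add_iff 1).2 (Real.summable_one_div_nat_pow.2 (by norm_num : 1 < 3))
  refine hs.congr fun i => ?_
  rw [cubeWeight]; push_cast; rfl

theorem cubeWeight_pos (i : ℕ) : 0 < cubeWeight i := by unfold cubeWeight; positivity

theorem summable_abs_cubeWeight : Summable fun i => |cubeWeight i| :=
  summable_cubeWeight.congr fun i => (abs_of_pos (cubeWeight_pos i)).symm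

theorem tsum_cubeWeight : ∑' i, cubeWeight i = (riemannZeta 3).re := by
  have h := zeta_nat_eq_tsum_of_gt_one (k := 3) (by norm_num)
  have hs : Summable fun n : ℕ => 1 / (n : ℝ) ^ 3 := Real.summable_one_div_nat_pow.2 (by norm_num)
  have e : riemannZeta 3 = ((∑' n : ℕ, 1 / (n : ℝ) ^ 3 : ℝ) : ℂ) := by
    rw [Complex.ofReal_tsum]
    push_cast at h ⊢
    exact h
  rw [e, Complex.ofReal_re, hs.tsum_eq_zero_add]
  simp [cubeWeight]

theorem pow_mul_moment (r : ℕ) {t : ℝ} (ht : 0 < t) :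
    t ^ (r + 3) * moment (r + 1) t = ∑' i : ℕ, cubeWeight i *
      ((((i : ℝ) + 1) * t) ^ (r + 3) * totExp (r + 1) ((i + 1) * t)) := by
  rw [moment, (summable_moment_succ r ht).tsum_prod, ← tsum_mul_left]
  refine tsum_congr fun i => ?_
  simp only [moment_term_eq]
  rw [tsum_mul_left, cubeWeight]
  change _ * (_ * totExp (r + 1) ((i + 1) * t)) = _
  field_simp
  simp only [mul_pow]; ring

theorem moment_le (r : ℕ) : ∃ C, 0 < C ∧ ∀ t, 0 < t → t ^ (r + 3) * moment (r + 1) t ≤ C := by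
  refine ⟨(∑' i, |cubeWeight i|) * (Nat.factorial (r + 2) * 2 ^ (r + 3)), ?_, fun t ht => ?_⟩
  · refine mul_pos ?_ (by positivity)
    exact summable_abs_cubeWeight.tsum_pos (fun i => abs_nonneg _) 0
      (abs_pos.2 (cubeWeight_pos 0).ne')
  · rw [pow_mul_moment r ht]
    refine (le_abs_self _).trans (abs_tsum_dilates_le
      (V := fun s => s ^ (r + 3) * totExp (r + 1) s) (k := fun i : ℕ => (i : ℝ) + 1)
      (fun s hs => ?_) summable_abs_cubeWeight (fun i _ => by positivity) ht)
    rw [abs_of_nonneg (mul_nonneg (by positivity) (totExp_nonneg _ _))]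
    exact totExp_le (r + 1) hs

theorem tendsto_moment (r : ℕ) {L : ℝ}
    (hL : Tendsto (fun s : ℝ => s ^ (r + 3) * powExp (r + 2) s) (𝓝[>] 0) (𝓝 L)) :
    Tendsto (fun t : ℝ => t ^ (r + 3) * moment (r + 1) t) (𝓝[>] 0)
      (𝓝 (L * (6 / Real.pi ^ 2) * (riemannZeta 3).re)) := by
  rw [← tsum_cubeWeight]
  have h := tendsto_tsum_dilates (k := fun i : ℕ => (i : ℝ) + 1)
    (C := Nat.factorial (r + 2) * 2 ^ (r + 3)) (fun s hs => by
      rw [abs_of_nonneg (mul_nonneg (by positivity) (totExp_nonneg _ _))]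
      exact totExp_le (r + 1) hs) (tendsto_totExp (r := r + 1) (by omega) hL)
    summable_abs_cubeWeight (fun i _ => by positivity)
  refine h.congr' ?_
  filter_upwards [self_mem_nhdsWithin] with t ht
  rw [pow_mul_moment r ht]

/-- The constant `ζ(3) / ζ(2)`. -/
noncomputable def zetaRatio : ℝ := 6 / Real.pi ^ 2 * (riemannZeta 3).re

theorem zetaRatio_pos : 0 < zetaRatio := by
  have h : 0 < (riemannZeta 3).re := by
    rw [← tsum_cubeWeight]
    exact summable_cubeWeight.tsum_pos (fun i => (cubeWeight_pos i).le) 0 (cubeWeight_pos 0)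
  have := Real.pi_pos
  unfold zetaRatio
  positivity

theorem tendsto_moment_one :
    Tendsto (fun t : ℝ => t ^ 3 * moment 1 t) (𝓝[>] 0) (𝓝 (2 * zetaRatio)) := by
  have := tendsto_moment 0 tendsto_powExp_two
  rwa [mul_assoc] at this

theorem tendsto_moment_two :
    Tendsto (fun t : ℝ => t ^ 4 * moment 2 t) (𝓝[>] 0) (𝓝 (6 * zetaRatio)) := by
  have := tendsto_moment 1 tendsto_powExp_three
  rwa [mul_assoc] at this

/-- Termwise differentiation on `(t / 2, ∞)`, where the derivatives are dominated by their values at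
`t / 2`. -/
theorem hasDerivAt_moment (r : ℕ) {t : ℝ} (ht : 0 < t) :
    HasDerivAt (moment r) (-moment (r + 1) t) t := by
  have h2 : 0 < t / 2 := by linarith
  have ht2 : t ∈ Set.Ioi (t / 2) := by simpa using ht
  have h := hasDerivAt_tsum_of_isPreconnected (summable_moment (r + 1) h2) isOpen_Ioi
    isPreconnected_Ioi (g := fun p s => coef p * (expo p : ℝ) ^ r * Real.exp (-(expo p * s)))
    (g' := fun p s => -(coef p * (expo p : ℝ) ^ (r + 1) * Real.exp (-(expo p * s))))
    (fun p s _ => by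
      have h1 : HasDerivAt (fun s : ℝ => -((expo p : ℝ) * s)) (-(expo p : ℝ)) s := by
        have := ((hasDerivAt_id s).const_mul (expo p : ℝ)).neg
        rwa [mul_one] at this
      convert! h1.exp.const_mul (coef p * (expo p : ℝ) ^ r) using 1
      ring)
    (fun p s hs => by
      have hs' : t / 2 < s := hs
      rw [norm_neg, Real.norm_of_nonneg (moment_term_nonneg _ _ _)]
      have := coef_nonneg p
      gcongr)
    ht2 (summable_moment r ht) ht2
  rwa [tsum_neg] at h

theorem continuousOn_moment (r : ℕ) : ContinuousOn (moment r) (Set.Ioi 0) := fun _ ht =>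
  (hasDerivAt_moment r ht).continuousAt.continuousWithinAt

theorem strictAntiOn_moment (r : ℕ) : StrictAntiOn (moment (r + 1)) (Set.Ioi 0) := by
  intro s hs t ht hst
  have h (p : ℕ × ℕ) : coef p * (expo p : ℝ) ^ (r + 1) * Real.exp (-(expo p * t)) ≤
      coef p * (expo p : ℝ) ^ (r + 1) * Real.exp (-(expo p * s)) := by
    have := coef_nonneg p
    gcongr
  -- The term `j = m = 1`, with coefficient and exponent `1`, decreases strictly.
  refine (summable_moment (r + 1) ht).tsum_lt_tsum h (i := (0, 1)) ?_ (summable_moment (r + 1) hs)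
  simpa [coef, expo] using hst

/-! ### Mean size and existence of the calibrated parameter -/

theorem pow_eq_exp_log {x : ℝ} (h0 : 0 < x) (k : ℕ) : x ^ k = Real.exp (-(k * -Real.log x)) := by
  rw [mul_neg, neg_neg, ← Real.log_pow, Real.exp_log (by positivity)]

theorem tailRate_zero_eq_moment {x : ℝ} (h0 : 0 < x) (h1 : x < 1) :
    tailRate x 0 = moment 0 (-Real.log x) := by
  have ht : 0 < -Real.log x := neg_pos.2 (Real.log_neg h0 h1)
  rw [moment, (summable_moment 0 ht).tsum_prod, tailRate]
  refine tsum_congr fun i => ?_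
  rw [rate, christoffelGF, div_eq_mul_inv, ← tsum_mul_right]
  refine tsum_congr fun m => ?_
  rw [← pow_eq_exp_log h0, ← pow_mul, coef, expo]
  push_cast
  rw [show 0 + 1 + i = i + 1 by ring]
  field_simp
  ring_nf

theorem genFun_eq_exp_moment {x : ℝ} (h0 : 0 < x) (h1 : x < 1) :
    genFun x = Real.exp (moment 0 (-Real.log x)) := by
  rw [genFun_eq_exp h0 h1, tailRate_zero_eq_moment h0 h1]

theorem meanSize_eq_moment {x : ℝ} (h0 : 0 < x) (h1 : x < 1) :
    meanSize x = moment 1 (-Real.log x) := by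
  have ht : 0 < -Real.log x := neg_pos.2 (Real.log_neg h0 h1)
  have hd := ((hasDerivAt_moment 0 ht).comp x (Real.hasDerivAt_log h0.ne').neg).exp
  have he : genFun =ᶠ[𝓝 x] fun y => Real.exp ((moment 0 ∘ fun y => -Real.log y) y) := by
    filter_upwards [Ioo_mem_nhds h0 h1] with y hy
    exact genFun_eq_exp_moment hy.1 hy.2
  rw [meanSize, (hd.congr_of_eventuallyEq he).deriv, he.self_of_nhds]
  have := Real.exp_pos ((moment 0 ∘ fun y => -Real.log y) x)
  field_simp
  simp [mul_comm]

theorem exists_moment_gt (n : ℝ) : ∃ t, 0 < t ∧ n < moment 1 t := by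
  have hK := zetaRatio_pos
  have h1 : Tendsto (fun t : ℝ => (t ^ 3)⁻¹) (𝓝[>] 0) atTop := by
    refine tendsto_inv_nhdsGT_zero.comp (tendsto_nhdsWithin_iff.2 ⟨?_, ?_⟩)
    · simpa using (tendsto_id_nhdsGT_zero.pow 3)
    · filter_upwards [self_mem_nhdsWithin] with t ht
      have ht' : (0 : ℝ) < t := ht
      exact pow_pos ht' 3
  have h2 := tendsto_moment_one.pos_mul_atTop (by positivity) h1
  obtain ⟨t, ht, h0⟩ := ((h2.eventually_gt_atTop n).and self_mem_nhdsWithin).exists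
  have h0' : (0 : ℝ) < t := h0
  refine ⟨t, h0, ?_⟩
  rwa [mul_comm, inv_mul_cancel_left₀ (by positivity)] at ht

theorem exists_moment_lt {n : ℝ} (hn : 0 < n) : ∃ t, 0 < t ∧ moment 1 t < n := by
  obtain ⟨C, hC, h⟩ := moment_le 0
  -- For `t ≥ 1` the bound on `t ^ 3 * moment 1 t` also bounds `t * moment 1 t`, so the mean is at
  -- most `C / t ≤ n / 2`.
  refine ⟨max 1 (2 * C / n), by positivity, ?_⟩
  set t := max 1 (2 * C / n) with ht
  have h1 : 1 ≤ t := le_max_left _ _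
  have h2 : 2 * C / n ≤ t := le_max_right _ _
  have h3 := h t (by linarith)
  have hm := moment_nonneg 1 t
  rw [div_le_iff₀ hn] at h2
  have h4 : t ≤ t ^ (0 + 3) := le_self_pow₀ h1 (by norm_num)
  have h5 : t * moment 1 t ≤ C := (mul_le_mul_of_nonneg_right h4 hm).trans h3
  nlinarith

theorem existsUnique_meanSize {n : ℕ} (hn : 1 ≤ n) :
    ∃! x : ℝ, x ∈ Set.Ioo (0 : ℝ) 1 ∧ meanSize x = n := by
  have hlog {x : ℝ} (hx : x ∈ Set.Ioo (0 : ℝ) 1) : 0 < -Real.log x :=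
    neg_pos.2 (Real.log_neg hx.1 hx.2)
  obtain ⟨a, ha, ha'⟩ := exists_moment_gt n
  obtain ⟨b, hb, hb'⟩ := exists_moment_lt (n := n) (by exact_mod_cast hn)
  obtain ⟨t, ht, htn⟩ := (isPreconnected_Ioi (a := (0 : ℝ))).intermediate_value hb ha
    (continuousOn_moment 1) ⟨hb'.le, ha'.le⟩
  have ht' : (0 : ℝ) < t := ht
  have hx : Real.exp (-t) ∈ Set.Ioo (0 : ℝ) 1 :=
    ⟨Real.exp_pos _, by rw [Real.exp_lt_one_iff]; linarith⟩
  refine ⟨Real.exp (-t), ⟨hx, ?_⟩, fun y ⟨hy, hyn⟩ => ?_⟩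
  · rw [meanSize_eq_moment hx.1 hx.2, Real.log_exp, neg_neg, htn]
  · rw [meanSize_eq_moment hy.1 hy.2, ← htn] at hyn
    have := (strictAntiOn_moment 0).injOn (hlog hy) ht hyn
    rw [← this, neg_neg, Real.exp_log hy.1]

/-! ### Continuation of the exponential formula to the unit disc -/

theorem differentiableOn_tsum_pow {ι : Type} {a : ι → ℝ} {k : ι → ℕ}
    (h : ∀ r : ℝ, 0 < r → r < 1 → Summable fun i => |a i| * r ^ k i) :
    DifferentiableOn ℂ (fun z : ℂ => ∑' i, (a i : ℂ) * z ^ k i) (Metric.ball 0 1) := by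
  intro z hz
  rw [mem_ball_zero_iff] at hz
  obtain ⟨r, hr, hr1⟩ := exists_between hz
  have hr0 : 0 < r := (norm_nonneg z).trans_lt hr
  have hd := Complex.differentiableOn_tsum_of_summable_norm (h r hr0 hr1)
    (F := fun i (z : ℂ) => (a i : ℂ) * z ^ k i) (U := Metric.ball 0 r)
    (fun i => by fun_prop) Metric.isOpen_ball (fun i w hw => by
      rw [mem_ball_zero_iff] at hw
      rw [norm_mul, norm_pow, Complex.norm_real, Real.norm_eq_abs]
      gcongr)
  exact (hd.differentiableAt (Metric.isOpen_ball.mem_nhds (by simpa using hr))).differentiableWithinAt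

theorem summable_coef_mul_pow {r : ℝ} (h0 : 0 < r) (h1 : r < 1) :
    Summable fun p => coef p * r ^ expo p := by
  have ht : 0 < -Real.log r := neg_pos.2 (Real.log_neg h0 h1)
  refine (summable_moment 0 ht).congr fun p => ?_
  rw [← pow_eq_exp_log h0, pow_zero, mul_one]

/-- Identity theorem: both sides are analytic in the disc and agree on `(0, 1)`, which accumulates
at `0`. -/
theorem tsum_pow_size_eq_exp {z : ℂ} (hz : ‖z‖ < 1) :
    ∑' w : {w : List Bool // IsNWConvex w}, z ^ size w.1 =
      Complex.exp (∑' p, (coef p : ℂ) * z ^ expo p) := by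
  have hG := differentiableOn_tsum_pow (a := fun _ => 1)
    (k := fun w : {w : List Bool // IsNWConvex w} => size w.1) (fun r h0 h1 => by
      simpa using summable_pow_size h0 h1)
  have hL := differentiableOn_tsum_pow (a := coef) (k := expo) (fun r h0 h1 =>
    (summable_coef_mul_pow h0 h1).congr fun p => by rw [abs_of_nonneg (coef_nonneg p)])
  have hfreq : ∃ᶠ z : ℂ in 𝓝[≠] 0,
      ∑' w : {w : List Bool // IsNWConvex w}, ((1 : ℝ) : ℂ) * z ^ size w.1 =
        Complex.exp (∑' p, (coef p : ℂ) * z ^ expo p) := by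
    have ht : Tendsto (fun x : ℝ => (x : ℂ)) (𝓝[>] 0) (𝓝[≠] 0) := by
      refine tendsto_nhdsWithin_iff.2 ⟨?_, ?_⟩
      · exact (Complex.continuous_ofReal.tendsto' 0 0 (by simp)).mono_left nhdsWithin_le_nhds
      · filter_upwards [self_mem_nhdsWithin] with x hx
        simpa using (ne_of_gt hx)
    refine ht.frequently (Eventually.frequently ?_)
    filter_upwards [Ioo_mem_nhdsGT (one_pos : (0 : ℝ) < 1)] with x hx
    have h1 := genFun_eq_exp_moment hx.1 hx.2
    have h2 : moment 0 (-Real.log x) = ∑' p, coef p * x ^ expo p := by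
      refine tsum_congr fun p => ?_
      rw [← pow_eq_exp_log hx.1, pow_zero, mul_one]
    rw [h2, genFun] at h1
    have h3 := congrArg (fun y : ℝ => (y : ℂ)) h1
    simp only [Complex.ofReal_exp, Complex.ofReal_tsum, Complex.ofReal_mul,
      Complex.ofReal_pow] at h3
    simpa using h3
  have := (hG.analyticOnNhd Metric.isOpen_ball).eqOn_of_preconnected_of_frequently_eq
    (hL.cexp.analyticOnNhd Metric.isOpen_ball) (convex_ball 0 1).isPreconnected
    (Metric.mem_ball_self one_pos) hfreq (mem_ball_zero_iff.2 hz)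
  simpa using this

/-! ### Characteristic function and Fourier inversion -/

theorem integral_exp_int_mul_I (m : ℤ) :
    ∫ θ in (-Real.pi)..Real.pi, Complex.exp (m * θ * Complex.I) =
      if m = 0 then 2 * (Real.pi : ℂ) else 0 := by
  split_ifs with h
  · simp [h]; ring
  · have hc : (m : ℂ) * Complex.I ≠ 0 := by simpa using h
    have := integral_exp_mul_complex (a := -Real.pi) (b := Real.pi) hc
    simp only [show ∀ θ : ℝ, (m : ℂ) * θ * Complex.I = m * Complex.I * θ from fun θ => by ring]
    rw [this, div_eq_zero_iff]
    left
    rw [sub_eq_zero]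
    have hp := Complex.exp_periodic.int_mul m (m * Complex.I * ((-Real.pi : ℝ) : ℂ))
    rw [← hp]
    congr 1
    push_cast
    ring

/-- The logarithm of the characteristic function of the size of a Boltzmann distributed path
with parameter `exp (-t)`. -/
noncomputable def logChar (t θ : ℝ) : ℂ :=
  ∑' p, ((coef p * Real.exp (-(expo p * t)) : ℝ) : ℂ) *
    (Complex.exp ((expo p : ℂ) * θ * Complex.I) - 1)

theorem norm_exp_ofReal_I (k : ℕ) (θ : ℝ) : ‖Complex.exp ((k : ℂ) * θ * Complex.I)‖ = 1 := by
  have := Complex.norm_exp_ofReal_mul_I (k * θ)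
  push_cast at this
  exact this

theorem summable_exp {t : ℝ} (ht : 0 < t) : Summable fun p => coef p * Real.exp (-(expo p * t)) :=
  (summable_moment 0 ht).congr fun p => by rw [pow_zero, mul_one]

theorem continuous_logChar {t : ℝ} (ht : 0 < t) : Continuous (logChar t) := by
  refine continuous_tsum (fun p => by fun_prop) ((summable_exp ht).mul_right 2) fun p θ => ?_
  have := coef_nonneg p
  rw [norm_mul, Complex.norm_real, Real.norm_of_nonneg (by positivity)]
  gcongr
  calc _ ≤ _ := norm_sub_le _ _
    _ = 2 := by rw [norm_exp_ofReal_I, norm_one]; norm_num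

theorem summable_logChar {t : ℝ} (ht : 0 < t) (θ : ℝ) :
    Summable fun p => ((coef p * Real.exp (-(expo p * t)) : ℝ) : ℂ) *
      (Complex.exp ((expo p : ℂ) * θ * Complex.I) - 1) := by
  refine Summable.of_norm_bounded ((summable_exp ht).mul_right 2) fun p => ?_
  have := coef_nonneg p
  rw [norm_mul, Complex.norm_real, Real.norm_of_nonneg (by positivity)]
  gcongr
  calc _ ≤ _ := norm_sub_le _ _
    _ = 2 := by rw [norm_exp_ofReal_I, norm_one]; norm_num

theorem tsum_pow_size_mul_exp {t : ℝ} (ht : 0 < t) (θ : ℝ) :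
    ∑' w : {w : List Bool // IsNWConvex w},
        ((Real.exp (-t) ^ size w.1 : ℝ) : ℂ) * Complex.exp (size w.1 * θ * Complex.I) =
      genFun (Real.exp (-t)) * Complex.exp (logChar t θ) := by
  have h1 : Real.exp (-t) < 1 := by rw [Real.exp_lt_one_iff]; linarith
  have hz : ‖((Real.exp (-t) : ℝ) : ℂ) * Complex.exp (θ * Complex.I)‖ < 1 := by
    rw [norm_mul, Complex.norm_exp_ofReal_mul_I, mul_one, Complex.norm_real,
      Real.norm_of_nonneg (Real.exp_pos _).le]
    exact h1
  have hpow (k : ℕ) : (((Real.exp (-t) : ℝ) : ℂ) * Complex.exp (θ * Complex.I)) ^ k =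
      ((Real.exp (-t) ^ k : ℝ) : ℂ) * Complex.exp (k * θ * Complex.I) := by
    rw [mul_pow, ← Complex.exp_nat_mul, Complex.ofReal_pow, mul_assoc (k : ℂ)]
  have h := tsum_pow_size_eq_exp hz
  simp only [hpow] at h
  rw [h, genFun_eq_exp_moment (Real.exp_pos _) h1, Real.log_exp, neg_neg, Complex.ofReal_exp,
    ← Complex.exp_add]
  congr 1
  rw [moment, Complex.ofReal_tsum, logChar, ← Summable.tsum_add]
  · refine tsum_congr fun p => ?_
    rw [exp_neg_nat_mul]
    push_cast
    ring
  · exact (Complex.summable_ofReal.2 (summable_moment 0 ht))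
  · exact summable_logChar ht θ

/-- Orthogonality of the characters; termwise integration is dominated by the convergent series of
the `x ^ size`. -/
theorem sizeProb_eq_integral {t : ℝ} (ht : 0 < t) (n : ℕ) :
    (sizeProb (Real.exp (-t)) n : ℂ) = (2 * (Real.pi : ℂ))⁻¹ *
      ∫ θ in (-Real.pi)..Real.pi, Complex.exp (logChar t θ - n * θ * Complex.I) := by
  have h0 := Real.exp_pos (-t)
  have h1 : Real.exp (-t) < 1 := by rw [Real.exp_lt_one_iff]; linarith
  have hS := genFun_pos h0 h1
  have hS' : (genFun (Real.exp (-t)) : ℂ) ≠ 0 := by exact_mod_cast hS.ne'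
  have hpi : (Real.pi : ℂ) ≠ 0 := by exact_mod_cast Real.pi_ne_zero
  have key := intervalIntegral.hasSum_integral_of_dominated_convergence
    (μ := MeasureTheory.volume) (a := -Real.pi) (b := Real.pi)
    (F := fun (w : {w : List Bool // IsNWConvex w}) (θ : ℝ) =>
      ((Real.exp (-t) ^ size w.1 : ℝ) : ℂ) *
        Complex.exp (((size w.1 - n : ℤ) : ℂ) * θ * Complex.I))
    (f := fun θ => genFun (Real.exp (-t)) * Complex.exp (logChar t θ - n * θ * Complex.I))
    (fun w _ => Real.exp (-t) ^ size w.1)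
    (fun w => (Continuous.aestronglyMeasurable (by fun_prop)))
    (fun w => MeasureTheory.ae_of_all _ fun θ _ => by
      have := Complex.norm_exp_ofReal_mul_I ((size w.1 - n : ℤ) * θ)
      push_cast at this
      rw [norm_mul, Complex.norm_real, Real.norm_of_nonneg (by positivity)]
      push_cast
      rw [this, mul_one])
    (MeasureTheory.ae_of_all _ fun θ _ => summable_pow_size h0 h1)
    (by simp)
    (MeasureTheory.ae_of_all _ fun θ _ => by
      have hs : Summable fun w : {w : List Bool // IsNWConvex w} =>
          ((Real.exp (-t) ^ size w.1 : ℝ) : ℂ) * Complex.exp (size w.1 * θ * Complex.I) := by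
        refine Summable.of_norm_bounded (summable_pow_size h0 h1) fun w => ?_
        rw [norm_mul, norm_exp_ofReal_I, mul_one, Complex.norm_real,
          Real.norm_of_nonneg (by positivity)]
      have h := (hs.hasSum.mul_right (Complex.exp (-(n * θ * Complex.I))))
      rw [tsum_pow_size_mul_exp ht, mul_assoc (genFun _ : ℂ), ← Complex.exp_add,
        ← sub_eq_add_neg] at h
      convert! h using 2 with w
      rw [mul_assoc (Complex.ofReal _), ← Complex.exp_add]
      congr 2
      push_cast
      ring)
  have e := key.tsum_eq
  rw [intervalIntegral.integral_const_mul] at e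
  have e2 : (∑' w : {w : List Bool // IsNWConvex w}, ∫ θ in (-Real.pi)..Real.pi,
      ((Real.exp (-t) ^ size w.1 : ℝ) : ℂ) *
        Complex.exp (((size w.1 - n : ℤ) : ℂ) * θ * Complex.I)) =
      2 * Real.pi * (sizeProb (Real.exp (-t)) n * genFun (Real.exp (-t))) := by
    rw [← Complex.ofReal_mul, sizeProb, div_mul_cancel₀ _ hS.ne', Complex.ofReal_tsum,
      ← tsum_mul_left]
    refine tsum_congr fun w => ?_
    rw [intervalIntegral.integral_const_mul, integral_exp_int_mul_I]
    by_cases hw : size w.1 = n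
    · simp [hw, mul_comm]
    · have : ¬ ((size w.1 : ℤ) - n = 0) := by omega
      simp [hw, this]
  rw [e2] at e
  have e3 : (2 * (Real.pi : ℂ)) * sizeProb (Real.exp (-t)) n =
      ∫ θ in (-Real.pi)..Real.pi, Complex.exp (logChar t θ - n * θ * Complex.I) := by
    refine mul_left_cancel₀ hS' ?_
    rw [← e]
    ring
  rw [← e3]
  field_simp

/-! ### Bounds for the characteristic function -/

theorem norm_exp_I_sub_le (v : ℝ) :
    ‖Complex.exp (v * Complex.I) - 1 - (v * Complex.I - v ^ 2 / 2)‖ ≤ 4 * |v| ^ 3 := by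
  have hv : ‖(v : ℂ) * Complex.I‖ = |v| := by simp
  have hsq : ((v : ℂ) * Complex.I) ^ 2 = -(v : ℂ) ^ 2 := by rw [mul_pow, Complex.I_sq]; ring
  rcases le_or_gt |v| 1 with h | h
  · have := Complex.exp_bound (x := v * Complex.I) (by rwa [hv]) (n := 3) (by norm_num)
    rw [hv] at this
    simp only [Finset.sum_range_succ, Finset.sum_range_zero, hsq] at this
    norm_num [Nat.factorial] at this
    have h3 : 0 ≤ |v| ^ 3 := by positivity
    calc _ = _ := by congr 1; ring
      _ ≤ _ := this
      _ ≤ _ := by linarith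
  · have h1 : |v| ≤ |v| ^ 3 := le_self_pow₀ h.le (by norm_num)
    have h2 : |v| ^ 2 ≤ |v| ^ 3 := pow_le_pow_right₀ h.le (by norm_num)
    calc _ ≤ ‖Complex.exp (v * Complex.I)‖ + ‖(1 : ℂ)‖ +
          (‖(v : ℂ) * Complex.I‖ + ‖(v : ℂ) ^ 2 / 2‖) :=
        (norm_sub_le _ _).trans (add_le_add (norm_sub_le _ _) (norm_sub_le _ _))
      _ = 1 + 1 + (|v| + |v| ^ 2 / 2) := by
        rw [Complex.norm_exp_ofReal_mul_I, norm_one, hv]; simp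
      _ ≤ _ := by linarith

theorem norm_logChar_sub_le {t : ℝ} (ht : 0 < t) (θ : ℝ) :
    ‖logChar t θ - (θ * moment 1 t * Complex.I - θ ^ 2 * moment 2 t / 2)‖ ≤
      4 * |θ| ^ 3 * moment 3 t := by
  have hs (r : ℕ) := Complex.summable_ofReal.2 (summable_moment r ht)
  have h1 := ((hs 1).hasSum.mul_left ((θ : ℂ) * Complex.I)).sub
    ((hs 2).hasSum.mul_left ((θ : ℂ) ^ 2 / 2))
  have h2 := (summable_logChar ht θ).hasSum.sub h1
  rw [← Complex.ofReal_tsum, ← Complex.ofReal_tsum] at h2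
  change HasSum _ (logChar t θ - ((θ : ℂ) * Complex.I * moment 1 t - (θ : ℂ) ^ 2 / 2 * moment 2 t))
    at h2
  have h3 : (θ : ℂ) * moment 1 t * Complex.I - (θ : ℂ) ^ 2 * moment 2 t / 2 =
      (θ : ℂ) * Complex.I * moment 1 t - (θ : ℂ) ^ 2 / 2 * moment 2 t := by ring
  rw [h3, ← h2.tsum_eq, moment, ← tsum_mul_left]
  refine tsum_of_norm_bounded ((summable_moment 3 ht).mul_left _).hasSum fun p => ?_
  have hp := norm_exp_I_sub_le (expo p * θ)
  have hc := coef_nonneg p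
  have he := Real.exp_pos (-(expo p * t))
  calc _ = ‖((coef p * Real.exp (-(expo p * t)) : ℝ) : ℂ) *
          (Complex.exp (((expo p * θ : ℝ) : ℂ) * Complex.I) - 1 -
            (((expo p * θ : ℝ) : ℂ) * Complex.I - ((expo p * θ : ℝ) : ℂ) ^ 2 / 2))‖ := by
        congr 1; push_cast; ring
    _ ≤ coef p * Real.exp (-(expo p * t)) * (4 * |expo p * θ| ^ 3) := by
        rw [norm_mul, Complex.norm_real, Real.norm_of_nonneg (by positivity)]
        gcongr
    _ = _ := by rw [abs_mul, Nat.abs_cast]; ring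

theorem re_logChar {t : ℝ} (ht : 0 < t) (θ : ℝ) :
    HasSum (fun p => coef p * Real.exp (-(expo p * t)) * (1 - Real.cos (expo p * θ)))
      (-(logChar t θ).re) := by
  have h := (Complex.hasSum_re (summable_logChar ht θ).hasSum).neg
  refine h.congr_fun fun p => ?_
  rw [Complex.re_ofReal_mul, Complex.sub_re, Complex.one_re]
  have := Complex.exp_ofReal_mul_I_re (expo p * θ)
  push_cast at this
  rw [this]
  ring

/-- All terms of `-Re logChar` are nonnegative. Only those with `j = 1` are kept, and `φ(m) ≥ 1`
reduces them to `∑ x^m (1 - cos mθ)`, a difference of geometric series. -/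
theorem re_logChar_le_geom {t : ℝ} (ht : 0 < t) (θ : ℝ) :
    (logChar t θ).re ≤ ‖1 - (Real.exp (-t) : ℂ) * Complex.exp (θ * Complex.I)‖⁻¹ -
      (1 - Real.exp (-t))⁻¹ := by
  have h0 := Real.exp_pos (-t)
  have h1 : Real.exp (-t) < 1 := by rw [Real.exp_lt_one_iff]; linarith
  set z : ℂ := (Real.exp (-t) : ℂ) * Complex.exp (θ * Complex.I) with hz
  have hzn : ‖z‖ < 1 := by
    rw [hz, norm_mul, Complex.norm_exp_ofReal_mul_I, mul_one, Complex.norm_real,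
      Real.norm_of_nonneg h0.le]
    exact h1
  have hg := (hasSum_geometric_of_lt_one h0.le h1).sub
    (Complex.hasSum_re (hasSum_geometric_of_norm_lt_one hzn))
  have hle := hasSum_le_inj (fun m : ℕ => ((0, m) : ℕ × ℕ)) (fun a b h => by simpa using h)
    (fun p _ => mul_nonneg (mul_nonneg (coef_nonneg p) (Real.exp_pos _).le)
      (sub_nonneg.2 (Real.cos_le_one _))) (fun m => ?_) hg (re_logChar ht θ)
  · have := Complex.re_le_norm (1 - z)⁻¹
    rw [norm_inv] at this
    linarith
  · have hpow : z ^ m = ((Real.exp (-t) ^ m : ℝ) : ℂ) * Complex.exp ((m * θ : ℝ) * Complex.I) := by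
      rw [hz, mul_pow, ← Complex.exp_nat_mul]
      push_cast
      ring_nf
    rw [hpow, Complex.re_ofReal_mul, Complex.exp_ofReal_mul_I_re]
    simp only [coef, expo, zero_add, one_mul, Nat.cast_zero, div_one]
    rw [exp_neg_nat_mul]
    rcases Nat.eq_zero_or_pos m with rfl | hm
    · simp
    · have h2 : (1 : ℝ) ≤ Nat.totient m := by exact_mod_cast Nat.totient_pos.2 hm
      have h3 := Real.cos_le_one (m * θ)
      have h4 : 0 ≤ Real.exp (-t) ^ m * (1 - Real.cos (m * θ)) :=
        mul_nonneg (by positivity) (by linarith)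
      nlinarith

theorem sq_norm_one_sub_mul_exp (x θ : ℝ) :
    ‖1 - (x : ℂ) * Complex.exp (θ * Complex.I)‖ ^ 2 =
      (1 - x) ^ 2 + 2 * x * (1 - Real.cos θ) := by
  rw [Complex.sq_norm, Complex.normSq_apply]
  have h1 := Complex.exp_ofReal_mul_I_re θ
  have h2 := Complex.exp_ofReal_mul_I_im θ
  simp only [Complex.sub_re, Complex.sub_im, Complex.re_ofReal_mul, Complex.im_ofReal_mul, h1, h2,
    Complex.one_re, Complex.one_im]
  linear_combination x ^ 2 * Real.sin_sq_add_cos_sq θ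

/-- With `x = e^{-t} ≥ 1/4`, `1 - cos θ ≥ 2 θ² / π²` and `|θ| ≥ δ t ≥ δ (1 - x)`, the identity for
`|1 - z|²` gives `|1 - z| ≥ ρ (1 - x)` with `ρ² = 1 + δ² / π²`. The gap between the two geometric
sums is then at least `(1 - 1/ρ) / t`. -/
theorem exists_re_logChar_le_far {δ : ℝ} (hδ : 0 < δ) : ∃ c, 0 < c ∧ ∀ t, 0 < t → t ≤ 1 →
    ∀ θ, δ * t ≤ |θ| → |θ| ≤ Real.pi → (logChar t θ).re ≤ -(c / t) := by
  have hpi := Real.pi_pos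
  set ρ : ℝ := √(1 + δ ^ 2 / Real.pi ^ 2) with hρ
  have hρ1 : 1 < ρ := by
    rw [hρ, Real.lt_sqrt zero_le_one]
    have : 0 < δ ^ 2 / Real.pi ^ 2 := by positivity
    linarith
  have hρ0 : 0 < ρ := by linarith
  refine ⟨1 - ρ⁻¹, by rw [sub_pos]; exact inv_lt_one_of_one_lt₀ hρ1, fun t ht ht1 θ h1 h2 => ?_⟩
  refine (re_logChar_le_geom ht θ).trans ?_
  have hx0 := Real.exp_pos (-t)
  have hx1 : Real.exp (-t) < 1 := by rw [Real.exp_lt_one_iff]; linarith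
  have hxq : 1 / 4 ≤ Real.exp (-t) := by
    have h3 : Real.exp (-1) ≤ Real.exp (-t) := Real.exp_le_exp.2 (by linarith)
    have h4 : (1 : ℝ) / 4 ≤ Real.exp (-1) := by
      rw [Real.exp_neg, one_div]
      exact inv_anti₀ (Real.exp_pos 1) (by linarith [Real.exp_one_lt_d9])
    linarith
  have ha : 1 - Real.exp (-t) ≤ t := by linarith [Real.add_one_le_exp (-t)]
  set a := 1 - Real.exp (-t) with hadef
  have ha0 : 0 < a := by linarith
  have hsq := sq_norm_one_sub_mul_exp (Real.exp (-t)) θ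
  have hcos := Real.cos_le_one_sub_mul_cos_sq h2
  have hN : (ρ * a) ^ 2 ≤ ‖1 - (Real.exp (-t) : ℂ) * Complex.exp (θ * Complex.I)‖ ^ 2 := by
    rw [hsq, mul_pow, hρ, Real.sq_sqrt (by positivity)]
    have e1 : a ^ 2 ≤ t ^ 2 := by gcongr
    have e2 : (δ * t) ^ 2 ≤ θ ^ 2 := by rw [← sq_abs θ]; gcongr
    have e3 : δ ^ 2 / Real.pi ^ 2 * a ^ 2 ≤ δ ^ 2 / Real.pi ^ 2 * t ^ 2 := by gcongr
    have e4 : δ ^ 2 / Real.pi ^ 2 * t ^ 2 = (δ * t) ^ 2 / Real.pi ^ 2 := by ring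
    have e5 : (δ * t) ^ 2 / Real.pi ^ 2 ≤ θ ^ 2 / Real.pi ^ 2 := by gcongr
    have e6 : 2 / Real.pi ^ 2 * θ ^ 2 = 2 * (θ ^ 2 / Real.pi ^ 2) := by ring
    have e7 : 0 ≤ θ ^ 2 / Real.pi ^ 2 := by positivity
    have e8 : 2 * (θ ^ 2 / Real.pi ^ 2) ≤ 1 - Real.cos θ := by linarith
    have e9 : 2 * (1 / 4) * (2 * (θ ^ 2 / Real.pi ^ 2)) ≤
        2 * Real.exp (-t) * (1 - Real.cos θ) := by gcongr
    nlinarith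
  have hN' := le_of_sq_le_sq hN (norm_nonneg _)
  have hinv := inv_anti₀ (by positivity) hN'
  have h5 : (1 - ρ⁻¹) / t ≤ (1 - ρ⁻¹) / a := by
    have : 0 ≤ 1 - ρ⁻¹ := sub_nonneg.2 (inv_le_one_of_one_le₀ hρ1.le)
    gcongr
  rw [mul_inv] at hinv
  have h6 : (1 - ρ⁻¹) / a = a⁻¹ - ρ⁻¹ * a⁻¹ := by ring
  linarith

theorem exists_re_logChar_le_near : ∃ δ c t₀, 0 < δ ∧ 0 < c ∧ 0 < t₀ ∧ ∀ t, 0 < t → t ≤ t₀ →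
    ∀ θ, |θ| ≤ δ * t → (logChar t θ).re ≤ -(c * (θ / t ^ 2) ^ 2) := by
  obtain ⟨C, hC, hM3⟩ := moment_le 2
  have hz := zetaRatio_pos
  have hev := tendsto_moment_two.eventually_const_lt (u := 4 * zetaRatio) (by linarith)
  obtain ⟨t₀, ht₀, hsub⟩ := mem_nhdsGT_iff_exists_Ioc_subset.1 hev
  -- This `δ` makes the cubic remainder at most `zetaRatio * θ² / t⁴`, half of the lower bound `2 *
  -- zetaRatio * θ² / t⁴` for the quadratic term.
  refine ⟨zetaRatio / (4 * C), zetaRatio, t₀, by positivity, hz, ht₀, fun t ht htt θ hθ => ?_⟩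
  have h2 : 4 * zetaRatio < t ^ 4 * moment 2 t := hsub ⟨ht, htt⟩
  have h3 : t ^ 5 * moment 3 t ≤ C := hM3 t ht
  have hT := (Complex.abs_re_le_norm _).trans (norm_logChar_sub_le ht θ)
  have hre : (logChar t θ - (θ * moment 1 t * Complex.I - θ ^ 2 * moment 2 t / 2)).re =
      (logChar t θ).re + θ ^ 2 * moment 2 t / 2 := by
    have e : (θ * moment 1 t * Complex.I - θ ^ 2 * moment 2 t / 2 : ℂ) =
        ((-(θ ^ 2 * moment 2 t / 2) : ℝ) : ℂ) + ((θ * moment 1 t : ℝ) : ℂ) * Complex.I := by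
      push_cast; ring
    rw [e, Complex.sub_re, Complex.add_re, Complex.ofReal_re, Complex.re_ofReal_mul, Complex.I_re]
    ring
  rw [hre] at hT
  have h4 := (abs_le.1 hT).2
  have h5 : 4 * |θ| ^ 3 * moment 3 t ≤ θ ^ 2 * (zetaRatio / t ^ 4) := by
    have e1 : moment 3 t ≤ C / t ^ 5 := by rw [le_div_iff₀ (by positivity)]; linarith
    calc 4 * |θ| ^ 3 * moment 3 t ≤ 4 * (|θ| ^ 2 * (zetaRatio / (4 * C) * t)) * (C / t ^ 5) := by
          rw [pow_succ |θ| 2]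
          have := moment_nonneg 3 t
          gcongr
      _ = |θ| ^ 2 * (zetaRatio / t ^ 4) := by field_simp
      _ = _ := by rw [sq_abs]
  have h6 : θ ^ 2 * (4 * zetaRatio / t ^ 4) ≤ θ ^ 2 * moment 2 t := by
    have : 4 * zetaRatio / t ^ 4 ≤ moment 2 t := by
      rw [div_le_iff₀ (by positivity)]; linarith
    gcongr
  have h7 : θ ^ 2 * (4 * zetaRatio / t ^ 4) = 4 * (θ ^ 2 * (zetaRatio / t ^ 4)) := by ring
  have h8 : zetaRatio * (θ / t ^ 2) ^ 2 = θ ^ 2 * (zetaRatio / t ^ 4) := by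
    field_simp
  rw [h8]
  linarith

/-- An integrable majorant independent of `t`. In the far range `e^{-d/t} ≤ 24 t⁴ / d⁴`, and `|u| t²
≤ π` gives `t⁴ (1 + u²) ≤ 1 + π²`. -/
theorem exists_exp_re_logChar_le : ∃ c C t₀, 0 < c ∧ 0 < C ∧ 0 < t₀ ∧ ∀ t, 0 < t → t ≤ t₀ →
    ∀ u, |u * t ^ 2| ≤ Real.pi →
      Real.exp (logChar t (u * t ^ 2)).re ≤ Real.exp (-c * u ^ 2) + C * (1 + u ^ 2)⁻¹ := by
  obtain ⟨δ, c, t₀, hδ, hc, ht₀, hnear⟩ := exists_re_logChar_le_near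
  obtain ⟨d, hd, hfar⟩ := exists_re_logChar_le_far hδ
  have hpi := Real.pi_pos
  refine ⟨c, 24 * (1 + Real.pi ^ 2) / d ^ 4, min t₀ 1, hc, by positivity, by positivity,
    fun t ht htt u hu => ?_⟩
  have htt0 : t ≤ t₀ := htt.trans (min_le_left _ _)
  have htt1 : t ≤ 1 := htt.trans (min_le_right _ _)
  have hb : 0 ≤ 24 * (1 + Real.pi ^ 2) / d ^ 4 * (1 + u ^ 2)⁻¹ := by positivity
  rcases le_or_gt |u * t ^ 2| (δ * t) with h | h
  · have h1 := hnear t ht htt0 _ h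
    rw [mul_div_cancel_right₀ _ (by positivity)] at h1
    have h2 := Real.exp_le_exp.2 h1
    rw [← neg_mul] at h2
    linarith
  · have h1 := Real.exp_le_exp.2 (hfar t ht htt1 _ h.le hu)
    have h2 : (d / t) ^ 4 / 24 ≤ Real.exp (d / t) := by
      have := Real.pow_div_factorial_le_exp (d / t) (by positivity) 4
      norm_num [Nat.factorial] at this
      exact this
    have h3 : Real.exp (-(d / t)) ≤ 24 * t ^ 4 / d ^ 4 := by
      rw [Real.exp_neg]
      calc _ ≤ ((d / t) ^ 4 / 24)⁻¹ := inv_anti₀ (by positivity) h2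
        _ = _ := by field_simp
    have h4 : u ^ 2 * t ^ 4 ≤ Real.pi ^ 2 := by
      have := pow_le_pow_left₀ (abs_nonneg _) hu 2
      rw [sq_abs] at this
      linarith
    have h5 : t ^ 4 ≤ 1 := pow_le_one₀ ht.le htt1
    have h6 : 24 * t ^ 4 / d ^ 4 ≤ 24 * (1 + Real.pi ^ 2) / d ^ 4 * (1 + u ^ 2)⁻¹ := by
      rw [← div_eq_mul_inv, le_div_iff₀ (by positivity), div_mul_eq_mul_div]
      exact div_le_div_of_nonneg_right (by linarith) (by positivity)
    linarith [Real.exp_pos (-c * u ^ 2)]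

/-! ### Local limit theorem -/

/-- The integrand of the local limit theorem, in the scale of the standard deviation. -/
noncomputable def scaledChar (n : ℕ) (t u : ℝ) : ℂ :=
  Complex.exp (logChar t (u * t ^ 2) - n * (u * t ^ 2 : ℝ) * Complex.I)

theorem norm_scaledChar (n : ℕ) (t u : ℝ) :
    ‖scaledChar n t u‖ = Real.exp (logChar t (u * t ^ 2)).re := by
  rw [scaledChar, Complex.norm_exp, Complex.sub_re, ← Complex.ofReal_natCast,
    ← Complex.ofReal_mul, Complex.re_ofReal_mul, Complex.I_re, mul_zero, sub_zero]

theorem continuous_scaledChar (n : ℕ) {t : ℝ} (ht : 0 < t) : Continuous (scaledChar n t) := by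
  have := continuous_logChar ht
  unfold scaledChar
  fun_prop

theorem sizeProb_div_eq_integral (n : ℕ) {t : ℝ} (ht : 0 < t) :
    ((sizeProb (Real.exp (-t)) n / t ^ 2 : ℝ) : ℂ) = (2 * (Real.pi : ℂ))⁻¹ *
      ∫ u, (Set.Ioc (-(Real.pi / t ^ 2)) (Real.pi / t ^ 2)).indicator (scaledChar n t) u := by
  have hpi := Real.pi_pos
  have ht2 : t ^ 2 ≠ 0 := by positivity
  have h := intervalIntegral.integral_comp_mul_right
    (fun θ => Complex.exp (logChar t θ - n * θ * Complex.I)) ht2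
    (a := -(Real.pi / t ^ 2)) (b := Real.pi / t ^ 2)
  rw [neg_mul, div_mul_cancel₀ _ ht2] at h
  rw [MeasureTheory.integral_indicator measurableSet_Ioc,
    ← intervalIntegral.integral_of_le (by
      have : 0 < Real.pi / t ^ 2 := by positivity
      linarith)]
  change _ = _ * ∫ u in _.._, Complex.exp (logChar t (u * t ^ 2) - n * (u * t ^ 2 : ℝ) * Complex.I)
  rw [h, Complex.ofReal_div, sizeProb_eq_integral ht, Complex.real_smul]
  push_cast
  ring

/-- At `θ = u t²` the linear term is `u t² (mean - n)`, which vanishes by calibration; the quadratic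
one tends to `-3 * zetaRatio * u²`, and the remainder is `O(t)`. -/
theorem tendsto_scaledChar {t : ℕ → ℝ} (hpos : ∀ᶠ n in atTop, 0 < t n)
    (ht : Tendsto t atTop (𝓝 0))
    (hm : Tendsto (fun n => t n ^ 2 * (moment 1 (t n) - n)) atTop (𝓝 0)) (u : ℝ) :
    Tendsto (fun n => scaledChar n (t n) u) atTop
      (𝓝 ((Real.exp (-(3 * zetaRatio) * u ^ 2) : ℝ) : ℂ)) := by
  have htw : Tendsto t atTop (𝓝[>] 0) := tendsto_nhdsWithin_iff.2 ⟨ht, hpos⟩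
  obtain ⟨C, hC, hM3⟩ := moment_le 2
  have hr : Tendsto (fun n => logChar (t n) (u * t n ^ 2) -
      (((u * t n ^ 2 : ℝ) : ℂ) * moment 1 (t n) * Complex.I -
        ((u * t n ^ 2 : ℝ) : ℂ) ^ 2 * moment 2 (t n) / 2)) atTop (𝓝 0) := by
    refine squeeze_zero_norm' (a := fun n => 4 * |u| ^ 3 * C * t n) ?_ ?_
    · filter_upwards [hpos] with n hn
      refine (norm_logChar_sub_le hn _).trans ?_
      have h3 : t n ^ 5 * moment 3 (t n) ≤ C := hM3 _ hn
      calc _ = 4 * |u| ^ 3 * t n * (t n ^ 5 * moment 3 (t n)) := by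
            rw [abs_mul, abs_of_nonneg (by positivity : 0 ≤ t n ^ 2)]; ring
        _ ≤ 4 * |u| ^ 3 * t n * C := by gcongr
        _ = _ := by ring
    · simpa using ht.const_mul (4 * |u| ^ 3 * C)
  have h1 : Tendsto (fun n => ((u * (t n ^ 2 * (moment 1 (t n) - n)) : ℝ) : ℂ) * Complex.I)
      atTop (𝓝 0) := by
    have := (Complex.continuous_ofReal.tendsto _).comp (hm.const_mul u)
    simpa using this.mul_const Complex.I
  have h2 : Tendsto (fun n => ((u ^ 2 / 2 * (t n ^ 4 * moment 2 (t n)) : ℝ) : ℂ)) atTop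
      (𝓝 ((u ^ 2 / 2 * (6 * zetaRatio) : ℝ) : ℂ)) :=
    (Complex.continuous_ofReal.tendsto _).comp ((tendsto_moment_two.comp htw).const_mul _)
  have h := ((hr.add h1).sub h2).cexp
  have e : Complex.exp (0 + 0 - ((u ^ 2 / 2 * (6 * zetaRatio) : ℝ) : ℂ)) =
      ((Real.exp (-(3 * zetaRatio) * u ^ 2) : ℝ) : ℂ) := by
    rw [Complex.ofReal_exp]
    congr 1
    push_cast
    ring
  rw [e] at h
  refine h.congr fun n => ?_
  rw [scaledChar]
  congr 1
  push_cast
  ring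

theorem tendsto_sizeProb {t : ℕ → ℝ} (hpos : ∀ᶠ n in atTop, 0 < t n)
    (ht : Tendsto t atTop (𝓝 0))
    (hm : Tendsto (fun n => t n ^ 2 * (moment 1 (t n) - n)) atTop (𝓝 0)) :
    Tendsto (fun n => sizeProb (Real.exp (-t n)) n / t n ^ 2) atTop
      (𝓝 ((2 * Real.pi)⁻¹ * √(Real.pi / (3 * zetaRatio)))) := by
  have hpi := Real.pi_pos
  obtain ⟨c, C, t₀, hc, hC, ht₀, hb⟩ := exists_exp_re_logChar_le
  have hle : ∀ᶠ n in atTop, t n ≤ t₀ := ht.eventually_le_const ht₀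
  have key := MeasureTheory.tendsto_integral_filter_of_dominated_convergence
    (μ := MeasureTheory.volume) (l := atTop)
    (F := fun n => (Set.Ioc (-(Real.pi / t n ^ 2)) (Real.pi / t n ^ 2)).indicator
      (scaledChar n (t n)))
    (f := fun u : ℝ => ((Real.exp (-(3 * zetaRatio) * u ^ 2) : ℝ) : ℂ))
    (fun u => Real.exp (-c * u ^ 2) + C * (1 + u ^ 2)⁻¹)
    (by
      filter_upwards [hpos] with n hn
      exact (continuous_scaledChar n hn).aestronglyMeasurable.indicator measurableSet_Ioc)
    (by
      filter_upwards [hpos, hle] with n hn hn'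
      refine MeasureTheory.ae_of_all _ fun u => ?_
      by_cases hu : u ∈ Set.Ioc (-(Real.pi / t n ^ 2)) (Real.pi / t n ^ 2)
      · rw [Set.indicator_of_mem hu, norm_scaledChar]
        refine hb _ hn hn' u ?_
        rw [abs_mul, abs_of_nonneg (by positivity : 0 ≤ t n ^ 2), ← le_div_iff₀ (by positivity)]
        exact abs_le.2 ⟨hu.1.le, hu.2⟩
      · rw [Set.indicator_of_notMem hu, norm_zero]
        positivity)
    ((integrable_exp_neg_mul_sq hc).add (integrable_inv_one_add_sq.const_mul C))
    (MeasureTheory.ae_of_all _ fun u => by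
      have hinf : Tendsto (fun n => Real.pi / t n ^ 2) atTop atTop := by
        refine Tendsto.const_mul_atTop hpi (tendsto_inv_nhdsGT_zero.comp
          (tendsto_nhdsWithin_iff.2 ⟨by simpa using ht.pow 2, ?_⟩))
        filter_upwards [hpos] with n hn
        exact Set.mem_Ioi.2 (by positivity)
      refine (tendsto_scaledChar hpos ht hm u).congr' ?_
      filter_upwards [hinf.eventually_gt_atTop |u|] with n hn
      have := abs_lt.1 hn
      exact (Set.indicator_of_mem (Set.mem_Ioc.2 ⟨this.1, this.2.le⟩) _).symm)
  have h2 := key.const_mul (2 * (Real.pi : ℂ))⁻¹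
  rw [integral_complex_ofReal, integral_gaussian] at h2
  have h3 : Tendsto (fun n => ((sizeProb (Real.exp (-t n)) n / t n ^ 2 : ℝ) : ℂ)) atTop
      (𝓝 (((2 * Real.pi)⁻¹ * √(Real.pi / (3 * zetaRatio)) : ℝ) : ℂ)) := by
    have e : (((2 * Real.pi)⁻¹ * √(Real.pi / (3 * zetaRatio)) : ℝ) : ℂ) =
        (2 * (Real.pi : ℂ))⁻¹ * (√(Real.pi / (3 * zetaRatio)) : ℝ) := by push_cast; ring
    rw [e]
    refine h2.congr' ?_
    filter_upwards [hpos] with n hn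
    rw [sizeProb_div_eq_integral n hn]
  exact (Complex.continuous_re.tendsto _).comp h3

/-! ### The constant `κ` -/

theorem kappa_pow_six : kappa ^ 6 = 18 * Real.pi ^ 5 / (riemannZeta 3).re := by
  have hz := zetaRatio_pos
  have hpi := Real.pi_pos
  have hz3 : 0 < (riemannZeta 3).re := by
    unfold zetaRatio at hz
    exact pos_of_mul_pos_right hz (by positivity)
  have h {a : ℝ} (ha : 0 ≤ a) (r : ℝ) : (a ^ r) ^ 6 = a ^ (r * 6) := by
    rw [← Real.rpow_natCast, ← Real.rpow_mul ha]; norm_num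
  rw [kappa, div_pow, mul_pow, mul_pow, h (by norm_num), h (by norm_num), h hpi.le, h hz3.le]
  have e1 : (2 : ℝ) ^ (1 / 6 * 6 : ℝ) = 2 := by norm_num
  have e2 : (3 : ℝ) ^ (1 / 3 * 6 : ℝ) = 9 := by norm_num
  have e3 : Real.pi ^ (5 / 6 * 6 : ℝ) = Real.pi ^ 5 := by
    rw [← Real.rpow_natCast]; norm_num
  have e4 : (riemannZeta 3).re ^ (1 / 6 * 6 : ℝ) = (riemannZeta 3).re := by norm_num
  rw [e1, e2, e3, e4]
  norm_num

theorem kappa_pos : 0 < kappa := by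
  have hz := zetaRatio_pos
  have hpi := Real.pi_pos
  have hz3 : 0 < (riemannZeta 3).re := by
    unfold zetaRatio at hz
    exact pos_of_mul_pos_right hz (by positivity)
  unfold kappa
  positivity

theorem local_constant_eq_inv_kappa :
    (2 * Real.pi)⁻¹ * √(Real.pi / (3 * zetaRatio)) * (2 * zetaRatio) ^ (2 / 3 : ℝ) = kappa⁻¹ := by
  have hz := zetaRatio_pos
  have hpi := Real.pi_pos
  have hk := kappa_pos
  refine (pow_left_inj₀ (by positivity) (by positivity) (n := 6) (by norm_num)).1 ?_
  have h1 : √(Real.pi / (3 * zetaRatio)) ^ 6 = (Real.pi / (3 * zetaRatio)) ^ 3 := by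
    rw [show 6 = 2 * 3 by norm_num, pow_mul, Real.sq_sqrt (by positivity)]
  have h2 : ((2 * zetaRatio) ^ (2 / 3 : ℝ)) ^ 6 = (2 * zetaRatio) ^ 4 := by
    rw [← Real.rpow_natCast, ← Real.rpow_mul (by positivity), ← Real.rpow_natCast]; norm_num
  rw [mul_pow, mul_pow, h1, h2, inv_pow, inv_pow, kappa_pow_six]
  have hz3 : (riemannZeta 3).re = zetaRatio * Real.pi ^ 2 / 6 := by
    unfold zetaRatio; field_simp
  rw [hz3]
  field_simp
  norm_num

/-- Telescoping bounds from `1/(2m²) - 1/(2(m+1)²) ≤ 1/m³ ≤ 1/((m-1)m(m+1))`, summed from `m = N +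
2`. -/
theorem sum_inv_cube_bounds (N n : ℕ) :
    1 / (2 * ((N : ℝ) + 2) ^ 2) - 1 / (2 * ((N : ℝ) + n + 2) ^ 2) ≤
        ∑ i ∈ Finset.range n, cubeWeight (i + (N + 1)) ∧
      ∑ i ∈ Finset.range n, cubeWeight (i + (N + 1)) ≤
        1 / (2 * ((N : ℝ) + 1) * (N + 2)) - 1 / (2 * ((N : ℝ) + n + 1) * (N + n + 2)) := by
  induction n with
  | zero => simp
  | succ n ih =>
    rw [Finset.sum_range_succ, cubeWeight]
    push_cast
    set m : ℝ := (N : ℝ) + n + 2 with hm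
    have hm2 : 2 ≤ m := by have h1 := N.cast_nonneg (α := ℝ); have := n.cast_nonneg (α := ℝ); linarith
    have e1 : (n : ℝ) + (N + 1) + 1 = m := by rw [hm]; ring
    have e2 : (N : ℝ) + (n + 1) + 2 = m + 1 := by rw [hm]; ring
    have e3 : (N : ℝ) + n + 1 = m - 1 := by rw [hm]; ring
    have e4 : (N : ℝ) + (n + 1) + 1 = m := by rw [hm]; ring
    rw [e3] at ih
    rw [e1, e2, e4]
    have hm1 : 0 < m - 1 := by linarith
    have k1 : 1 / (2 * m ^ 2) - 1 / (2 * (m + 1) ^ 2) ≤ 1 / m ^ 3 := by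
      rw [div_sub_div _ _ (by positivity) (by positivity), div_le_div_iff₀ (by positivity) (by positivity)]
      have : 0 ≤ m ^ 2 * (3 * m + 2) := by positivity
      nlinarith
    have k2 : 1 / m ^ 3 ≤ 1 / (2 * (m - 1) * m) - 1 / (2 * m * (m + 1)) := by
      have e : 1 / (2 * (m - 1) * m) - 1 / (2 * m * (m + 1)) = 1 / ((m - 1) * m * (m + 1)) := by
        field_simp
        ring
      rw [e]
      refine one_div_le_one_div_of_le (by positivity) ?_
      nlinarith
    exact ⟨by linarith [ih.1], by linarith [ih.2]⟩

theorem zeta_three_bounds : 1.2020 < (riemannZeta 3).re ∧ (riemannZeta 3).re < 1.2021 := by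
  rw [← tsum_cubeWeight]
  have hs := summable_cubeWeight
  have h := hs.sum_add_tsum_nat_add 20
  have ht : Tendsto (fun n => ∑ i ∈ Finset.range n, cubeWeight (i + 20)) atTop
      (𝓝 (∑' i, cubeWeight (i + 20))) :=
    ((summable_nat_add_iff 20).2 hs).hasSum.tendsto_sum_nat
  have hup : ∑' i, cubeWeight (i + 20) ≤ 1 / (2 * 20 * 21) := by
    refine le_of_tendsto' ht fun n => ?_
    have := (sum_inv_cube_bounds 19 n).2
    have h2 : 0 ≤ 1 / (2 * (((19 : ℕ) : ℝ) + n + 1) * ((19 : ℕ) + n + 2)) := by positivity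
    norm_num at this h2 ⊢
    linarith
  -- A thousand terms of the tail suffice for the lower bound: `21 = 19 + 2` and `1021 = 19 + 1000 +
  -- 2`.
  have hlo : 1 / (2 * 21 ^ 2) - 1 / (2 * 1021 ^ 2) ≤ ∑' i, cubeWeight (i + 20) := by
    refine le_trans ?_ (((summable_nat_add_iff 20).2 hs).sum_le_tsum (Finset.range 1000)
      fun i _ => (cubeWeight_pos _).le)
    have := (sum_inv_cube_bounds 19 1000).1
    norm_num at this ⊢
    exact this
  have hf : ∑ i ∈ Finset.range 20, cubeWeight i = ∑ i ∈ Finset.range 20, 1 / ((i : ℝ) + 1) ^ 3 := rfl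
  rw [hf] at h
  norm_num [Finset.sum_range_succ] at h hup hlo
  constructor <;> norm_num <;> linarith

theorem abs_kappa_sub_lt : |kappa - 4.0755| < 0.0001 := by
  have h := kappa_pow_six
  obtain ⟨h1, h2⟩ := zeta_three_bounds
  have p1 := Real.pi_gt_d6
  have p2 := Real.pi_lt_d6
  have hz : 0 < (riemannZeta 3).re := by linarith
  rw [eq_div_iff hz.ne'] at h
  have q1 : (3.141592 : ℝ) ^ 5 < Real.pi ^ 5 := by gcongr
  have q2 : Real.pi ^ 5 < (3.141593 : ℝ) ^ 5 := by gcongr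
  have hk := kappa_pos
  rw [abs_lt]
  constructor
  · by_contra! hc
    have h3 : kappa ≤ 4.0754 := by linarith
    have h4 : kappa ^ 6 ≤ 4.0754 ^ 6 := by gcongr
    have h5 : kappa ^ 6 * (riemannZeta 3).re ≤ 4.0754 ^ 6 * 1.2021 := by gcongr
    rw [h] at h5
    norm_num at h5 q1
    linarith
  · by_contra! hc
    have h3 : 4.0756 ≤ kappa := by linarith
    have h4 : 4.0756 ^ 6 ≤ kappa ^ 6 := by gcongr
    have h5 : 4.0756 ^ 6 * 1.2020 ≤ kappa ^ 6 * (riemannZeta 3).re := by gcongr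
    rw [h] at h5
    norm_num at h5 q2
    linarith

/-! ### Asymptotics of the calibrated parameter -/

theorem tendsto_moment_div {t : ℕ → ℝ}
    (hcal : (fun n : ℕ => moment 1 (t n) - n) =o[atTop] fun n : ℕ => (n : ℝ) ^ (2 / 3 : ℝ)) :
    Tendsto (fun n : ℕ => moment 1 (t n) / n) atTop (𝓝 1) := by
  have h1 : (fun n : ℕ => (n : ℝ) ^ (2 / 3 : ℝ)) =O[atTop] fun n : ℕ => (n : ℝ) := by
    refine Asymptotics.IsBigO.of_bound 1 ?_
    filter_upwards [eventually_ge_atTop 1] with n hn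
    have hn' : (1 : ℝ) ≤ n := by exact_mod_cast hn
    rw [Real.norm_of_nonneg (by positivity), Real.norm_of_nonneg (by positivity), one_mul]
    calc (n : ℝ) ^ (2 / 3 : ℝ) ≤ (n : ℝ) ^ (1 : ℝ) :=
          Real.rpow_le_rpow_of_exponent_le hn' (by norm_num)
      _ = n := Real.rpow_one _
  have h2 := ((hcal.trans_isBigO h1).tendsto_div_nhds_zero).const_add 1
  rw [add_zero] at h2
  refine h2.congr' ?_
  filter_upwards [eventually_ge_atTop 1] with n hn
  have hn' : (n : ℝ) ≠ 0 := by positivity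
  field_simp
  ring

/-- The mean size tends to infinity and is strictly decreasing in `t`, so `t` eventually falls below
any fixed `ε`. -/
theorem tendsto_parameter {t : ℕ → ℝ} (hpos : ∀ᶠ n in atTop, 0 < t n)
    (hcal : (fun n : ℕ => moment 1 (t n) - n) =o[atTop] fun n : ℕ => (n : ℝ) ^ (2 / 3 : ℝ)) :
    Tendsto t atTop (𝓝 0) := by
  have hinf : Tendsto (fun n => moment 1 (t n)) atTop atTop := by
    have := (tendsto_moment_div hcal).pos_mul_atTop one_pos tendsto_natCast_atTop_atTop
    refine this.congr' ?_
    filter_upwards [eventually_ge_atTop 1] with n hn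
    exact div_mul_cancel₀ _ (by positivity)
  refine tendsto_order.2 ⟨fun a ha => hpos.mono fun n hn => ha.trans hn, fun ε hε => ?_⟩
  filter_upwards [hpos, hinf.eventually_gt_atTop (moment 1 ε)] with n hn hm
  exact ((strictAntiOn_moment 0).lt_iff_gt hε hn).1 hm

theorem tendsto_nat_mul_cube {t : ℕ → ℝ} (hpos : ∀ᶠ n in atTop, 0 < t n)
    (hcal : (fun n : ℕ => moment 1 (t n) - n) =o[atTop] fun n : ℕ => (n : ℝ) ^ (2 / 3 : ℝ)) :
    Tendsto (fun n : ℕ => n * t n ^ 3) atTop (𝓝 (2 * zetaRatio)) := by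
  have h1 := tendsto_moment_one.comp
    (tendsto_nhdsWithin_iff.2 ⟨tendsto_parameter hpos hcal, hpos⟩)
  have h2 := h1.div (tendsto_moment_div hcal) one_ne_zero
  rw [div_one] at h2
  have h3 : ∀ᶠ n in atTop, 0 < moment 1 (t n) / n :=
    (tendsto_moment_div hcal).eventually_const_lt one_pos
  refine h2.congr' ?_
  filter_upwards [h3, eventually_ge_atTop 1] with n hn hn1
  have hn' : (n : ℝ) ≠ 0 := by positivity
  have hm : moment 1 (t n) ≠ 0 := fun h => by simp [h] at hn
  simp only [Function.comp_apply, Pi.div_apply]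
  field_simp

theorem tendsto_sq_mul_rpow {t : ℕ → ℝ} (hpos : ∀ᶠ n in atTop, 0 < t n)
    (hcal : (fun n : ℕ => moment 1 (t n) - n) =o[atTop] fun n : ℕ => (n : ℝ) ^ (2 / 3 : ℝ)) :
    Tendsto (fun n : ℕ => t n ^ 2 * (n : ℝ) ^ (2 / 3 : ℝ)) atTop
      (𝓝 ((2 * zetaRatio) ^ (2 / 3 : ℝ))) := by
  have hz := zetaRatio_pos
  have h := (tendsto_nat_mul_cube hpos hcal).rpow_const (p := (2 / 3 : ℝ))
    (Or.inl (by positivity))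
  refine h.congr' ?_
  filter_upwards [hpos] with n hn
  rw [Real.mul_rpow (by positivity) (by positivity), ← Real.rpow_natCast, ← Real.rpow_mul hn.le,
    mul_comm]
  norm_num

/-- Since `t²` is of order `n^{-2/3}`, the error `o(n^{2/3})` is exactly what the local limit
theorem tolerates, namely less than the order `t^{-2}` of the standard deviation. -/
theorem tendsto_sizeProb_mul_rpow {t : ℕ → ℝ} (hpos : ∀ᶠ n in atTop, 0 < t n)
    (hcal : (fun n : ℕ => moment 1 (t n) - n) =o[atTop] fun n : ℕ => (n : ℝ) ^ (2 / 3 : ℝ)) :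
    Tendsto (fun n : ℕ => sizeProb (Real.exp (-t n)) n * (n : ℝ) ^ (2 / 3 : ℝ)) atTop
      (𝓝 kappa⁻¹) := by
  have h1 := tendsto_sq_mul_rpow hpos hcal
  have h2 : Tendsto (fun n : ℕ => t n ^ 2 * (moment 1 (t n) - n)) atTop (𝓝 0) := by
    have := h1.mul hcal.tendsto_div_nhds_zero
    rw [mul_zero] at this
    refine this.congr' ?_
    filter_upwards [eventually_ge_atTop 1] with n hn
    have hn' : (0 : ℝ) < (n : ℝ) ^ (2 / 3 : ℝ) := by positivity
    field_simp
  have h3 := (tendsto_sizeProb hpos (tendsto_parameter hpos hcal) h2).mul h1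
  rw [local_constant_eq_inv_kappa] at h3
  refine h3.congr' ?_
  filter_upwards [hpos] with n hn
  field_simp

/-! ### Expected cost in terms of `t` -/

theorem sqSum_exp_le {s : ℝ} (hs : 0 < s) :
    sqSum (Real.exp (-s)) ≤ ENNReal.ofReal (16 / s ^ 3) := by
  have h := powExp_le (r := 2) (by norm_num) hs
  have e : sqSum (Real.exp (-s)) = ENNReal.ofReal (powExp 2 s) := by
    rw [powExp, ENNReal.ofReal_tsum_of_nonneg (fun n => by positivity) (summable_powExp 2 hs)]
    refine tsum_congr fun n => ?_
    rw [ENNReal.ofReal_mul (by positivity), exp_neg_nat_mul, ENNReal.ofReal_pow (by positivity),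
      ENNReal.ofReal_pow (by positivity), ENNReal.ofReal_natCast]
  rw [e]
  refine ENNReal.ofReal_le_ofReal ?_
  rw [le_div_iff₀ (by positivity)]
  norm_num [Nat.factorial] at h
  linarith

theorem linSum_exp_le {s : ℝ} (hs : 0 < s) :
    linSum (Real.exp (-s)) ≤ ENNReal.ofReal (4 / s ^ 2) := by
  have h := powExp_le (r := 1) (by norm_num) hs
  have e : linSum (Real.exp (-s)) = ENNReal.ofReal (powExp 1 s) := by
    rw [powExp, ENNReal.ofReal_tsum_of_nonneg (fun n => by positivity) (summable_powExp 1 hs)]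
    refine tsum_congr fun n => ?_
    rw [ENNReal.ofReal_mul (by positivity), exp_neg_nat_mul, pow_one, ENNReal.ofReal_natCast]
  rw [e]
  refine ENNReal.ofReal_le_ofReal ?_
  rw [le_div_iff₀ (by positivity)]
  norm_num [Nat.factorial] at h
  linarith

theorem exp_neg_pow_succ (t : ℝ) (j : ℕ) :
    Real.exp (-t) ^ (j + 1) = Real.exp (-(((j : ℝ) + 1) * t)) := by
  rw [← exp_neg_nat_mul]; push_cast; rfl

theorem summable_inv_succ_sq : Summable fun j : ℕ => 1 / ((j : ℝ) + 1) ^ 2 := by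
  refine ((summable_nat_add_iff 1).2 (Real.summable_one_div_nat_pow.2 one_lt_two)).congr fun j => ?_
  push_cast; rfl

/-- The sum of the inverse squares. -/
noncomputable def invSqSum : ℝ := ∑' j : ℕ, 1 / ((j : ℝ) + 1) ^ 2

theorem invSqSum_nonneg : 0 ≤ invSqSum := tsum_nonneg fun j => by positivity

theorem tsum_ofReal_le {f : ℕ → ℝ≥0∞} {c : ℝ} (hc : 0 ≤ c)
    (h : ∀ j, f j ≤ ENNReal.ofReal (c * (1 / ((j : ℝ) + 1) ^ 2))) :
    ∑' j, f j ≤ ENNReal.ofReal (c * invSqSum) := by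
  rw [invSqSum, ← tsum_mul_left, ENNReal.ofReal_tsum_of_nonneg (fun j => by positivity)
    (summable_inv_succ_sq.mul_left c)]
  exact ENNReal.tsum_le_tsum h

theorem one_div_cube_le (j : ℕ) : 1 / ((j : ℝ) + 1) ^ 3 ≤ 1 / ((j : ℝ) + 1) ^ 2 := by
  refine one_div_le_one_div_of_le (by positivity) (pow_le_pow_right₀ ?_ (by norm_num))
  have := j.cast_nonneg (α := ℝ)
  linarith

theorem sqTotal_exp_le {t : ℝ} (ht : 0 < t) :
    sqTotal (Real.exp (-t)) ≤ ENNReal.ofReal (16 / t ^ 3 * invSqSum) := by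
  refine tsum_ofReal_le (by positivity) fun j => ?_
  rw [exp_neg_pow_succ]
  refine (sqSum_exp_le (by positivity)).trans (ENNReal.ofReal_le_ofReal ?_)
  calc 16 / (((j : ℝ) + 1) * t) ^ 3 = 16 / t ^ 3 * (1 / ((j : ℝ) + 1) ^ 3) := by field_simp
    _ ≤ _ := mul_le_mul_of_nonneg_left (one_div_cube_le j) (by positivity)

theorem varTotal_exp_le {t : ℝ} (ht : 0 < t) :
    varTotal (Real.exp (-t)) ≤ ENNReal.ofReal (16 / t ^ 3 * invSqSum) := by
  refine tsum_ofReal_le (by positivity) fun j => ?_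
  rw [exp_neg_pow_succ]
  have e : ((j : ℝ≥0∞) + 1) = ENNReal.ofReal ((j : ℝ) + 1) := by
    rw [ENNReal.ofReal_add (by positivity) zero_le_one, ENNReal.ofReal_natCast, ENNReal.ofReal_one]
  calc _ ≤ ENNReal.ofReal ((j : ℝ) + 1) * ENNReal.ofReal (16 / (((j : ℝ) + 1) * t) ^ 3) := by
        rw [e]
        exact mul_le_mul' le_rfl ((linSum_le_sqSum _).trans (sqSum_exp_le (by positivity)))
    _ = _ := by
        rw [← ENNReal.ofReal_mul (by positivity)]
        congr 1
        field_simp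

theorem linTotal_exp_le {t : ℝ} (ht : 0 < t) :
    linTotal (Real.exp (-t)) ≤ ENNReal.ofReal (4 / t ^ 2 * invSqSum) := by
  refine tsum_ofReal_le (by positivity) fun j => ?_
  rw [exp_neg_pow_succ]
  refine (linSum_exp_le (by positivity)).trans (ENNReal.ofReal_le_ofReal (le_of_eq ?_))
  field_simp

/-- The size is of order `t^{-3}` and the number of words of order `t^{-2}`. Splitting the sorting
cost at the value `t` gives `t * t^{-4}` and `t^{-1} * t^{-2}`, so sorting is also `O(t^{-3})`. -/
theorem exists_expectedCost_trial_le : ∃ C, 0 < C ∧ ∀ t : ℝ, 0 < t → t ≤ 1 →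
    (trial (Real.exp (-t))).expectedCost ≤ ENNReal.ofReal (C / t ^ 3) := by
  have hZ := invSqSum_nonneg
  refine ⟨6 + 24 * (16 * invSqSum) + 6 * ((4 * invSqSum) ^ 2 + 16 * invSqSum) + 4 * invSqSum,
    by positivity, fun t ht ht1 => ?_⟩
  have hx1 : Real.exp (-t) < 1 := by rw [Real.exp_lt_one_iff]; linarith
  refine (expectedCost_trial_le (Real.exp_pos _) hx1 ht).trans ?_
  calc _ ≤ 6 + 24 * ENNReal.ofReal (16 / t ^ 3 * invSqSum) +
          6 * ENNReal.ofReal t * (ENNReal.ofReal (4 / t ^ 2 * invSqSum) ^ 2 +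
            ENNReal.ofReal (16 / t ^ 3 * invSqSum)) +
          (ENNReal.ofReal t)⁻¹ * ENNReal.ofReal (4 / t ^ 2 * invSqSum) := by
        gcongr
        · exact sqTotal_exp_le ht
        · exact linTotal_exp_le ht
        · exact varTotal_exp_le ht
        · exact linTotal_exp_le ht
    _ = ENNReal.ofReal (6 + 24 * (16 / t ^ 3 * invSqSum) +
          6 * t * ((4 / t ^ 2 * invSqSum) ^ 2 + 16 / t ^ 3 * invSqSum) +
          t⁻¹ * (4 / t ^ 2 * invSqSum)) := by
        rw [ENNReal.ofReal_add (by positivity) (by positivity),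
          ENNReal.ofReal_add (by positivity) (by positivity),
          ENNReal.ofReal_add (by positivity) (by positivity),
          ENNReal.ofReal_mul (p := 24) (by positivity),
          ENNReal.ofReal_mul (p := 6 * t) (by positivity), ENNReal.ofReal_mul (p := 6) (by positivity),
          ENNReal.ofReal_add (p := (4 / t ^ 2 * invSqSum) ^ 2) (by positivity) (by positivity),
          ENNReal.ofReal_pow (by positivity), ENNReal.ofReal_mul (p := t⁻¹) (by positivity),
          ENNReal.ofReal_inv_of_pos ht]
        norm_num
    _ ≤ _ := by
        refine ENNReal.ofReal_le_ofReal ?_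
        rw [le_div_iff₀ (by positivity)]
        have e : (6 + 24 * (16 / t ^ 3 * invSqSum) +
            6 * t * ((4 / t ^ 2 * invSqSum) ^ 2 + 16 / t ^ 3 * invSqSum) +
            t⁻¹ * (4 / t ^ 2 * invSqSum)) * t ^ 3 =
            6 * t ^ 3 + 24 * (16 * invSqSum) + 6 * ((4 * invSqSum) ^ 2 + 16 * invSqSum * t) +
              4 * invSqSum := by
          field_simp
        rw [e]
        have h3 : t ^ 3 ≤ 1 := pow_le_one₀ ht.le ht1
        nlinarith

/-- The argument yields `O(n^{5/3})`; the iterated logarithm, eventually at least `1`, is inserted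
only to match the stated bound. -/
theorem eventually_rpow_le_log_log : ∀ᶠ n : ℕ in atTop,
    (n : ℝ) ^ (5 / 3 : ℝ) ≤ (n : ℝ) ^ (5 / 3 : ℝ) * Real.log (Real.log n) := by
  have h : Tendsto (fun n : ℕ => Real.log (Real.log n)) atTop atTop :=
    Real.tendsto_log_atTop.comp (Real.tendsto_log_atTop.comp tendsto_natCast_atTop_atTop)
  filter_upwards [h.eventually_ge_atTop 1] with n hn
  exact le_mul_of_one_le_right (by positivity) hn

theorem tendsto_expectedTrials {x : ℕ → ℝ} (hx : ∀ n : ℕ, 1 ≤ n → x n ∈ Set.Ioo (0 : ℝ) 1)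
    (hcal : (fun n : ℕ => meanSize (x n) - n) =o[atTop] fun n : ℕ => (n : ℝ) ^ (2 / 3 : ℝ)) :
    Tendsto (fun n : ℕ => expectedTrials (x n) n / ENNReal.ofReal ((n : ℝ) ^ (2 / 3 : ℝ)))
      atTop (𝓝 (ENNReal.ofReal kappa)) ∧
    ∃ C : ℝ, ∀ᶠ n : ℕ in atTop, (exactSampler (x n) n).expectedCost ≤
      ENNReal.ofReal (C * ((n : ℝ) ^ (5 / 3 : ℝ) * Real.log (Real.log n))) := by
  have hk := kappa_pos
  have hz := zetaRatio_pos
  have hpos : ∀ᶠ n in atTop, 0 < -Real.log (x n) := by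
    filter_upwards [eventually_ge_atTop 1] with n hn
    exact neg_pos.2 (Real.log_neg (hx n hn).1 (hx n hn).2)
  have hcal' : (fun n : ℕ => moment 1 (-Real.log (x n)) - n) =o[atTop]
      fun n : ℕ => (n : ℝ) ^ (2 / 3 : ℝ) := by
    refine hcal.congr' ?_ EventuallyEq.rfl
    filter_upwards [eventually_ge_atTop 1] with n hn
    rw [meanSize_eq_moment (hx n hn).1 (hx n hn).2]
  have hexp : ∀ n, 1 ≤ n → Real.exp (- -Real.log (x n)) = x n := fun n hn => by
    rw [neg_neg, Real.exp_log (hx n hn).1]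
  have hp := tendsto_sizeProb_mul_rpow hpos hcal'
  constructor
  · have h1 := ENNReal.tendsto_ofReal (hp.inv₀ (inv_ne_zero hk.ne'))
    rw [inv_inv] at h1
    refine h1.congr' ?_
    filter_upwards [eventually_ge_atTop 1] with n hn
    have hs := sizeProb_pos (hx n hn).1 (hx n hn).2 n
    have hn' : (0 : ℝ) < (n : ℝ) ^ (2 / 3 : ℝ) := by positivity
    rw [hexp n hn, expectedTrials_eq (hx n hn).1 (hx n hn).2, mul_inv,
      ENNReal.ofReal_mul (by positivity), ENNReal.ofReal_inv_of_pos hs,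
      ENNReal.ofReal_inv_of_pos hn']
    exact (div_eq_mul_inv _ _).symm
  · obtain ⟨C, hC, htrial⟩ := exists_expectedCost_trial_le
    -- Eventually there are at most `2 κ n^{2/3}` trials on average, and `n t³`, with limit `2 *
    -- zetaRatio`, exceeds `zetaRatio`, so a trial costs at most `C n / zetaRatio`.
    refine ⟨C / zetaRatio * (2 * kappa), ?_⟩
    have h1 : ∀ᶠ n : ℕ in atTop, (2 * kappa)⁻¹ <
        sizeProb (Real.exp (- -Real.log (x n))) n * (n : ℝ) ^ (2 / 3 : ℝ) :=
      hp.eventually_const_lt (inv_strictAnti₀ hk (by linarith))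
    have h2 : ∀ᶠ n : ℕ in atTop, zetaRatio < n * (-Real.log (x n)) ^ 3 :=
      (tendsto_nat_mul_cube hpos hcal').eventually_const_lt (by linarith)
    have h3 : ∀ᶠ n : ℕ in atTop, -Real.log (x n) ≤ 1 :=
      (tendsto_parameter hpos hcal').eventually_le_const one_pos
    filter_upwards [h1, h2, h3, hpos, eventually_ge_atTop 1, eventually_rpow_le_log_log] with
      n h1 h2 h3 h4 hn hlog
    have hs := sizeProb_pos (hx n hn).1 (hx n hn).2 n
    have hn' : (0 : ℝ) < (n : ℝ) ^ (2 / 3 : ℝ) := by positivity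
    have ht := htrial _ h4 h3
    rw [hexp n hn] at h1 ht
    rw [expectedCost_exactSampler (hx n hn).1 (hx n hn).2, ← ENNReal.ofReal_inv_of_pos hs]
    refine (mul_le_mul' le_rfl ht).trans ?_
    rw [← ENNReal.ofReal_mul (by positivity)]
    refine ENNReal.ofReal_le_ofReal ?_
    have e1 : (sizeProb (x n) n)⁻¹ ≤ 2 * kappa * (n : ℝ) ^ (2 / 3 : ℝ) := by
      rw [inv_le_comm₀ hs (by positivity), mul_inv, ← div_eq_mul_inv, div_le_iff₀ hn']
      exact h1.le
    have e2 : C / (-Real.log (x n)) ^ 3 ≤ C / zetaRatio * n := by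
      rw [div_le_iff₀ (by positivity), mul_assoc]
      calc C = C / zetaRatio * zetaRatio := by field_simp
        _ ≤ _ := by gcongr
    have e3 : (n : ℝ) ^ (2 / 3 : ℝ) * n = (n : ℝ) ^ (5 / 3 : ℝ) := by
      rw [← Real.rpow_add_one (by positivity)]
      norm_num
    calc _ ≤ 2 * kappa * (n : ℝ) ^ (2 / 3 : ℝ) * (C / zetaRatio * n) := by gcongr
      _ = C / zetaRatio * (2 * kappa) * ((n : ℝ) ^ (2 / 3 : ℝ) * n) := by ring
      _ ≤ _ := by rw [e3]; gcongr

end NWPath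

theorem mainTheorem6 :
    (∀ x ∈ Set.Ioo (0 : ℝ) 1,
      NWPath.IsBoltzmannSampler (NWPath.freeSampler x) x ∧
      ∀ n : ℕ, (NWPath.exactSampler x n).haltProb = 1) ∧
    (∀ n : ℕ, 1 ≤ n → ∃! x : ℝ, x ∈ Set.Ioo (0 : ℝ) 1 ∧ NWPath.meanSize x = n) ∧
    |NWPath.kappa - 4.0755| < 0.0001 ∧
    ∀ x : ℕ → ℝ, (∀ n : ℕ, 1 ≤ n → x n ∈ Set.Ioo (0 : ℝ) 1) →
      (fun n : ℕ => NWPath.meanSize (x n) - n) =o[atTop] (fun n : ℕ => (n : ℝ) ^ (2 / 3 : ℝ)) →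
      Tendsto
        (fun n : ℕ => NWPath.expectedTrials (x n) n / ENNReal.ofReal ((n : ℝ) ^ (2 / 3 : ℝ)))
        atTop (𝓝 (ENNReal.ofReal NWPath.kappa)) ∧
      ∃ C : ℝ, ∀ᶠ n : ℕ in atTop,
        (NWPath.exactSampler (x n) n).expectedCost ≤
          ENNReal.ofReal (C * ((n : ℝ) ^ (5 / 3 : ℝ) * Real.log (Real.log n))) :=
  ⟨fun _ hx => ⟨NWPath.isBoltzmannSampler_freeSampler hx.1 hx.2,
      NWPath.haltProb_exactSampler hx.1 hx.2⟩,
    fun _ hn => NWPath.existsUnique_meanSize hn, NWPath.abs_kappa_sub_lt,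
    fun _ hx hcal => NWPath.tendsto_expectedTrials hx hcal⟩
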